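/- Let $L\to M$ be a (smooth, real) line bundle, $DL$ its gauge algebroid (whose fibre $D_xL$ consists of the $\mathbb R$-linear maps $\Delta:\Gamma(L)\to L_x$ with $\Delta(f\lambda)=v(f)\lambda_x+f(x)\Delta\lambda$ for some $v=\sigma(\Delta)\in T_xM$), $J^1L=\mathrm{Hom}(DL,L)$, and $\mathbb DL=DL\oplus J^1L$ the omni-Lie algebroid with the $L$-valued pairing $\langle\!\langle(\Delta,\psi),(\square,\chi)\rangle\!\rangle=\langle\chi,\Delta\rangle+\langle\psi,\square\rangle$ and the bracket $[\![(\Delta,\psi),(\square,\chi)]\!]=([\Delta,\square],\mathcal L_\Delta\chi-\iota_\square d_D\psi)$. Let $\mathbb K:\mathbb DL\to\mathbb DL$ be a generalized contact structure, i.e. $\mathbb K^2=-\mathrm{id}$, $\mathbb K$ is skew-symmetric with respect to $\langle\!\langle-,-\rangle\!\rangle$, and $[\![\mathbb K\alpha,\mathbb K\beta]\!]-[\![\alpha,\beta]\!]-\mathbb K[\![\mathbb K\alpha,\beta]\!]-\mathbb K[\![\alpha,\mathbb K\beta]\!]=0$ for all $\alpha,\beta\in\Gamma(\mathbb DL)$.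 Let $\mathfrak L\subset\mathbb DL\otimes\mathbb C$ be its $+\mathrm i$-eigenbundle, and let $J^\sharp:J^1L\to DL$, $J^\sharp\psi=\mathrm{pr}_{DL}\mathbb K(0,\psi)$, be the underlying Jacobi structure; its characteristic leaves are the maximal connected integral manifolds of $\operatorname{im}(\sigma\circ J^\sharp)\subset TM$. Let $\mathcal O$ be an even dimensional characteristic leaf, $x_0\in\mathcal O$, and let $N\hookrightarrow M$ be an (immersed) submanifold through $x_0$ with $T_{x_0}M=T_{x_0}N\oplus T_{x_0}\mathcal O$. Then there is an open neighbourhood $U$ of $x_0$ in $N$ such that, with $I_U:L_U:=L|_U\to L$ the inclusion, the backward image $$I_U^!\mathfrak L=\{(\Delta,I_U^*\psi)\in\mathbb DL_U\otimes\mathbb C : ((I_U)_*\Delta,\psi)\in\mathfrak L\}$$ is a complex Dirac–Jacobi structure (a smooth, maximally isotropic, involutive complex subbundle of $\mathbb DL_U\otimes\mathbb C$) of generalized contact type, i.e. $I_U^!\mathfrak L\cap\overline{I_U^!\mathfrak L}=0$. Moreover $I_U^!\mathfrak L$ is the $+\mathrm i$-eigenbundle of a generalized contact structure on $L_U$. 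-/

import Mathlib

open scoped Manifold ContDiff Bundle TensorProduct Topology

namespace GenContact

noncomputable section

open Bundle VectorField

/-! ### Vector fields -/

section VectorFields

/-- Smooth vector fields on an `m`-dimensional manifold `M`. -/
abbrev VField (m : ℕ) (M : Type*) [TopologicalSpace M]
    [ChartedSpace (EuclideanSpace ℝ (Fin m)) M] [IsManifold (𝓡 m) ∞ M] : Type _ :=
  Cₛ^∞⟮𝓡 m; EuclideanSpace ℝ (Fin m), (TangentSpace (𝓡 m) : M → Type _)⟯

variable {m : ℕ} {M : Type*} [TopologicalSpace M] [ChartedSpace (EuclideanSpace ℝ (Fin m)) M]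
  [IsManifold (𝓡 m) ∞ M]

theorem contMDiff_mvfderiv_apply {f : M → ℝ} (hf : ContMDiff (𝓡 m) 𝓘(ℝ, ℝ) ∞ f)
    (X : VField m M) :
    ContMDiff (𝓡 m) 𝓘(ℝ, ℝ) ∞ (fun x => mvfderiv (𝓡 m) f x (X x)) := by
  have h1 : ContMDiff (𝓡 m).tangent 𝓘(ℝ, ℝ).tangent ∞ (tangentMap (𝓡 m) 𝓘(ℝ, ℝ) f) :=
    hf.contMDiff_tangentMap (by simp)
  exact (contMDiff_snd_tangentBundle_modelSpace ℝ 𝓘(ℝ, ℝ)).comp (h1.comp X.contMDiff)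

theorem mvfderiv_mlieBracket {f : M → ℝ} (hf : ContMDiff (𝓡 m) 𝓘(ℝ, ℝ) ∞ f)
    (X Y : VField m M) (x : M) :
    mvfderiv (𝓡 m) f x (mlieBracket (𝓡 m) X Y x) =
      mvfderiv (𝓡 m) (fun y => mvfderiv (𝓡 m) f y (Y y)) x (X x) -
      mvfderiv (𝓡 m) (fun y => mvfderiv (𝓡 m) f y (X y)) x (Y x) := by
  by_cases hs : Subsingleton (EuclideanSpace ℝ (Fin m))
  · have h0 : ∀ v : TangentSpace (𝓡 m) x, v = 0 := fun v => hs.elim v 0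
    rw [h0 (mlieBracket (𝓡 m) X Y x), h0 (X x), h0 (Y x)]
    simp
  rw [not_subsingleton_iff_nontrivial] at hs
  obtain ⟨z, hz⟩ := exists_ne (0 : EuclideanSpace ℝ (Fin m))
  let Z : Π y : M, TangentSpace (𝓡 m) y :=
    FiberBundle.extend (EuclideanSpace ℝ (Fin m)) (x := x) (z : TangentSpace (𝓡 m) x)
  have hZx : Z x = z := FiberBundle.extend_apply_self ..
  have hZ : ContMDiffAt (𝓡 m) (𝓡 m).tangent ∞ (fun y => (Z y : TangentBundle (𝓡 m) M)) x :=
    FiberBundle.contMDiffAt_extend ..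
  have hX := X.contMDiff
  have hY := Y.contMDiff
  have h2 : (2 : ℕ∞ω) ≤ ∞ := by
    have : (((2 : ℕ) : ℕ∞) : ℕ∞ω) ≤ ((⊤ : ℕ∞) : ℕ∞ω) := WithTop.coe_le_coe.2 le_top
    simpa using this
  have h3 : (3 : ℕ∞ω) ≤ ∞ := by
    have : (((3 : ℕ) : ℕ∞) : ℕ∞ω) ≤ ((⊤ : ℕ∞) : ℕ∞ω) := WithTop.coe_le_coe.2 le_top
    simpa using this
  have : IsManifold (𝓡 m) (minSmoothness ℝ 2) M := IsManifold.of_le (n := ∞) (by simpa using h2)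
  have : IsManifold (𝓡 m) (minSmoothness ℝ 3) M := IsManifold.of_le (n := ∞) (by simpa using h3)
  have two : (minSmoothness ℝ 2) ≤ ∞ := by simpa using h2
  have hone : (∞ : ℕ∞ω) ≠ 0 := by simp
  have hZev : ∀ᶠ y in 𝓝 x, MDifferentiableAt (𝓡 m) (𝓡 m).tangent
      (fun y => (Z y : TangentBundle (𝓡 m) M)) y := by
    have : IsManifold (𝓡 m) 2 M := IsManifold.of_le (n := ∞) h2
    have := (contMDiffAt_iff_contMDiffAt_nhds (n := 2) (by simp)).1 (hZ.of_le h2)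
    filter_upwards [this] with y hy using hy.mdifferentiableAt (by simp)
  have hfd : ∀ y, MDifferentiableAt (𝓡 m) 𝓘(ℝ, ℝ) f y := fun y => (hf y).mdifferentiableAt hone
  have hd : ∀ V : VField m M,
      MDifferentiableAt (𝓡 m) 𝓘(ℝ, ℝ) (fun y => mvfderiv (𝓡 m) f y (V y)) x :=
    fun V => (contMDiff_mvfderiv_apply hf V x).mdifferentiableAt hone
  have hfZ : ContMDiffAt (𝓡 m) (𝓡 m).tangent ∞ (fun y => ((f • Z) y : TangentBundle (𝓡 m) M)) x :=
    (hf x).smul_section hZ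
  have key : ∀ V : VField m M,
      mlieBracket (𝓡 m) V (f • Z) =ᶠ[𝓝 x]
        (fun y => mvfderiv (𝓡 m) f y (V y)) • Z + f • mlieBracket (𝓡 m) V Z := by
    intro V
    filter_upwards [hZev] with y hy
    rw [mlieBracket_smul_right (hfd y) hy]
    rfl
  have hb : ∀ V : VField m M,
      MDifferentiableAt (𝓡 m) (𝓡 m).tangent
        (fun y => (mlieBracket (𝓡 m) V Z y : TangentBundle (𝓡 m) M)) x := by
    intro V
    have : IsManifold (𝓡 m) (((2 : ℕ∞) : ℕ∞ω) + 1) M := IsManifold.of_le (n := ∞) (by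
      refine le_trans (le_of_eq ?_) h3
      norm_num)
    have : ContMDiffAt (𝓡 m) (𝓡 m).tangent ((1 : ℕ∞) : ℕ∞ω)
        (fun y => (mlieBracket (𝓡 m) V Z y : TangentBundle (𝓡 m) M)) x :=
      ContMDiffAt.mlieBracket_vectorField (n := (2 : ℕ∞)) (m := (1 : ℕ∞))
        ((V.contMDiff x).of_le h2) (hZ.of_le h2)
        (by simp; norm_num)
    exact this.mdifferentiableAt (by simp)
  have hZ1 := hZ.mdifferentiableAt hone
  have expand : ∀ U V : VField m M,
      mlieBracket (𝓡 m) U (mlieBracket (𝓡 m) V (f • Z)) x =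
        mvfderiv (𝓡 m) (fun y => mvfderiv (𝓡 m) f y (V y)) x (U x) • Z x
          + mvfderiv (𝓡 m) f x (V x) • mlieBracket (𝓡 m) U Z x
          + (mvfderiv (𝓡 m) f x (U x) • mlieBracket (𝓡 m) V Z x
          + f x • mlieBracket (𝓡 m) U (mlieBracket (𝓡 m) V Z) x) := by
    intro U V
    rw [Filter.EventuallyEq.mlieBracket_vectorField_eq (V := ⇑U) (Filter.EventuallyEq.refl _ _) (key V),
      mlieBracket_add_right, mlieBracket_smul_right (hd V) hZ1,
      mlieBracket_smul_right (hfd x) (hb V)]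
    · exact (hd V).smul_section hZ1
    · exact (hfd x).smul_section (hb V)
  have J1 := leibniz_identity_mlieBracket_apply (hX.contMDiffAt.of_le two)
    (hY.contMDiffAt.of_le two) (hfZ.of_le two)
  have J2 := leibniz_identity_mlieBracket_apply (hX.contMDiffAt.of_le two)
    (hY.contMDiffAt.of_le two) (hZ.of_le two)
  rw [expand X Y, expand Y X, mlieBracket_smul_right (hfd x) hZ1, J2] at J1
  have J3 : (mvfderiv (𝓡 m) f x (mlieBracket (𝓡 m) X Y x) -
      (mvfderiv (𝓡 m) (fun y => mvfderiv (𝓡 m) f y (Y y)) x (X x) -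
      mvfderiv (𝓡 m) (fun y => mvfderiv (𝓡 m) f y (X y)) x (Y x))) • Z x = 0 := by
    rw [sub_smul, sub_smul, sub_eq_zero, eq_comm, ← sub_eq_zero]
    rw [← sub_eq_zero] at J1
    rw [← J1]
    simp only [smul_add]
    abel
  rw [smul_eq_zero, hZx] at J3
  exact sub_eq_zero.1 (J3.resolve_right hz)

/-- The derivative `X(f)` of a smooth function along a smooth vector field. -/
def vfDeriv (X : VField m M) (f : C^∞⟮𝓡 m, M; ℝ⟯) : C^∞⟮𝓡 m, M; ℝ⟯ :=
  ⟨fun x => mvfderiv (𝓡 m) f x (X x), contMDiff_mvfderiv_apply f.contMDiff X⟩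

/-- The Lie bracket of two smooth vector fields. -/
def vfBracket (X Y : VField m M) : VField m M :=
  ⟨fun x => mlieBracket (𝓡 m) X Y x, by
    have hk : ∀ j : ℕ, ((j : ℕ∞) : ℕ∞ω) ≤ ∞ := fun j => WithTop.coe_le_coe.2 le_top
    rw [contMDiff_infty]
    intro k x
    have : IsManifold (𝓡 m) ((((k + 1 : ℕ) : ℕ∞) : ℕ∞ω) + 1) M :=
      IsManifold.of_le (n := ∞) (by exact_mod_cast hk (k + 1 + 1))
    have : IsManifold (𝓡 m) (minSmoothness ℝ 2) M :=
      IsManifold.of_le (n := ∞) (by simpa using hk 2)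
    have := ContMDiffAt.mlieBracket_vectorField (n := ((k + 1 : ℕ) : ℕ∞)) (m := (k : ℕ∞))
      ((X.contMDiff x).of_le (hk _)) ((Y.contMDiff x).of_le (hk _)) (by simp)
    exact this⟩

end VectorFields

/-! ### The gauge algebroid, first jets and the omni-Lie algebroid of a line bundle -/

section LineBundle

variable (m : ℕ) {M : Type*} [TopologicalSpace M] [ChartedSpace (EuclideanSpace ℝ (Fin m)) M]
  (L : M → Type*) [TopologicalSpace (TotalSpace ℝ L)] [∀ x, AddCommGroup (L x)]
  [∀ x, Module ℝ (L x)] [∀ x, TopologicalSpace (L x)] [FiberBundle ℝ L] [VectorBundle ℝ ℝ L]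

/-- The space `Γ(L)` of smooth sections of a line bundle `L → M`. -/
abbrev Sec : Type _ := Cₛ^∞⟮𝓡 m; ℝ, L⟯

variable {m L} in
/-- The product of a smooth function and a smooth section. -/
def fsmul (f : C^∞⟮𝓡 m, M; ℝ⟯) (l : Sec m L) : Sec m L :=
  ⟨fun x => f x • l x, f.contMDiff.smul_section l.contMDiff⟩

/-- Evaluation of sections of `L` at `x`. -/
def evalSec (x : M) : Sec m L →ₗ[ℝ] L x where
  toFun l := l x
  map_add' _ _ := rfl
  map_smul' _ _ := rfl

variable {m L} in
/-- The Leibniz rule `Δ(f λ) = v(f) λ(x) + f(x) Δ(λ)` for an `ℝ`-linear map `Δ : Γ(L) → L_x`: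
the tangent vector `v` is the symbol of `Δ`. -/
def IsSymbol {x : M} (Δ : Sec m L →ₗ[ℝ] L x) (v : TangentSpace (𝓡 m) x) : Prop :=
  ∀ (f : C^∞⟮𝓡 m, M; ℝ⟯) (l : Sec m L),
    Δ (fsmul f l) = mvfderiv (𝓡 m) f x v • l x + f x • Δ l

variable {m L} in
theorem IsSymbol.add {x : M} {Δ E : Sec m L →ₗ[ℝ] L x} {v w : TangentSpace (𝓡 m) x}
    (h : IsSymbol Δ v) (k : IsSymbol E w) : IsSymbol (Δ + E) (v + w) := fun f l => by
  simp only [LinearMap.add_apply, h f l, k f l, map_add, add_smul, smul_add]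
  abel

variable {m L} in
theorem IsSymbol.smul {x : M} (c : ℝ) {Δ : Sec m L →ₗ[ℝ] L x} {v : TangentSpace (𝓡 m) x}
    (h : IsSymbol Δ v) : IsSymbol (c • Δ) (c • v) := fun f l => by
  simp only [LinearMap.smul_apply, h f l, map_smul, smul_eq_mul, smul_add, mul_smul,
    smul_comm c (f x)]

variable {m L} in
theorem IsSymbol.zero (x : M) : IsSymbol (0 : Sec m L →ₗ[ℝ] L x) 0 := fun f l => by
  simp

/-- The fibre `D_x L` of the gauge algebroid: `ℝ`-linear maps `Γ(L) → L_x` satisfying the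
Leibniz rule for some symbol in `T_x M`. -/
def GaugeFiber (x : M) : Submodule ℝ (Sec m L →ₗ[ℝ] L x) where
  carrier := {Δ | ∃ v : TangentSpace (𝓡 m) x, IsSymbol Δ v}
  add_mem' := fun ⟨v, hv⟩ ⟨w, hw⟩ => ⟨v + w, hv.add hw⟩
  zero_mem' := ⟨0, IsSymbol.zero x⟩
  smul_mem' := fun c _ ⟨v, hv⟩ => ⟨c • v, hv.smul c⟩

/-- The fibre `J¹_x L = Hom(D_x L, L_x)` of the first jet bundle. -/
abbrev JetFiber (x : M) : Type _ := GaugeFiber m L x →ₗ[ℝ] L x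

/-- The fibre `D_x L ⊕ J¹_x L` of the omni-Lie algebroid. -/
abbrev OmniFiber (x : M) : Type _ := GaugeFiber m L x × JetFiber m L x

/-- The symmetric `L`-valued form `⟪(Δ, ψ), (∇, χ)⟫ = ⟨χ, Δ⟩ + ⟨ψ, ∇⟩` on the omni-Lie
algebroid. -/
def pairing (x : M) : LinearMap.BilinMap ℝ (OmniFiber m L x) (L x) :=
  LinearMap.mk₂ ℝ (fun a b => b.2 a.1 + a.2 b.1)
    (fun a a' b => by simp; abel) (fun c a b => by simp)
    (fun a b b' => by simp; abel) (fun c a b => by simp)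

variable [IsManifold (𝓡 m) ∞ M]

/-- The space `Γ(DL)` of derivations of `L`: `ℝ`-linear operators `Δ` on `Γ(L)` with
`Δ(f λ) = X(f) λ + f Δ(λ)` for some smooth vector field `X`. -/
def Gauge : Submodule ℝ (Module.End ℝ (Sec m L)) where
  carrier := {Δ | ∃ X : VField m M, ∀ x, IsSymbol (evalSec m L x ∘ₗ Δ) (X x)}
  add_mem' := fun ⟨X, hX⟩ ⟨Y, hY⟩ => ⟨X + Y, fun x => (hX x).add (hY x)⟩
  zero_mem' := ⟨0, fun x => IsSymbol.zero x⟩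
  smul_mem' := fun c _ ⟨X, hX⟩ => ⟨c • X, fun x => (hX x).smul c⟩

/-- The value at `x` of a derivation. -/
def gaugeEval (x : M) : Gauge m L →ₗ[ℝ] GaugeFiber m L x where
  toFun Δ := ⟨evalSec m L x ∘ₗ Δ.1, by obtain ⟨X, hX⟩ := Δ.2; exact ⟨X x, hX x⟩⟩
  map_add' _ _ := rfl
  map_smul' _ _ := by ext; simp

variable {m L} in
theorem commutator_mem_gauge {Δ E : Module.End ℝ (Sec m L)} (hΔ : Δ ∈ Gauge m L)
    (hE : E ∈ Gauge m L) : Δ * E - E * Δ ∈ Gauge m L := by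
  obtain ⟨X, hX⟩ := hΔ
  obtain ⟨Y, hY⟩ := hE
  refine ⟨vfBracket X Y, fun x f l => ?_⟩
  have expand : ∀ (D : Module.End ℝ (Sec m L)) (V : VField m M),
      (∀ x, IsSymbol (evalSec m L x ∘ₗ D) (V x)) → ∀ (f : C^∞⟮𝓡 m, M; ℝ⟯) (l : Sec m L),
      D (fsmul f l) = fsmul (vfDeriv V f) l + fsmul f (D l) := by
    intro D V hD f l
    ext y
    exact hD y f l
  change (Δ (E (fsmul f l)) - E (Δ (fsmul f l))) x =
    mvfderiv (𝓡 m) f x (mlieBracket (𝓡 m) X Y x) • l x + f x • (Δ (E l) - E (Δ l)) x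
  rw [expand E Y hY, expand Δ X hX, map_add, map_add, expand Δ X hX, expand Δ X hX,
    expand E Y hY, expand E Y hY, mvfderiv_mlieBracket f.contMDiff X Y x]
  change (mvfderiv (𝓡 m) (vfDeriv Y f) x (X x) • l x + vfDeriv Y f x • Δ l x +
      (vfDeriv X f x • E l x + f x • Δ (E l) x)) -
    (mvfderiv (𝓡 m) (vfDeriv X f) x (Y x) • l x + vfDeriv X f x • E l x +
      (vfDeriv Y f x • Δ l x + f x • E (Δ l) x)) =
    (mvfderiv (𝓡 m) (vfDeriv Y f) x (X x) - mvfderiv (𝓡 m) (vfDeriv X f) x (Y x)) • l x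
      + f x • (Δ (E l) x - E (Δ l) x)
  simp only [sub_smul, smul_sub]
  abel

/-- The commutator `[Δ, ∇] = Δ ∘ ∇ - ∇ ∘ Δ` of derivations. -/
def gaugeBracket : Gauge m L →ₗ[ℝ] Gauge m L →ₗ[ℝ] Gauge m L :=
  LinearMap.mk₂ ℝ (fun Δ E => ⟨Δ.1 * E.1 - E.1 * Δ.1, commutator_mem_gauge Δ.2 E.2⟩)
    (fun a a' b => by ext1; simp [add_mul, mul_add]; abel)
    (fun c a b => by ext1; simp [smul_sub])
    (fun a b b' => by ext1; simp [add_mul, mul_add]; abel)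
    (fun c a b => by ext1; simp [smul_sub])

/-- The space `Γ(J¹L)`: families `ψ_x ∈ J¹_x L` such that `⟨ψ, ∇⟩` is a smooth section of `L`
for every derivation `∇`. -/
def JetSec : Submodule ℝ (∀ x : M, JetFiber m L x) where
  carrier := {ψ | ∀ E : Gauge m L, ContMDiff (𝓡 m) ((𝓡 m).prod 𝓘(ℝ, ℝ)) ∞
    (fun x => TotalSpace.mk' ℝ x (ψ x (gaugeEval m L x E)))}
  add_mem' := fun h k E => (h E).add_section (k E)
  zero_mem' := fun _ => (0 : Sec m L).contMDiff
  smul_mem' := fun _ _ h E => (h E).const_smul_section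

/-- The pairing `Γ(J¹L) × Γ(DL) → Γ(L)`. -/
def jetPair : JetSec m L →ₗ[ℝ] Gauge m L →ₗ[ℝ] Sec m L :=
  LinearMap.mk₂ ℝ (fun ψ E => ⟨fun x => ψ.1 x (gaugeEval m L x E), ψ.2 E⟩)
    (fun a a' b => by ext; simp) (fun c a b => by ext; simp)
    (fun a b b' => by ext; simp) (fun c a b => by ext; simp)

/-- The space `Γ(DL ⊕ J¹L)` of smooth sections of the omni-Lie algebroid. -/
abbrev OmniSec : Type _ := Gauge m L × JetSec m L

/-- The value at `x` of a section of the omni-Lie algebroid. -/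
def omniEval (x : M) : OmniSec m L →ₗ[ℝ] OmniFiber m L x :=
  LinearMap.prodMap (gaugeEval m L x) (LinearMap.proj x ∘ₗ (JetSec m L).subtype)

/-- The value `⟨ℒ_Δ χ, ∇⟩ = Δ⟨χ, ∇⟩ - ⟨χ, [Δ, ∇]⟩` of the Lie derivative on `∇ ∈ Γ(DL)`. -/
def lieJet (Δ : Gauge m L) (χ : JetSec m L) : Gauge m L →ₗ[ℝ] Sec m L :=
  Δ.1 ∘ₗ jetPair m L χ - jetPair m L χ ∘ₗ gaugeBracket m L Δ

/-- The contraction `ι_E d_D ψ`: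
`d_D ψ (E, ∇) = E⟨ψ, ∇⟩ - ∇⟨ψ, E⟩ - ⟨ψ, [E, ∇]⟩` for `∇ ∈ Γ(DL)`. -/
def contractDJet (E : Gauge m L) (ψ : JetSec m L) : Gauge m L →ₗ[ℝ] Sec m L :=
  E.1 ∘ₗ jetPair m L ψ - LinearMap.applyₗ (jetPair m L ψ E) ∘ₗ (Gauge m L).subtype
    - jetPair m L ψ ∘ₗ gaugeBracket m L E

/-- The bracket `⟦(Δ, ψ), (E, χ)⟧ = ([Δ, E], ℒ_Δ χ - ι_E d_D ψ)` of sections of the omni-Lie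
algebroid. Its second component is given as a functional `Γ(DL) → Γ(L)`. -/
def dorfman : LinearMap.BilinMap ℝ (OmniSec m L) (Gauge m L × (Gauge m L →ₗ[ℝ] Sec m L)) :=
  LinearMap.mk₂ ℝ
    (fun α β => (gaugeBracket m L α.1 β.1, lieJet m L α.1 β.2 - contractDJet m L β.1 α.2))
    (fun a a' b => by
      ext1
      · simp
      · ext1 E
        simp [lieJet, contractDJet]
        abel)
    (fun c a b => by
      ext1
      · simp
      · ext1 E
        simp [lieJet, contractDJet, smul_sub])
    (fun a b b' => by
      ext1
      · simp
      · ext1 E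
        simp [lieJet, contractDJet]
        abel)
    (fun c a b => by
      ext1
      · simp
      · ext1 E
        simp [lieJet, contractDJet, smul_sub])

/-- A section `(Δ, ψ)` of the omni-Lie algebroid, with the section `ψ` of `J¹L` read as the
functional `∇ ↦ ⟨ψ, ∇⟩` on `Γ(DL)`. -/
def toFunctional : OmniSec m L →ₗ[ℝ] Gauge m L × (Gauge m L →ₗ[ℝ] Sec m L) :=
  LinearMap.prodMap LinearMap.id (jetPair m L)

/-! ### Generalized contact structures and complex Dirac-Jacobi structures -/

/-- A generalized contact structure on the line bundle `L`: a smooth endomorphism `K` of the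
omni-Lie algebroid (`fib` on the fibres, `sec` on sections) with `K² = -1`, skew-symmetric and
integrable. -/
structure GenContactStructure where
  fib : ∀ x : M, OmniFiber m L x →ₗ[ℝ] OmniFiber m L x
  sec : OmniSec m L →ₗ[ℝ] OmniSec m L
  eval_sec : ∀ (α : OmniSec m L) (x : M), omniEval m L x (sec α) = fib x (omniEval m L x α)
  sq : ∀ (x : M) (a : OmniFiber m L x), fib x (fib x a) = -a
  skew : ∀ (x : M) (a b : OmniFiber m L x),
    pairing m L x (fib x a) b + pairing m L x a (fib x b) = 0
  /-- `⟦Kα, Kβ⟧ - ⟦α, β⟧ - K(⟦Kα, β⟧ + ⟦α, Kβ⟧) = 0`, where `γ = ⟦Kα, β⟧ + ⟦α, Kβ⟧`. -/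
  integrable : ∀ α β : OmniSec m L, ∃ γ : OmniSec m L,
    toFunctional m L γ = dorfman m L (sec α) β + dorfman m L α (sec β) ∧
    dorfman m L (sec α) (sec β) - dorfman m L α β = toFunctional m L (sec γ)

/-- The complexified fibre `(D_x L ⊕ J¹_x L) ⊗ ℂ`. -/
abbrev OmniFiberC (x : M) : Type _ := ℂ ⊗[ℝ] OmniFiber m L x

/-- Smooth sections of the complexified omni-Lie algebroid. -/
abbrev OmniSecC : Type _ := ℂ ⊗[ℝ] OmniSec m L

/-- The value at `x` of a complex section. -/
def omniEvalC (x : M) : OmniSecC m L →ₗ[ℂ] OmniFiberC m L x :=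
  (omniEval m L x).baseChange ℂ

/-- Complex conjugation on `V ⊗ ℂ`. -/
def conjC (V : Type*) [AddCommGroup V] [Module ℝ V] : ℂ ⊗[ℝ] V →ₗ[ℝ] ℂ ⊗[ℝ] V :=
  TensorProduct.map Complex.conjAe.toLinearMap LinearMap.id

variable {m L} in
/-- A complex Dirac-Jacobi structure on `L`: a smooth complex subbundle of the complexified
omni-Lie algebroid which is maximally isotropic and involutive. -/
structure IsDiracJacobi (D : ∀ x : M, Submodule ℂ (OmniFiberC m L x)) : Prop where
  smooth : ∀ x : M, ∃ (k : ℕ) (s : Fin k → OmniSecC m L), ∀ᶠ y in 𝓝 x,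
    LinearIndependent ℂ (fun i => omniEvalC m L y (s i)) ∧
    Submodule.span ℂ (Set.range fun i => omniEvalC m L y (s i)) = D y
  maximal_isotropic : ∀ x : M, Maximal (fun W : Submodule ℂ (OmniFiberC m L x) =>
    ∀ a ∈ W, ∀ b ∈ W, (pairing m L x).baseChange ℂ a b = 0) (D x)
  involutive : ∀ α β : OmniSecC m L, (∀ x, omniEvalC m L x α ∈ D x) →
    (∀ x, omniEvalC m L x β ∈ D x) →
    ∃ γ : OmniSecC m L, (∀ x, omniEvalC m L x γ ∈ D x) ∧
      (toFunctional m L).baseChange ℂ γ = (dorfman m L).baseChange ℂ α β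

variable {m L} in
/-- A complex Dirac-Jacobi structure `D` is of generalized contact type if `D ∩ conj D = 0`. -/
def IsGenContactType (D : ∀ x : M, Submodule ℂ (OmniFiberC m L x)) : Prop :=
  IsDiracJacobi D ∧ ∀ (x : M), ∀ a ∈ D x, conjC (OmniFiber m L x) a ∈ D x → a = 0

namespace GenContactStructure

variable {m L} (K : GenContactStructure m L)

/-- The `+i`-eigenbundle of a generalized contact structure. -/
def eigenbundle (x : M) : Submodule ℂ (OmniFiberC m L x) :=
  Module.End.eigenspace ((K.fib x).baseChange ℂ) Complex.I

/-- The sharp map `J♯ : J¹_x L → D_x L` of the underlying Jacobi structure `J`, the upper right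
entry of `K`. -/
def sharp (x : M) : JetFiber m L x →ₗ[ℝ] GaugeFiber m L x :=
  LinearMap.fst ℝ _ _ ∘ₗ K.fib x ∘ₗ LinearMap.inr ℝ _ _

/-- The characteristic distribution `im (σ ∘ J♯) ⊆ TM` (`σ` being the symbol). -/
def charDistribution (x : M) : Set (TangentSpace (𝓡 m) x) :=
  {v | ∃ ψ : JetFiber m L x, IsSymbol (K.sharp x ψ).1 v}

end GenContactStructure

end LineBundle

/-! ### Pull-backs -/

section Pullback

instance pullbackAddCommGroup {N M : Type*} (φ : N → M) (L : M → Type*) [∀ x, AddCommGroup (L x)]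
    (y : N) : AddCommGroup ((φ *ᵖ L) y) :=
  inferInstanceAs (AddCommGroup (L (φ y)))

variable {m n : ℕ} {M N : Type*} [TopologicalSpace M]
  [ChartedSpace (EuclideanSpace ℝ (Fin m)) M] [TopologicalSpace N]
  [ChartedSpace (EuclideanSpace ℝ (Fin n)) N]
  (L : M → Type*) [TopologicalSpace (TotalSpace ℝ L)] [∀ x, AddCommGroup (L x)]
  [∀ x, Module ℝ (L x)] [∀ x, TopologicalSpace (L x)] [FiberBundle ℝ L] [VectorBundle ℝ ℝ L]
  (φ : C^∞⟮𝓡 n, N; 𝓡 m, M⟯)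

/-- The pull-back of a section of `L` along `φ`, a section of `φ^* L`. -/
def pullSec : Sec m L →ₗ[ℝ] Sec n (φ *ᵖ L) where
  toFun l := ⟨fun y => l (φ y), fun y₀ => by
    refine (contMDiffAt_section (E := φ *ᵖ L) (s := fun y => l (φ y)) y₀).2 ?_
    have h := l.contMDiff (φ y₀)
    rw [contMDiffAt_section] at h
    exact h.comp y₀ (φ.contMDiff y₀)⟩
  map_add' _ _ := rfl
  map_smul' _ _ := rfl

/-- `Φ_* : D_y (φ^* L) → D_{φ(y)} L`, `(Φ_* Δ)(λ) = Δ(Φ^* λ)`. -/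
def pushGauge (y : N) : GaugeFiber n (φ *ᵖ L) y →ₗ[ℝ] GaugeFiber m L (φ y) where
  toFun Δ := ⟨Δ.1 ∘ₗ pullSec L φ, by
    obtain ⟨v, hv⟩ := Δ.2
    refine ⟨mfderiv (𝓡 n) (𝓡 m) φ y v, fun f l => ?_⟩
    have h := hv (f.comp φ) (pullSec L φ l)
    have hc : mvfderiv (𝓡 n) (f.comp φ) y v
        = mvfderiv (𝓡 m) f (φ y) (mfderiv (𝓡 n) (𝓡 m) φ y v) :=
      mvfderiv_comp_apply (g := f) (f := φ) y
        ((f.contMDiff _).mdifferentiableAt (by simp))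
        ((φ.contMDiff _).mdifferentiableAt (by simp)) v
    rw [hc] at h
    exact h⟩
  map_add' _ _ := rfl
  map_smul' _ _ := rfl

/-- The backward image `Φ^! D = {(Δ, Φ^* ψ) : (Φ_* Δ, ψ) ∈ D}` along the canonical regular bundle
map `Φ : φ^* L → L`, where `Φ^* ψ = ψ ∘ Φ_*`. -/
def backwardImage (D : ∀ x : M, Submodule ℂ (OmniFiberC m L x)) (y : N) :
    Submodule ℂ (OmniFiberC n (φ *ᵖ L) y) :=
  ((D (φ y)).comap
    ((LinearMap.prodMap (pushGauge L φ y) LinearMap.id :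
      GaugeFiber n (φ *ᵖ L) y × JetFiber m L (φ y) →ₗ[ℝ] OmniFiber m L (φ y)).baseChange ℂ)).map
    ((LinearMap.prodMap LinearMap.id (LinearMap.lcomp ℝ (L (φ y)) (pushGauge L φ y)) :
      GaugeFiber n (φ *ᵖ L) y × JetFiber m L (φ y) →ₗ[ℝ] OmniFiber n (φ *ᵖ L) y).baseChange ℂ)

end Pullback

/-! ### Immersed submanifolds, characteristic leaves and transversals -/

/-- `i : N → M` is (the inclusion of) an immersed submanifold: a smooth injective immersion. -/
structure IsImmersedSubmanifold {m n : ℕ} {M N : Type*} [TopologicalSpace M]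
    [ChartedSpace (EuclideanSpace ℝ (Fin m)) M] [TopologicalSpace N]
    [ChartedSpace (EuclideanSpace ℝ (Fin n)) N] (i : N → M) : Prop where
  contMDiff : ContMDiff (𝓡 n) (𝓡 m) ∞ i
  injective : Function.Injective i
  injective_mfderiv : ∀ y : N, Function.Injective (mfderiv (𝓡 n) (𝓡 m) i y)

section Leaves

universe u

variable {m : ℕ} {M : Type u} [TopologicalSpace M] [ChartedSpace (EuclideanSpace ℝ (Fin m)) M]
  {L : M → Type*} [TopologicalSpace (TotalSpace ℝ L)] [∀ x, AddCommGroup (L x)]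
  [∀ x, Module ℝ (L x)] [∀ x, TopologicalSpace (L x)] [FiberBundle ℝ L] [VectorBundle ℝ ℝ L]
  [IsManifold (𝓡 m) ∞ M] (K : GenContactStructure m L)

/-- A connected immersed submanifold whose tangent spaces are the values of the characteristic
distribution. -/
structure GenContactStructure.IsIntegralManifold {k : ℕ} {O : Type*} [TopologicalSpace O]
    [ChartedSpace (EuclideanSpace ℝ (Fin k)) O] (ι : O → M) : Prop where
  connected : ConnectedSpace O
  immersed : IsImmersedSubmanifold (m := m) (n := k) ι
  range_mfderiv : ∀ y : O,
    Set.range (mfderiv (𝓡 k) (𝓡 m) ι y) = K.charDistribution (ι y)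

/-- A characteristic leaf: a maximal connected integral manifold of the characteristic
distribution. -/
structure GenContactStructure.IsCharacteristicLeaf {k : ℕ} {O : Type*} [TopologicalSpace O]
    [ChartedSpace (EuclideanSpace ℝ (Fin k)) O] (ι : O → M) : Prop where
  integral : K.IsIntegralManifold (k := k) ι
  maximal : ∀ (k' : ℕ) (O' : Type u) [TopologicalSpace O']
    [ChartedSpace (EuclideanSpace ℝ (Fin k')) O'] [IsManifold (𝓡 k') ∞ O'] (ι' : O' → M),
    K.IsIntegralManifold (k := k') ι' → (Set.range ι ∩ Set.range ι').Nonempty →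
    Set.range ι' ⊆ Set.range ι

end Leaves

/-- `N` (included by `i`) is a minimal-dimensional transversal to `O` (included by `ι`) at the
common point `i y = x = ι o`: `T_x M = T_x N ⊕ T_x O`. All tangent spaces are, by definition, the
model space; as `i y` and `ι o` are the same point, the two identifications agree. -/
def IsTransversalAt {m n k : ℕ} {M N O : Type*} [TopologicalSpace M]
    [ChartedSpace (EuclideanSpace ℝ (Fin m)) M] [TopologicalSpace N]
    [ChartedSpace (EuclideanSpace ℝ (Fin n)) N] [TopologicalSpace O]
    [ChartedSpace (EuclideanSpace ℝ (Fin k)) O] (i : N → M) (ι : O → M) (y : N) (o : O)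
    (x : M) : Prop :=
  i y = x ∧ ι o = x ∧
  IsCompl
    (LinearMap.range (mfderiv (𝓡 n) (𝓡 m) i y :
      EuclideanSpace ℝ (Fin n) →L[ℝ] EuclideanSpace ℝ (Fin m)).toLinearMap)
    (LinearMap.range (mfderiv (𝓡 k) (𝓡 m) ι o :
      EuclideanSpace ℝ (Fin k) →L[ℝ] EuclideanSpace ℝ (Fin m)).toLinearMap)

/-- The restriction of a smooth map to an open subset of its domain. -/
def restrictOpen {m n : ℕ} {M N : Type*} [TopologicalSpace M]
    [ChartedSpace (EuclideanSpace ℝ (Fin m)) M] [TopologicalSpace N]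
    [ChartedSpace (EuclideanSpace ℝ (Fin n)) N] (i : C^∞⟮𝓡 n, N; 𝓡 m, M⟯)
    (U : TopologicalSpace.Opens N) : C^∞⟮𝓡 n, U; 𝓡 m, M⟯ :=
  ⟨fun y => i y, i.contMDiff.comp contMDiff_subtype_val⟩

end

end GenContact

/-! The leaf being even dimensional makes `N` a cosymplectic transversal. As `J♯` is skew with
values in a line, its image has even rank. The identity derivation spans the kernel of the symbol;
if it lay in the image of `J♯`, that image would have rank `k + 1`, which is odd (`sharp_ne_one`).
So the symbol is injective on `im J♯`. Let `DN` be the derivations with symbol in `TN`, and let `ψ`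
annihilate `DN` with `J♯ψ` in `DN`. The symbol of `J♯ψ` lies in `TN ∩ TO = 0`, so `J♯ψ = 0`; by
skewness `ψ` kills `im J♯`, and `DN + im J♯ = DL` gives `ψ = 0` (`isCosymplecticOn_of_isCompl`).

This condition says that a square linear system is nonsingular (`det_liftMatrix_ne_zero_iff`), so it
is open and the solutions are smooth. The system takes a point `a` of the omni-Lie algebroid on `N`
and finds its unique lift `c` on `M` such that `Kc` is again a lift, of some point `K'a`. Then `K'²
= -1` because `Kc` lifts `K'a` and `K(Kc) = -c`, and `K'` is skew because the lifting relation
preserves pairings. The value of a bracket at a point depends only on first jets. Extending lifts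
off `N` to first order therefore transfers integrability from `K` to `K'` (`SecRel.dorfman`,
`exists_induced`).

The `+i`-eigenbundle of `K'` consists of the elements `u - iK'u`. It is the backward image by the
construction of `K'` (`RegularMap.eigenbundle_eq`), and the eigenbundle of a generalized contact
structure is of generalized contact type (`isGenContactType_eigenbundle`). Both conclusions thus
follow from the existence of `K'`. -/

namespace GenContact

noncomputable section

open Bundle VectorField

/-! ### Local frames of a line bundle, its gauge algebroid and its first jets -/

section Frames

variable {m : ℕ} {M : Type*} [TopologicalSpace M] [ChartedSpace (EuclideanSpace ℝ (Fin m)) M]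
  {L : M → Type*} [TopologicalSpace (TotalSpace ℝ L)] [∀ x, AddCommGroup (L x)]
  [∀ x, Module ℝ (L x)] [∀ x, TopologicalSpace (L x)] [FiberBundle ℝ L] [VectorBundle ℝ ℝ L]

/-! ### Ratios in a line -/

/-- The coordinate of a vector of the line `L_x` with respect to `e`. -/
def ratio {x : M} (e : L x) : L x →ₗ[ℝ] ℝ :=
  ((trivializationAt ℝ L x).linearMapAt ℝ x e)⁻¹ • (trivializationAt ℝ L x).linearMapAt ℝ x

theorem linearMapAt_injective (x : M) :
    Function.Injective ((trivializationAt ℝ L x).linearMapAt ℝ x) := by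
  intro a b h
  have hx := FiberBundle.mem_baseSet_trivializationAt' (F := ℝ) (E := L) x
  rw [← (trivializationAt ℝ L x).symmₗ_linearMapAt (R := ℝ) hx a, h,
    (trivializationAt ℝ L x).symmₗ_linearMapAt (R := ℝ) hx b]

theorem linearMapAt_ne_zero {x : M} {e : L x} (he : e ≠ 0) :
    (trivializationAt ℝ L x).linearMapAt ℝ x e ≠ 0 := fun h =>
  he (linearMapAt_injective x (h.trans (map_zero _).symm))

theorem ratio_smul_self {x : M} {e : L x} (he : e ≠ 0) (l : L x) : ratio e l • e = l := by
  apply linearMapAt_injective x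
  have := linearMapAt_ne_zero he
  simp only [map_smul, ratio, LinearMap.smul_apply, smul_eq_mul]
  field_simp

theorem ratio_self {x : M} {e : L x} (he : e ≠ 0) : ratio e e = 1 :=
  smul_left_injective ℝ he (by simp [ratio_smul_self he])

theorem ratio_smul {x : M} {e : L x} (he : e ≠ 0) (c : ℝ) : ratio e (c • e) = c := by
  simp [ratio_self he]

theorem ratio_eq_iff {x : M} {e : L x} (he : e ≠ 0) {l : L x} {c : ℝ} :
    ratio e l = c ↔ l = c • e :=
  ⟨fun h => by rw [← h, ratio_smul_self he], fun h => by rw [h, ratio_smul he]⟩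

/-- `ratio` at `y` is written in the trivialization chosen at `y`, which varies with `y`. By
`ratio_eq_iff` its value does not depend on that choice, so near `x` it is the quotient of two
coordinates in the single trivialization at `x`. -/
theorem contMDiffAt_ratio (e l : Sec m L) {x : M} (he : e x ≠ 0) :
    ContMDiffAt (𝓡 m) 𝓘(ℝ, ℝ) ∞ (fun y => ratio (e y) (l y)) x ∧ ∀ᶠ y in 𝓝 x, e y ≠ 0 := by
  set t := trivializationAt ℝ L x
  have hs : ∀ s : Sec m L, ContMDiffAt (𝓡 m) 𝓘(ℝ, ℝ) ∞ (fun y => (t ⟨y, s y⟩).2) x := fun s =>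
    (contMDiffAt_section x).1 (s.contMDiff x)
  have hx : x ∈ t.baseSet := FiberBundle.mem_baseSet_trivializationAt' x
  have hb : ∀ᶠ y in 𝓝 x, y ∈ t.baseSet := t.open_baseSet.mem_nhds hx
  have hcoe : ∀ y ∈ t.baseSet, ∀ s : L y, (t ⟨y, s⟩).2 = t.linearMapAt ℝ y s := fun y hy s => by
    rw [t.coe_linearMapAt_of_mem hy]
  have hex : (t ⟨x, e x⟩).2 ≠ 0 := by
    rw [hcoe x hx]; exact linearMapAt_ne_zero he
  have hev : ∀ᶠ y in 𝓝 x, (t ⟨y, e y⟩).2 ≠ 0 := (hs e).continuousAt.eventually_ne hex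
  have hne : ∀ᶠ y in 𝓝 x, e y ≠ 0 := by
    filter_upwards [hev, hb] with y hy hyb h0
    rw [hcoe y hyb, h0, map_zero] at hy
    exact hy rfl
  refine ⟨(((hs l).mul ((hs e).inv₀ hex))).congr_of_eventuallyEq ?_, hne⟩
  filter_upwards [hev, hb, hne] with y hy hyb hye
  rw [ratio_eq_iff hye]
  have hi : Function.Injective (t.linearMapAt ℝ y) := by
    intro a b h
    rw [← t.symmₗ_linearMapAt (R := ℝ) hyb a, h, t.symmₗ_linearMapAt (R := ℝ) hyb b]
  apply hi
  rw [map_smul, ← hcoe y hyb, ← hcoe y hyb, Pi.mul_apply, smul_eq_mul, mul_assoc]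
  change _ = _ * (((t ⟨y, e y⟩).2)⁻¹ * _)
  rw [inv_mul_cancel₀ hy, mul_one]

/-! ### Module structures over the smooth functions -/

@[simp] theorem fsmul_apply (f : C^∞⟮𝓡 m, M; ℝ⟯) (l : Sec m L) (x : M) :
    fsmul f l x = f x • l x := rfl

theorem sec_sum_apply {ι : Type*} (s : Finset ι) (l : ι → Sec m L) (x : M) :
    (∑ i ∈ s, l i) x = ∑ i ∈ s, l i x :=
  map_sum (evalSec m L x) l s

theorem gaugeFiber_sum_apply {ι : Type*} (s : Finset ι) (c : ι → ℝ) {x : M}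
    (Δ : ι → GaugeFiber m L x) (l : Sec m L) :
    (∑ i ∈ s, c i • Δ i).1 l = ∑ i ∈ s, c i • (Δ i).1 l := by
  rw [Submodule.coe_sum, LinearMap.sum_apply]
  rfl

variable [IsManifold (𝓡 m) ∞ M]

@[simp] theorem gaugeEval_apply (x : M) (Δ : Gauge m L) (l : Sec m L) :
    (gaugeEval m L x Δ).1 l = Δ.1 l x := rfl

@[simp] theorem jetPair_apply (ψ : JetSec m L) (E : Gauge m L) (x : M) :
    jetPair m L ψ E x = ψ.1 x (gaugeEval m L x E) := rfl

theorem gauge_ext {Δ E : Gauge m L} (h : ∀ x, gaugeEval m L x Δ = gaugeEval m L x E) : Δ = E := by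
  ext1; ext l x
  exact congrArg (fun D : GaugeFiber m L x => D.1 l) (h x)

theorem jetSec_ext {ψ χ : JetSec m L} (h : ∀ x, ψ.1 x = χ.1 x) : ψ = χ :=
  Subtype.ext (funext h)

theorem omniSec_ext {α β : OmniSec m L} (h : ∀ x, omniEval m L x α = omniEval m L x β) : α = β :=
  Prod.ext (gauge_ext fun x => congrArg Prod.fst (h x))
    (jetSec_ext fun x => congrArg Prod.snd (h x))

/-- The product of a smooth function and a derivation. -/
def gsmul (f : C^∞⟮𝓡 m, M; ℝ⟯) : Gauge m L →ₗ[ℝ] Gauge m L where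
  toFun Δ := ⟨{ toFun := fun l => fsmul f (Δ.1 l)
                map_add' := fun a b => by ext x; simp
                map_smul' := fun c a => by ext x; simp [smul_comm c] }, by
    obtain ⟨X, hX⟩ := Δ.2
    refine ⟨⟨fun x => f x • X x, f.contMDiff.smul_section X.contMDiff⟩, fun x g l => ?_⟩
    have := hX x g l
    change f x • (evalSec m L x ∘ₗ Δ.1) (fsmul g l) =
      mvfderiv (𝓡 m) g x (f x • X x) • l x + g x • f x • (evalSec m L x ∘ₗ Δ.1) l
    rw [this, map_smul, smul_add, smul_smul, smul_eq_mul, smul_comm (f x) (g x)]⟩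
  map_add' a b := by ext1; ext l x; simp
  map_smul' c a := by
    ext1; ext l x
    change f x • c • a.1 l x = c • f x • a.1 l x
    rw [smul_comm]

@[simp] theorem gaugeEval_gsmul (f : C^∞⟮𝓡 m, M; ℝ⟯) (Δ : Gauge m L) (x : M) :
    gaugeEval m L x (gsmul f Δ) = f x • gaugeEval m L x Δ := rfl

/-- The product of a smooth function and a section of the first jet bundle. -/
def jsmul (f : C^∞⟮𝓡 m, M; ℝ⟯) (ψ : JetSec m L) : JetSec m L :=
  ⟨fun x => f x • ψ.1 x, fun E => (fsmul f (jetPair m L ψ E)).contMDiff⟩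

@[simp] theorem jsmul_apply (f : C^∞⟮𝓡 m, M; ℝ⟯) (ψ : JetSec m L) (x : M) :
    (jsmul f ψ).1 x = f x • ψ.1 x := rfl

/-- The product of a smooth function and a section of the omni-Lie algebroid. -/
def osmul (f : C^∞⟮𝓡 m, M; ℝ⟯) (α : OmniSec m L) : OmniSec m L := (gsmul f α.1, jsmul f α.2)

@[simp] theorem omniEval_osmul (f : C^∞⟮𝓡 m, M; ℝ⟯) (α : OmniSec m L) (x : M) :
    omniEval m L x (osmul f α) = f x • omniEval m L x α := rfl

@[simp] theorem omniEval_fst (α : OmniSec m L) (x : M) :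
    (omniEval m L x α).1 = gaugeEval m L x α.1 := rfl

@[simp] theorem omniEval_snd (α : OmniSec m L) (x : M) :
    (omniEval m L x α).2 = α.2.1 x := rfl

theorem gaugeEval_sum {ι : Type*} (s : Finset ι) (E : ι → Gauge m L) (x : M) :
    gaugeEval m L x (∑ i ∈ s, E i) = ∑ i ∈ s, gaugeEval m L x (E i) := map_sum _ _ _

theorem jetSec_sum_apply {ι : Type*} (s : Finset ι) (ψ : ι → JetSec m L) (x : M) :
    (∑ i ∈ s, ψ i).1 x = ∑ i ∈ s, (ψ i).1 x :=
  map_sum (LinearMap.proj x ∘ₗ (JetSec m L).subtype) ψ s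

theorem omniEval_sum {ι : Type*} (s : Finset ι) (α : ι → OmniSec m L) (x : M) :
    omniEval m L x (∑ i ∈ s, α i) = ∑ i ∈ s, omniEval m L x (α i) := map_sum _ _ _

theorem sum_smul_omniEval {ι : Type*} (s : Finset ι) (c : ι → ℝ) (α : ι → OmniSec m L) (x : M) :
    ∑ i ∈ s, c i • omniEval m L x (α i) =
      (∑ i ∈ s, c i • gaugeEval m L x (α i).1, ∑ i ∈ s, c i • (α i).2.1 x) := by
  refine Prod.ext ?_ ?_
  · rw [Prod.fst_sum]; rfl
  · rw [Prod.snd_sum]; rfl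

/-- The identity operator, as a derivation. -/
def gaugeOne : Gauge m L :=
  ⟨1, 0, fun x f l => by
    change f x • l x = mvfderiv (𝓡 m) f x 0 • l x + f x • l x
    simp⟩

@[simp] theorem gaugeOne_apply (l : Sec m L) : (gaugeOne : Gauge m L).1 l = l := rfl

/-- The first jet of a section. -/
def jetOf (l : Sec m L) : JetSec m L :=
  ⟨fun _ => { toFun := fun Δ => Δ.1 l, map_add' := fun _ _ => rfl, map_smul' := fun _ _ => rfl },
    fun E => (E.1 l).contMDiff⟩

@[simp] theorem jetOf_apply (l : Sec m L) (x : M) (Δ : GaugeFiber m L x) :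
    (jetOf l).1 x Δ = Δ.1 l := rfl

/-! ### Frames of a line bundle -/

variable (m L) in
/-- Smooth data which on `V` restrict to a nonvanishing section `e` of `L`, functions `u j` with
independent differentials, and the dual derivations `D j`, which annihilate `e`. -/
structure LineFrame (V : Set M) where
  e : Sec m L
  u : Fin m → C^∞⟮𝓡 m, M; ℝ⟯
  D : Fin m → Gauge m L
  q : Sec m L → C^∞⟮𝓡 m, M; ℝ⟯
  e_ne : ∀ x ∈ V, e x ≠ 0
  q_smul : ∀ l, ∀ x ∈ V, q l x • e x = l x
  D_e : ∀ j, ∀ x ∈ V, (D j).1 e x = 0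
  D_u : ∀ j k, ∀ x ∈ V, (D j).1 (fsmul (u k) e) x = if k = j then e x else 0
  ext : ∀ x ∈ V, ∀ Δ : GaugeFiber m L x, Δ.1 e = 0 → (∀ j, Δ.1 (fsmul (u j) e) = 0) → Δ = 0
  symbol_inj : ∀ x ∈ V, ∀ v : TangentSpace (𝓡 m) x, (∀ j, mvfderiv (𝓡 m) (u j) x v = 0) → v = 0

namespace LineFrame

variable {V : Set M} (F : LineFrame m L V)

/-- `ratio` need not be smooth where `e` vanishes; `q` is a globally smooth substitute that agrees
with it on `V`. -/
theorem q_eq (l : Sec m L) {x : M} (hx : x ∈ V) : F.q l x = ratio (F.e x) (l x) :=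
  ((ratio_eq_iff (F.e_ne x hx)).2 (F.q_smul l x hx).symm).symm

/-- The frame `1, D j` of the gauge algebroid. -/
def gframe : Option (Fin m) → Gauge m L
  | none => gaugeOne
  | some j => F.D j

/-- The dual frame of the first jet bundle. -/
def jframe : Option (Fin m) → JetSec m L
  | none => jetOf F.e
  | some j => jetOf (fsmul (F.u j) F.e) - jsmul (F.u j) (jetOf F.e)

/-- Subtracting `u j` times the jet of `e` makes the elements indexed by `some j` vanish on the
identity, while `D_e` makes the jet of `e` vanish on every `D j`. -/
theorem jframe_gframe (a b : Option (Fin m)) {x : M} (hx : x ∈ V) :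
    (F.jframe a).1 x (gaugeEval m L x (F.gframe b)) = if a = b then F.e x else 0 := by
  rcases a with _ | a <;> rcases b with _ | b <;>
    simp [jframe, gframe, F.D_e _ x hx, F.D_u _ _ x hx, jsmul_apply]

/-- The coordinates on the fibres of the gauge algebroid. -/
def gcoord (x : M) (a : Option (Fin m)) : GaugeFiber m L x →ₗ[ℝ] ℝ :=
  ratio (F.e x) ∘ₗ (F.jframe a).1 x

/-- The coordinates on the fibres of the first jet bundle. -/
def jcoord (x : M) (a : Option (Fin m)) : JetFiber m L x →ₗ[ℝ] ℝ :=
  ratio (F.e x) ∘ₗ LinearMap.applyₗ (gaugeEval m L x (F.gframe a))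

theorem jframe_apply (a : Option (Fin m)) {x : M} (hx : x ∈ V) (Δ : GaugeFiber m L x) :
    (F.jframe a).1 x Δ = F.gcoord x a Δ • F.e x :=
  (ratio_smul_self (F.e_ne x hx) _).symm

theorem apply_gframe (a : Option (Fin m)) {x : M} (hx : x ∈ V) (ψ : JetFiber m L x) :
    ψ (gaugeEval m L x (F.gframe a)) = F.jcoord x a ψ • F.e x :=
  (ratio_smul_self (F.e_ne x hx) _).symm

theorem gcoord_gframe (a b : Option (Fin m)) {x : M} (hx : x ∈ V) :
    F.gcoord x a (gaugeEval m L x (F.gframe b)) = if a = b then 1 else 0 := by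
  simp only [gcoord, LinearMap.comp_apply, F.jframe_gframe a b hx]
  split_ifs <;> simp [ratio_self (F.e_ne x hx)]

theorem jcoord_jframe (a b : Option (Fin m)) {x : M} (hx : x ∈ V) :
    F.jcoord x a ((F.jframe b).1 x) = if b = a then 1 else 0 := by
  simp only [jcoord, LinearMap.comp_apply, LinearMap.applyₗ_apply_apply, F.jframe_gframe b a hx]
  split_ifs <;> simp [ratio_self (F.e_ne x hx)]

theorem gauge_ext_of_coord {x : M} (hx : x ∈ V) {Δ E : GaugeFiber m L x}
    (h : ∀ a, F.gcoord x a Δ = F.gcoord x a E) : Δ = E := by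
  have h' : ∀ a, (F.jframe a).1 x Δ = (F.jframe a).1 x E := fun a => by
    rw [F.jframe_apply a hx, F.jframe_apply a hx, h]
  have h0 : Δ.1 F.e = E.1 F.e := h' none
  refine sub_eq_zero.1 (F.ext x hx _ (sub_eq_zero.2 h0) fun j => sub_eq_zero.2 ?_)
  have := h' (some j)
  simpa [jframe, h0] using this

theorem gauge_expand {x : M} (hx : x ∈ V) (Δ : GaugeFiber m L x) :
    Δ = ∑ a, F.gcoord x a Δ • gaugeEval m L x (F.gframe a) :=
  F.gauge_ext_of_coord hx fun b => by
    simp only [map_sum, map_smul, F.gcoord_gframe _ _ hx, smul_eq_mul, mul_ite, mul_one, mul_zero,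
      Finset.sum_ite_eq, Finset.mem_univ, if_true]

theorem jet_expand {x : M} (hx : x ∈ V) (ψ : JetFiber m L x) :
    ψ = ∑ a, F.jcoord x a ψ • (F.jframe a).1 x := by
  ext Δ
  conv_lhs => rw [F.gauge_expand hx Δ]
  simp only [map_sum, map_smul, F.apply_gframe _ hx, LinearMap.sum_apply, LinearMap.smul_apply,
    F.jframe_apply _ hx]
  exact Finset.sum_congr rfl fun a _ => smul_comm _ _ _

theorem jet_ext {x : M} (hx : x ∈ V) {ψ χ : JetFiber m L x}
    (h : ∀ a, ψ (gaugeEval m L x (F.gframe a)) = χ (gaugeEval m L x (F.gframe a))) : ψ = χ := by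
  rw [F.jet_expand hx ψ, F.jet_expand hx χ]
  simp only [jcoord, LinearMap.comp_apply, LinearMap.applyₗ_apply_apply, h]

/-- The frame of the omni-Lie algebroid. -/
def oframe : Option (Fin m) ⊕ Option (Fin m) → OmniSec m L
  | .inl a => (F.gframe a, 0)
  | .inr a => (0, F.jframe a)

/-- The coordinates on the fibres of the omni-Lie algebroid. -/
def ocoord (x : M) : Option (Fin m) ⊕ Option (Fin m) → OmniFiber m L x →ₗ[ℝ] ℝ
  | .inl a => F.gcoord x a ∘ₗ LinearMap.fst ℝ _ _
  | .inr a => F.jcoord x a ∘ₗ LinearMap.snd ℝ _ _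

theorem omni_expand {x : M} (hx : x ∈ V) (a : OmniFiber m L x) :
    a = ∑ A, F.ocoord x A a • omniEval m L x (F.oframe A) := by
  rw [Fintype.sum_sum_type]
  refine Prod.ext ?_ ?_
  · rw [Prod.fst_add, Prod.fst_sum, Prod.fst_sum]
    simpa [oframe, ocoord] using F.gauge_expand hx a.1
  · rw [Prod.snd_add, Prod.snd_sum, Prod.snd_sum]
    simpa [oframe, ocoord] using F.jet_expand hx a.2

theorem ocoord_oframe (A B : Option (Fin m) ⊕ Option (Fin m)) {x : M} (hx : x ∈ V) :
    F.ocoord x A (omniEval m L x (F.oframe B)) = if A = B then 1 else 0 := by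
  rcases A with a | a <;> rcases B with b | b <;>
    simp [ocoord, oframe, F.gcoord_gframe _ _ hx, F.jcoord_jframe _ _ hx, eq_comm]

/-- The coordinates of a section of the omni-Lie algebroid. -/
def ocoordSec (α : OmniSec m L) : Option (Fin m) ⊕ Option (Fin m) → C^∞⟮𝓡 m, M; ℝ⟯
  | .inl a => F.q (jetPair m L (F.jframe a) α.1)
  | .inr a => F.q (jetPair m L α.2 (F.gframe a))

theorem ocoordSec_apply (α : OmniSec m L) (A : Option (Fin m) ⊕ Option (Fin m)) {x : M}
    (hx : x ∈ V) : F.ocoordSec α A x = F.ocoord x A (omniEval m L x α) := by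
  rcases A with a | a <;> exact F.q_eq _ hx

theorem isSymbol_u {x : M} {Δ : GaugeFiber m L x} {v : TangentSpace (𝓡 m) x}
    (h : IsSymbol Δ.1 v) (hx : x ∈ V) (j : Fin m) :
    F.gcoord x (some j) Δ = mvfderiv (𝓡 m) (F.u j) x v := by
  have := h (F.u j) F.e
  change ratio (F.e x) ((F.jframe (some j)).1 x Δ) = _
  rw [ratio_eq_iff (F.e_ne x hx)]
  simp [jframe, this]

/-- The Leibniz rule for `u j · e` isolates the multiple `du_j(v)` of the nonzero vector `e x`, and
the `du_j` separate tangent vectors. -/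
theorem isSymbol_unique (F : LineFrame m L V) {x : M} (hx : x ∈ V)
    {Δ : Sec m L →ₗ[ℝ] L x} {v w : TangentSpace (𝓡 m) x} (h : IsSymbol Δ v) (k : IsSymbol Δ w) : v = w := by
  refine sub_eq_zero.1 (F.symbol_inj x hx _ fun j => ?_)
  have h1 := h (F.u j) F.e
  rw [k (F.u j) F.e] at h1
  have h2 := smul_left_injective ℝ (F.e_ne x hx) (add_right_cancel h1)
  rw [map_sub, h2, sub_self]

/-- Every tangent vector is the symbol of a derivation. -/
theorem exists_isSymbol {x : M} (hx : x ∈ V) (v : TangentSpace (𝓡 m) x) :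
    ∃ Δ : GaugeFiber m L x, IsSymbol Δ.1 v ∧ Δ.1 F.e = 0 := by
  let Δ : GaugeFiber m L x :=
    ∑ j, mvfderiv (𝓡 m) (F.u j) x v • gaugeEval m L x (F.gframe (some j))
  obtain ⟨w, hw⟩ := Δ.2
  have hΔ : ∀ a, F.gcoord x a Δ = a.elim 0 fun j => mvfderiv (𝓡 m) (F.u j) x v := by
    intro a
    simp only [Δ, map_sum, map_smul, F.gcoord_gframe _ _ hx]
    rcases a with _ | a <;> simp
  have hwv : w = v := by
    refine sub_eq_zero.1 (F.symbol_inj x hx _ fun j => ?_)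
    rw [map_sub, ← F.isSymbol_u hw hx, hΔ, Option.elim_some, sub_self]
  refine ⟨Δ, hwv ▸ hw, ?_⟩
  have := F.jframe_apply none hx Δ
  rw [hΔ] at this
  exact this.trans (zero_smul ℝ _)

end LineFrame

end Frames

/-! ### Lifting points and sections of the omni-Lie algebroid along a bundle map -/

section PullbackLift

variable {m n : ℕ} {M N : Type*} [TopologicalSpace M]
  [ChartedSpace (EuclideanSpace ℝ (Fin m)) M] [TopologicalSpace N]
  [ChartedSpace (EuclideanSpace ℝ (Fin n)) N]
  {L : M → Type*} [TopologicalSpace (TotalSpace ℝ L)] [∀ x, AddCommGroup (L x)]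
  [∀ x, Module ℝ (L x)] [∀ x, TopologicalSpace (L x)] [FiberBundle ℝ L] [VectorBundle ℝ ℝ L]
  {L' : N → Type*} [TopologicalSpace (TotalSpace ℝ L')] [∀ x, AddCommGroup (L' x)]
  [∀ x, Module ℝ (L' x)] [∀ x, TopologicalSpace (L' x)] [FiberBundle ℝ L'] [VectorBundle ℝ ℝ L']
  {φ : C^∞⟮𝓡 n, N; 𝓡 m, M⟯}

variable (L L' φ) in
/-- A regular (fibrewise invertible) map of line bundles `L' → L` covering `φ`. -/
structure RegularMap where
  fib : ∀ y : N, L (φ y) ≃ₗ[ℝ] L' y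
  sec : Sec m L →ₗ[ℝ] Sec n L'
  sec_apply : ∀ l y, sec l y = fib y (l (φ y))

/-- Evaluation of smooth functions at a point. -/
def evalAt (y : N) : C^∞⟮𝓡 n, N; ℝ⟯ →+* ℝ := ContMDiffMap.evalRingHom y

theorem evalAt_apply (y : N) (f : C^∞⟮𝓡 n, N; ℝ⟯) : evalAt y f = f y := rfl

theorem sum_apply {ι : Type*} (s : Finset ι) (f : ι → C^∞⟮𝓡 n, N; ℝ⟯) (y : N) :
    (∑ i ∈ s, f i) y = ∑ i ∈ s, f i y := by
  simp only [← evalAt_apply, map_sum]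

theorem det_apply {ι : Type*} [Fintype ι] [DecidableEq ι] (S : Matrix ι ι C^∞⟮𝓡 n, N; ℝ⟯) (y : N) :
    S.det y = (Matrix.of fun i j => S i j y).det :=
  (evalAt y).map_det S

theorem isUnit_of_forall_ne_zero (f : C^∞⟮𝓡 n, N; ℝ⟯) (h : ∀ y, f y ≠ 0) : IsUnit f := by
  refine IsUnit.of_mul_eq_one ⟨fun y => (f y)⁻¹, fun y => (f.contMDiff y).inv₀ (h y)⟩ ?_
  ext y
  exact mul_inv_cancel₀ (h y)

/-- Linear systems with smooth coefficients and nonvanishing determinant have smooth solutions. -/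
theorem exists_smooth_solution {ι : Type*} [Fintype ι] [DecidableEq ι]
    (S : Matrix ι ι C^∞⟮𝓡 n, N; ℝ⟯) (hS : ∀ y, S.det y ≠ 0) (r : ι → C^∞⟮𝓡 n, N; ℝ⟯) :
    ∃ z : ι → C^∞⟮𝓡 n, N; ℝ⟯, ∀ y i, ∑ j, S i j y * z j y = r i y := by
  -- The matrix is inverted over the ring of smooth functions, where a nowhere vanishing determinant
  -- is a unit.
  refine ⟨S⁻¹.mulVec r, fun y i => ?_⟩
  have hz : S.mulVec (S⁻¹.mulVec r) = r := by
    rw [Matrix.mulVec_mulVec, Matrix.mul_nonsing_inv _ (isUnit_of_forall_ne_zero _ hS),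
      Matrix.one_mulVec]
  have h1 : ∑ j, S i j * S⁻¹.mulVec r j = r i := congrFun hz i
  have h2 := congrArg (evalAt y) h1
  simpa only [map_sum, map_mul, evalAt_apply] using h2

namespace RegularMap

variable (P : RegularMap L L' φ)

theorem sec_fsmul (f : C^∞⟮𝓡 m, M; ℝ⟯) (l : Sec m L) :
    P.sec (fsmul f l) = fsmul (f.comp φ) (P.sec l) := by
  ext y
  simp [P.sec_apply]

theorem isSymbol_push {y : N} {Δ : Sec n L' →ₗ[ℝ] L' y} {v : TangentSpace (𝓡 n) y}
    (hv : IsSymbol Δ v) :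
    IsSymbol ((P.fib y).symm.toLinearMap ∘ₗ Δ ∘ₗ P.sec)
      (mfderiv (𝓡 n) (𝓡 m) φ y v) := fun f l => by
  have h := hv (f.comp φ) (P.sec l)
  have hc : mvfderiv (𝓡 n) (f.comp φ) y v
      = mvfderiv (𝓡 m) f (φ y) (mfderiv (𝓡 n) (𝓡 m) φ y v) :=
    mvfderiv_comp_apply (g := f) (f := φ) y
      ((f.contMDiff _).mdifferentiableAt (by simp))
      ((φ.contMDiff _).mdifferentiableAt (by simp)) v
  rw [hc, ← P.sec_fsmul, P.sec_apply] at h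
  simp only [LinearMap.comp_apply, LinearEquiv.coe_coe, h, map_add, map_smul,
    LinearEquiv.symm_apply_apply]
  rfl

/-- The push-forward of derivations. -/
def push (y : N) : GaugeFiber n L' y →ₗ[ℝ] GaugeFiber m L (φ y) where
  toFun Δ := ⟨(P.fib y).symm.toLinearMap ∘ₗ Δ.1 ∘ₗ P.sec,
    Δ.2.elim fun _ hv => ⟨_, P.isSymbol_push hv⟩⟩
  map_add' _ _ := by ext1; ext1 l; simp
  map_smul' _ _ := by ext1; ext1 l; simp

theorem push_apply {y : N} (Δ : GaugeFiber n L' y) (l : Sec m L) :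
    (P.push y Δ).1 l = (P.fib y).symm (Δ.1 (P.sec l)) := rfl

theorem fib_push {y : N} (Δ : GaugeFiber n L' y) (l : Sec m L) :
    P.fib y ((P.push y Δ).1 l) = Δ.1 (P.sec l) :=
  (P.fib y).apply_symm_apply _

/-- The pull-back of first jets. -/
def pullJetFiber (y : N) : JetFiber m L (φ y) →ₗ[ℝ] JetFiber n L' y where
  toFun ψ := (P.fib y).toLinearMap ∘ₗ ψ ∘ₗ P.push y
  map_add' _ _ := by ext1 Δ; simp
  map_smul' _ _ := by ext1 Δ; simp

theorem pullJetFiber_apply {y : N} (ψ : JetFiber m L (φ y)) (Δ : GaugeFiber n L' y) :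
    P.pullJetFiber y ψ Δ = P.fib y (ψ (P.push y Δ)) := rfl

theorem ratio_fib {y : N} {e : L (φ y)} (he : e ≠ 0) (l : L (φ y)) :
    ratio (P.fib y e) (P.fib y l) = ratio e l := by
  rw [ratio_eq_iff ((P.fib y).map_ne_zero_iff.2 he), ← map_smul, ratio_smul_self he]

/-- Points of the omni-Lie algebroids of `L'` and `L` related by the bundle map. -/
def Rel (y : N) (a : OmniFiber n L' y) (b : OmniFiber m L (φ y)) : Prop :=
  P.push y a.1 = b.1 ∧ a.2 = P.pullJetFiber y b.2

namespace Rel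

variable {P} {y : N} {a a' : OmniFiber n L' y} {b b' : OmniFiber m L (φ y)}

theorem add (h : P.Rel y a b) (h' : P.Rel y a' b') : P.Rel y (a + a') (b + b') :=
  ⟨by rw [Prod.fst_add, Prod.fst_add, map_add, h.1, h'.1],
    by rw [Prod.snd_add, Prod.snd_add, h.2, h'.2, map_add]⟩

theorem smul (c : ℝ) (h : P.Rel y a b) : P.Rel y (c • a) (c • b) :=
  ⟨by rw [Prod.smul_fst, Prod.smul_fst, map_smul, h.1],
    by rw [Prod.smul_snd, Prod.smul_snd, h.2, map_smul]⟩

theorem neg (h : P.Rel y a b) : P.Rel y (-a) (-b) :=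
  ⟨by rw [Prod.fst_neg, Prod.fst_neg, map_neg, h.1],
    by rw [Prod.snd_neg, Prod.snd_neg, h.2, map_neg]⟩

theorem sub (h : P.Rel y a b) (h' : P.Rel y a' b') : P.Rel y (a - a') (b - b') :=
  ⟨by rw [Prod.fst_sub, Prod.fst_sub, map_sub, h.1, h'.1],
    by rw [Prod.snd_sub, Prod.snd_sub, h.2, h'.2, map_sub]⟩

theorem pairing_eq (h : P.Rel y a b) (h' : P.Rel y a' b') :
    pairing n L' y a a' = P.fib y (pairing m L (φ y) b b') := by
  change a'.2 a.1 + a.2 a'.1 = P.fib y (b'.2 b.1 + b.2 b'.1)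
  rw [← h.1, ← h'.1, h.2, h'.2, map_add]
  rfl

end Rel

end RegularMap

variable [IsManifold (𝓡 m) ∞ M] [IsManifold (𝓡 n) ∞ N] {V : Set M}

namespace RegularMap

variable (P : RegularMap L L' φ)

/-- If the push-forward vanishes, so does the image of the symbol under the injective differential.
The derivation is then determined by its value on `G.e = P.sec F.e`, which vanishes too. -/
theorem push_injective (F : LineFrame m L V) (G : LineFrame n L' Set.univ)
    (hG : G.e = P.sec F.e) {y : N} (hy : φ y ∈ V)
    (hi : Function.Injective (mfderiv (𝓡 n) (𝓡 m) φ y)) :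
    Function.Injective (P.push y) := by
  refine (injective_iff_map_eq_zero _).2 fun Δ h => ?_
  obtain ⟨v, hv⟩ := Δ.2
  have h1 : IsSymbol (P.push y Δ).1 _ := P.isSymbol_push hv
  rw [h] at h1
  have hv0 : v = 0 := hi ((F.isSymbol_unique hy h1 (IsSymbol.zero _)).trans (map_zero _).symm)
  have he : Δ.1 G.e = 0 := by
    rw [hG, ← P.fib_push, h]
    exact map_zero _
  refine G.ext y trivial Δ he fun j => ?_
  rw [hv, hv0, he, map_zero, zero_smul, smul_zero, add_zero]

/-- The pull-back of the dual frame. -/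
def pullJframe (F : LineFrame m L V) :
    Option (Fin m) → JetSec n L'
  | none => jetOf (P.sec F.e)
  | some j => jetOf (P.sec (fsmul (F.u j) F.e)) -
      jsmul ((F.u j).comp φ) (jetOf (P.sec F.e))

theorem pullJframe_apply (F : LineFrame m L V) (a : Option (Fin m)) (y : N) :
    (P.pullJframe F a).1 y = P.pullJetFiber y ((F.jframe a).1 (φ y)) := by
  have h : ∀ l : Sec m L, (jetOf (P.sec l)).1 y = P.pullJetFiber y ((jetOf l).1 (φ y)) :=
    fun l => by
      ext1 Δ
      exact (P.fib_push Δ l).symm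
  rcases a with _ | j
  · exact h _
  · change _ - F.u j (φ y) • _ = P.pullJetFiber y (_ - F.u j (φ y) • _)
    rw [map_sub, map_smul, h, h]

/-- The pull-back of a section of the first jet bundle. -/
def pullJet (F : LineFrame m L V) (hφ : ∀ y, φ y ∈ V) (ψ : JetSec m L) : JetSec n L' :=
  ⟨fun y => P.pullJetFiber y (ψ.1 (φ y)), by
    -- Smoothness is tested against derivations on `N`, whose push-forwards are defined only
    -- pointwise along `φ`. Expanding in the frame reduces it to jets of pulled-back sections, with
    -- smooth coefficients.
    have h : (fun y => P.pullJetFiber y (ψ.1 (φ y))) =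
        (∑ a, jsmul ((F.q (jetPair m L ψ (F.gframe a))).comp φ) (P.pullJframe F a)).1 := by
      funext y
      have hs := map_sum (LinearMap.proj y ∘ₗ (JetSec n L').subtype) (fun a =>
        jsmul ((F.q (jetPair m L ψ (F.gframe a))).comp φ) (P.pullJframe F a)) Finset.univ
      refine Eq.trans ?_ hs.symm
      conv_lhs => rw [F.jet_expand (hφ y) (ψ.1 (φ y))]
      rw [map_sum]
      refine Finset.sum_congr rfl fun a _ => ?_
      rw [map_smul, ← P.pullJframe_apply]
      change _ = F.q _ (φ y) • (P.pullJframe F a).1 y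
      rw [F.q_eq _ (hφ y)]
      rfl
    rw [h]
    exact Subtype.property _⟩

@[simp] theorem pullJet_apply (F : LineFrame m L V) (hφ : ∀ y, φ y ∈ V) (ψ : JetSec m L) (y : N) :
    (P.pullJet F hφ ψ).1 y = P.pullJetFiber y (ψ.1 (φ y)) := rfl

/-- Makes visible that the coordinates of the push-forward of a section are smooth on `N`. -/
theorem gcoord_push (F : LineFrame m L V) {G : LineFrame n L' Set.univ}
    (hG : G.e = P.sec F.e) (a : Option (Fin m)) (E : Gauge n L') {y : N}
    (hy : φ y ∈ V) :
    F.gcoord (φ y) a (P.push y (gaugeEval n L' y E)) =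
      G.q (jetPair n L' (P.pullJframe F a) E) y := by
  rw [G.q_eq _ (Set.mem_univ y), jetPair_apply, P.pullJframe_apply, hG, P.sec_apply,
    P.pullJetFiber_apply, P.ratio_fib (F.e_ne _ hy)]
  rfl

variable (K : GenContactStructure m L)

/-- The map `φ` is transverse to the Jacobi structure at `y`, and the gauge algebroid of `φ^* L`
meets the image of its annihilator under `J♯` only in zero. -/
def IsCosymplecticAt (y : N) : Prop :=
  ∀ ψ : JetFiber m L (φ y), P.pullJetFiber y ψ = 0 →
    K.sharp (φ y) ψ ∈ LinearMap.range (P.push y) → ψ = 0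

/-- The matrix of the linear system computing the lifts of the points of the omni-Lie algebroid
of `φ^* L`. -/
def liftMatrix (F : LineFrame m L V) (G : LineFrame n L' Set.univ) :
    Matrix (Option (Fin m) ⊕ Option (Fin n)) (Option (Fin m) ⊕ Option (Fin n))
      C^∞⟮𝓡 n, N; ℝ⟯
  | .inl a, .inl b => (F.q (jetPair m L (F.jframe a) (K.sec (0, F.jframe b)).1)).comp φ
  | .inl a, .inr c => -G.q (jetPair n L' (P.pullJframe F a) (G.gframe c))
  | .inr c, .inl b => G.q (jetPair n L' (P.pullJframe F b) (G.gframe c))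
  | .inr _, .inr _ => 0

theorem sharp_jet (x : M) (ψ : JetSec m L) :
    gaugeEval m L x (K.sec (0, ψ)).1 = K.sharp x (ψ.1 x) := by
  have := congrArg Prod.fst (K.eval_sec (0, ψ) x)
  rwa [omniEval_fst, show omniEval m L x (0, ψ) = (0, ψ.1 x) from
    Prod.ext (map_zero (gaugeEval m L x)) rfl] at this

section
variable (F : LineFrame m L V) {G : LineFrame n L' Set.univ} (y : N)
  (z : Option (Fin m) ⊕ Option (Fin n) → ℝ)

/-- For unknowns `(ψ, Δ)` with coordinates `z`, the system is `(ψ, Δ) ↦ (J♯ψ - Φ_*Δ, Φ^*ψ)`. The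
first component appears here, the second in `liftMatrix_inr`. -/
theorem liftMatrix_inl (hG : G.e = P.sec F.e) (hy : φ y ∈ V) (a : Option (Fin m)) :
    ∑ B, P.liftMatrix K F G (.inl a) B y * z B =
      F.gcoord (φ y) a (K.sharp (φ y) (∑ b, z (.inl b) • (F.jframe b).1 (φ y)) -
        P.push y (∑ c, z (.inr c) • gaugeEval n L' y (G.gframe c))) := by
  rw [Fintype.sum_sum_type, map_sub, map_sum, map_sum, map_sum, map_sum, sub_eq_add_neg,
    ← Finset.sum_neg_distrib]
  congr 1
  · refine Finset.sum_congr rfl fun b _ => ?_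
    rw [map_smul, map_smul, ← sharp_jet, smul_eq_mul, mul_comm]
    congr 1
    exact F.q_eq _ hy
  · refine Finset.sum_congr rfl fun b _ => ?_
    rw [map_smul, map_smul, P.gcoord_push F hG _ _ hy, smul_eq_mul, mul_comm, ← mul_neg]
    rfl

theorem liftMatrix_inr (c : Option (Fin n)) :
    ∑ B, P.liftMatrix K F G (.inr c) B y * z B =
      G.jcoord y c (P.pullJetFiber y (∑ b, z (.inl b) • (F.jframe b).1 (φ y))) := by
  rw [Fintype.sum_sum_type]
  have h0 : ∑ d : Option (Fin n), P.liftMatrix K F G (.inr c) (.inr d) y * z (.inr d) = 0 :=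
    Finset.sum_eq_zero fun d _ => zero_mul (z (.inr d))
  rw [h0, add_zero, map_sum, map_sum]
  refine Finset.sum_congr rfl fun b _ => ?_
  rw [map_smul, map_smul, smul_eq_mul, mul_comm, ← P.pullJframe_apply]
  congr 1
  exact G.q_eq _ (Set.mem_univ y)

/-- A kernel vector is a pair `(ψ, Δ)` with `Φ^*ψ = 0` and `J♯ψ = Φ_*Δ`. The cosymplectic condition
forces `ψ = 0`, and then injectivity of the push-forward forces `Δ = 0`. The matrix is square of
size `(m + 1) + (n + 1)`, so a trivial kernel means a nonzero determinant. -/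
theorem det_liftMatrix_ne_zero_iff (hG : G.e = P.sec F.e) (hy : φ y ∈ V)
    (hi : Function.Injective (P.push y)) :
    (P.liftMatrix K F G).det y ≠ 0 ↔ P.IsCosymplecticAt K y := by
  have hmul : ∀ z B, (Matrix.of fun B C => P.liftMatrix K F G B C y).mulVec z B =
      ∑ C, P.liftMatrix K F G B C y * z C := fun _ _ => rfl
  rw [det_apply, ne_eq, ← Matrix.exists_mulVec_eq_zero_iff, not_exists]
  constructor
  · rintro h ψ h1 ⟨Δ, h2⟩
    let z : Option (Fin m) ⊕ Option (Fin n) → ℝ :=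
      Sum.elim (fun b => F.jcoord (φ y) b ψ) fun c => G.gcoord y c Δ
    have hψ : ∑ b, z (.inl b) • (F.jframe b).1 (φ y) = ψ := (F.jet_expand hy ψ).symm
    have hΔ : ∑ c, z (.inr c) • gaugeEval n L' y (G.gframe c) = Δ :=
      (G.gauge_expand (Set.mem_univ y) Δ).symm
    have hz : z = 0 := by
      by_contra hz
      refine h z ⟨hz, funext fun B => ?_⟩
      rw [hmul]
      rcases B with a | c
      · rw [P.liftMatrix_inl K F y z hG hy, hψ, hΔ, h2, sub_self, map_zero]; rfl
      · rw [P.liftMatrix_inr K F y z, hψ, h1, map_zero]; rfl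
    rw [← hψ, hz]
    simp
  · rintro h z ⟨hz, h0⟩
    refine hz ?_
    have h1 : ∀ B, ∑ C, P.liftMatrix K F G B C y * z C = 0 := fun B => by
      rw [← hmul, h0]; rfl
    have h2 := F.gauge_ext_of_coord hy (E := 0) fun a => by
      rw [← P.liftMatrix_inl K F y z hG hy, h1, map_zero]
    have h3 : P.pullJetFiber y (∑ b, z (.inl b) • (F.jframe b).1 (φ y)) = 0 :=
        G.jet_ext (Set.mem_univ y) fun c => by
      rw [G.apply_gframe c (Set.mem_univ y), ← P.liftMatrix_inr K F y z, h1, zero_smul,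
        LinearMap.zero_apply]
    rw [sub_eq_zero] at h2
    have hψ := h _ h3 ⟨_, h2.symm⟩
    rw [hψ, map_zero] at h2
    have hΔ := hi (h2.symm.trans (map_zero _).symm)
    funext B
    rcases B with a | c
    · have := congrArg (F.jcoord (φ y) a) hψ
      simpa only [map_sum, map_smul, F.jcoord_jframe _ _ hy, smul_eq_mul, mul_ite, mul_one,
        mul_zero, Finset.sum_ite_eq', Finset.mem_univ, if_true, map_zero, Pi.zero_apply] using this
    · have := congrArg (G.gcoord y c) hΔ
      simpa only [map_sum, map_smul, G.gcoord_gframe _ _ (Set.mem_univ y), smul_eq_mul, mul_ite,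
        mul_one, mul_zero, Finset.sum_ite_eq, Finset.mem_univ, if_true, map_zero,
        Pi.zero_apply] using this

end

/-- The `DL`-component of `K(Φ_*Δ, ψ)` is that of `K(Φ_*Δ, 0)` plus `J♯ψ`. The first block thus asks
that it be a push-forward, and the second prescribes `Φ^*ψ`. -/
theorem rel_of_solution (F : LineFrame m L V) {G : LineFrame n L' Set.univ}
    (hG : G.e = P.sec F.e) {y : N} (hy : φ y ∈ V) (a : OmniFiber n L' y)
    (z : Option (Fin m) ⊕ Option (Fin n) → ℝ)
    (h1 : ∀ b, ∑ B, P.liftMatrix K F G (.inl b) B y * z B =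
      -F.gcoord (φ y) b (K.fib (φ y) (P.push y a.1, 0)).1)
    (h2 : ∀ c, ∑ B, P.liftMatrix K F G (.inr c) B y * z B = G.jcoord y c a.2) :
    P.Rel y a (P.push y a.1, ∑ b, z (.inl b) • (F.jframe b).1 (φ y)) ∧
    P.push y (∑ c, z (.inr c) • gaugeEval n L' y (G.gframe c)) =
      (K.fib (φ y) (P.push y a.1, ∑ b, z (.inl b) • (F.jframe b).1 (φ y))).1 := by
  set ψ : JetFiber m L (φ y) := ∑ b, z (.inl b) • (F.jframe b).1 (φ y) with hψ
  refine ⟨⟨rfl, G.jet_ext (Set.mem_univ y) fun c => ?_⟩, ?_⟩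
  · rw [G.apply_gframe c (Set.mem_univ y), G.apply_gframe c (Set.mem_univ y), ← h2,
      P.liftMatrix_inr K F y z]
  · have h3 : (P.push y a.1, ψ) = ((P.push y a.1, 0) + (0, ψ) : OmniFiber m L (φ y)) := by simp
    rw [h3, map_add, Prod.fst_add]
    change _ = _ + K.sharp (φ y) ψ
    refine F.gauge_ext_of_coord hy fun b => ?_
    have h := h1 b
    rw [P.liftMatrix_inl K F y z hG hy, map_sub, ← hψ] at h
    rw [map_add]
    linarith

theorem fib_sum {ι : Type*} (s : Finset ι) (c : ι → ℝ) (α : ι → OmniSec m L) (x : M) :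
    K.fib x (∑ i ∈ s, c i • omniEval m L x (α i)) =
      (∑ i ∈ s, c i • gaugeEval m L x (K.sec (α i)).1, ∑ i ∈ s, c i • (K.sec (α i)).2.1 x) := by
  have h : K.fib x (∑ i ∈ s, c i • omniEval m L x (α i)) =
      ∑ i ∈ s, c i • omniEval m L x (K.sec (α i)) := by
    rw [map_sum]
    exact Finset.sum_congr rfl fun i _ => by rw [LinearMap.map_smul, K.eval_sec]
  rw [h, sum_smul_omniEval]

theorem _root_.GenContact.LineFrame.sum_oframe (F : LineFrame m L V) (x : M)
    (c d : Option (Fin m) → ℝ) :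
    ∑ a, c a • omniEval m L x (F.oframe (.inl a)) + ∑ b, d b • omniEval m L x (F.oframe (.inr b)) =
      (∑ a, c a • gaugeEval m L x (F.gframe a), ∑ b, d b • (F.jframe b).1 x) := by
  refine Prod.ext ?_ ?_
  · rw [Prod.fst_add, Prod.fst_sum, Prod.fst_sum]
    refine (congrArg₂ _ rfl (Finset.sum_eq_zero fun a _ => ?_)).trans (add_zero _)
    exact smul_zero _
  · rw [Prod.snd_add, Prod.snd_sum, Prod.snd_sum]
    refine (congrArg₂ _ (Finset.sum_eq_zero fun a _ => ?_) rfl).trans (zero_add _)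
    exact smul_zero _

set_option maxHeartbeats 1000000 in
/-- Every section of the omni-Lie algebroid of `L'` has a lift along `φ` whose image under `K`
is a lift as well. -/
theorem exists_lift (F : LineFrame m L V) {G : LineFrame n L' Set.univ}
    (hG : G.e = P.sec F.e) (hφ : ∀ y, φ y ∈ V)
    (hi : ∀ y, Function.Injective (P.push y)) (hT : ∀ y, P.IsCosymplecticAt K y)
    (α : OmniSec n L') :
    ∃ (f : Option (Fin m) ⊕ Option (Fin m) → C^∞⟮𝓡 n, N; ℝ⟯) (β : OmniSec n L'), ∀ y,
      P.Rel y (omniEval n L' y α) (∑ A, f A y • omniEval m L (φ y) (F.oframe A)) ∧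
      P.Rel y (omniEval n L' y β)
        (K.fib (φ y) (∑ A, f A y • omniEval m L (φ y) (F.oframe A))) := by
  obtain ⟨d, hd⟩ : ∃ d : Option (Fin m) → C^∞⟮𝓡 n, N; ℝ⟯, ∀ y,
      P.push y (gaugeEval n L' y α.1) = ∑ a, d a y • gaugeEval m L (φ y) (F.gframe a) := by
    refine ⟨fun a => G.q (jetPair n L' (P.pullJframe F a) α.1), fun y => ?_⟩
    conv_lhs => rw [F.gauge_expand (hφ y) (P.push y (gaugeEval n L' y α.1))]
    simp only [P.gcoord_push F hG _ _ (hφ y)]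
  have hd' : ∀ y, ((P.push y (gaugeEval n L' y α.1), 0) : OmniFiber m L (φ y)) =
      ∑ a, d a y • omniEval m L (φ y) (F.gframe a, 0) := fun y => by
    refine Prod.ext ?_ ?_
    · rw [Prod.fst_sum, hd]; rfl
    · rw [Prod.snd_sum]
      exact (Finset.sum_eq_zero fun a _ => smul_zero _).symm
  -- To get a right-hand side smooth on `N`, `K` is applied to the frame sections on `M` and the
  -- coefficients `d` are pulled out.
  obtain ⟨r₁, hr₁⟩ : ∃ r : Option (Fin m) → C^∞⟮𝓡 n, N; ℝ⟯, ∀ y b,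
      r b y = -F.gcoord (φ y) b (K.fib (φ y) (P.push y (gaugeEval n L' y α.1), 0)).1 := by
    refine ⟨fun b => -∑ a, d a *
      (F.q (jetPair m L (F.jframe b) (K.sec (F.gframe a, 0)).1)).comp φ, fun y b => ?_⟩
    have hs : (K.fib (φ y) (P.push y (gaugeEval n L' y α.1), 0)).1 =
        ∑ a, d a y • gaugeEval m L (φ y) (K.sec (F.gframe a, 0)).1 := by
      rw [hd', fib_sum]
    refine (congrArg Neg.neg (sum_apply Finset.univ _ y)).trans (congrArg Neg.neg ?_)
    rw [hs]
    refine Eq.trans ?_ (map_sum (F.gcoord (φ y) b) _ _).symm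
    refine Finset.sum_congr rfl fun a _ => ?_
    refine Eq.trans ?_ ((F.gcoord (φ y) b).map_smul _ _).symm
    exact congrArg _ (F.q_eq _ (hφ y))
  obtain ⟨z, hz⟩ := exists_smooth_solution (P.liftMatrix K F G) (fun y =>
    (P.det_liftMatrix_ne_zero_iff K F y hG (hφ y) (hi y)).2 (hT y))
    (Sum.elim r₁ fun c => G.q (jetPair n L' α.2 (G.gframe c)))
  have key := fun y => P.rel_of_solution K F hG (hφ y) (omniEval n L' y α) (fun B => z B y)
    (fun b => (hz y (.inl b)).trans (hr₁ y b))
    (fun c => (hz y (.inr c)).trans (G.q_eq _ (Set.mem_univ y)))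
  obtain ⟨f, hf⟩ : ∃ f : Option (Fin m) ⊕ Option (Fin m) → C^∞⟮𝓡 n, N; ℝ⟯, ∀ y,
      ∑ A, f A y • omniEval m L (φ y) (F.oframe A) =
        (P.push y (gaugeEval n L' y α.1), ∑ b, z (.inl b) y • (F.jframe b).1 (φ y)) := by
    refine ⟨Sum.elim d fun b => z (.inl b), fun y => ?_⟩
    rw [Fintype.sum_sum_type]
    exact (F.sum_oframe (φ y) (fun a => d a y) fun b => z (.inl b) y).trans
      (Prod.ext (hd y).symm rfl)
  -- The derivation part of `β` comes from the second half of the solution; the jet part is the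
  -- pull-back of the jet component of `K` applied to the lift.
  refine ⟨f, (∑ c, gsmul (z (.inr c)) (G.gframe c),
    ∑ A, jsmul (f A) (P.pullJet F hφ (K.sec (F.oframe A)).2)), fun y => ?_⟩
  refine ⟨hf y ▸ (key y).1, ?_, ?_⟩
  · rw [omniEval_fst, gaugeEval_sum, hf]
    exact (key y).2
  · rw [omniEval_snd, jetSec_sum_apply, fib_sum, map_sum]
    refine Finset.sum_congr rfl fun A _ => ?_
    rw [LinearMap.map_smul]
    rfl

end RegularMap

end PullbackLift

/-! ### The generalized contact structure induced along a cosymplectic map -/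

section Induced

variable {m n : ℕ} {M N : Type*} [TopologicalSpace M]
  [ChartedSpace (EuclideanSpace ℝ (Fin m)) M] [TopologicalSpace N]
  [ChartedSpace (EuclideanSpace ℝ (Fin n)) N]
  {L : M → Type*} [TopologicalSpace (TotalSpace ℝ L)] [∀ x, AddCommGroup (L x)]
  [∀ x, Module ℝ (L x)] [∀ x, TopologicalSpace (L x)] [FiberBundle ℝ L] [VectorBundle ℝ ℝ L]
  {L' : N → Type*} [TopologicalSpace (TotalSpace ℝ L')] [∀ x, AddCommGroup (L' x)]
  [∀ x, Module ℝ (L' x)] [∀ x, TopologicalSpace (L' x)] [FiberBundle ℝ L'] [VectorBundle ℝ ℝ L']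
  {φ : C^∞⟮𝓡 n, N; 𝓡 m, M⟯}

/-! ### Tensoriality of the bracket -/

theorem gauge_leibniz [IsManifold (𝓡 m) ∞ M] (Δ : Gauge m L) : ∃ X : VField m M, ∀ f l,
    Δ.1 (fsmul f l) = fsmul (vfDeriv X f) l + fsmul f (Δ.1 l) := by
  obtain ⟨X, hX⟩ := Δ.2
  refine ⟨X, fun f l => ?_⟩
  ext y
  exact hX y f l

theorem fsmul_sub (f : C^∞⟮𝓡 m, M; ℝ⟯) (a b : Sec m L) :
    fsmul f (a - b) = fsmul f a - fsmul f b := by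
  ext x
  exact smul_sub _ _ _

section
variable [IsManifold (𝓡 m) ∞ M]

theorem gaugeBracket_apply (Δ E : Gauge m L) (l : Sec m L) :
    (gaugeBracket m L Δ E).1 l = Δ.1 (E.1 l) - E.1 (Δ.1 l) := rfl

theorem gaugeBracket_gsmul (Δ : Gauge m L) {X : VField m M}
    (hX : ∀ f l, Δ.1 (fsmul f l) = fsmul (vfDeriv X f) l + fsmul f (Δ.1 l))
    (f : C^∞⟮𝓡 m, M; ℝ⟯) (E : Gauge m L) :
    gaugeBracket m L Δ (gsmul f E) = gsmul (vfDeriv X f) E + gsmul f (gaugeBracket m L Δ E) := by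
  ext1; ext l x
  have h1 : (gaugeBracket m L Δ (gsmul f E)).1 l =
      fsmul (vfDeriv X f) (E.1 l) + fsmul f (Δ.1 (E.1 l)) - fsmul f (E.1 (Δ.1 l)) := by
    rw [gaugeBracket_apply, ← hX]; rfl
  rw [h1]
  change vfDeriv X f x • E.1 l x + f x • Δ.1 (E.1 l) x - f x • E.1 (Δ.1 l) x =
    vfDeriv X f x • E.1 l x + f x • (Δ.1 (E.1 l) x - E.1 (Δ.1 l) x)
  rw [smul_sub]; abel

theorem jetPair_gsmul (ψ : JetSec m L) (f : C^∞⟮𝓡 m, M; ℝ⟯) (E : Gauge m L) :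
    jetPair m L ψ (gsmul f E) = fsmul f (jetPair m L ψ E) := by
  ext x
  exact (ψ.1 x).map_smul (f x) (gaugeEval m L x E)

theorem dorfman_snd_apply (α β : OmniSec m L) (E : Gauge m L) :
    (dorfman m L α β).2 E =
      α.1.1 (jetPair m L β.2 E) - jetPair m L β.2 (gaugeBracket m L α.1 E) -
      (β.1.1 (jetPair m L α.2 E) - E.1 (jetPair m L α.2 β.1)
        - jetPair m L α.2 (gaugeBracket m L β.1 E)) := rfl

set_option maxHeartbeats 2000000 in
-- In `Δ⟨ψ, E⟩ - ⟨ψ, [Δ, E]⟩` the two terms produced by differentiating `f` cancel. The formula is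
-- regrouped into two such differences and the term `E⟨α.2, β.1⟩`, which is linear over functions in
-- `E` by itself.
theorem dorfman_gsmul (α β : OmniSec m L) (f : C^∞⟮𝓡 m, M; ℝ⟯) (E : Gauge m L) :
    (dorfman m L α β).2 (gsmul f E) = fsmul f ((dorfman m L α β).2 E) := by
  have key : ∀ (Δ : Gauge m L) (ψ : JetSec m L),
      Δ.1 (jetPair m L ψ (gsmul f E)) - jetPair m L ψ (gaugeBracket m L Δ (gsmul f E)) =
        fsmul f (Δ.1 (jetPair m L ψ E) - jetPair m L ψ (gaugeBracket m L Δ E)) := fun Δ ψ => by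
    obtain ⟨X, hX⟩ := gauge_leibniz Δ
    have h1 : Δ.1 (jetPair m L ψ (gsmul f E)) =
        fsmul (vfDeriv X f) (jetPair m L ψ E) + fsmul f (Δ.1 (jetPair m L ψ E)) := by
      rw [jetPair_gsmul, hX]
    have h2 : jetPair m L ψ (gaugeBracket m L Δ (gsmul f E)) =
        fsmul (vfDeriv X f) (jetPair m L ψ E) + fsmul f (jetPair m L ψ (gaugeBracket m L Δ E)) := by
      rw [gaugeBracket_gsmul Δ hX, ← jetPair_gsmul, ← jetPair_gsmul]
      exact (jetPair m L ψ).map_add _ _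
    rw [h1, h2, fsmul_sub]
    exact add_sub_add_left_eq_sub _ _ _
  have hdor : ∀ E' : Gauge m L, (dorfman m L α β).2 E' =
      α.1.1 (jetPair m L β.2 E') - jetPair m L β.2 (gaugeBracket m L α.1 E') -
      ((β.1.1 (jetPair m L α.2 E') - jetPair m L α.2 (gaugeBracket m L β.1 E'))
        - E'.1 (jetPair m L α.2 β.1)) := fun E' => by
    refine (dorfman_snd_apply α β E').trans ?_
    rw [sub_right_comm (β.1.1 (jetPair m L α.2 E'))]
  refine (hdor (gsmul f E)).trans (Eq.trans ?_ (congrArg (fsmul f) (hdor E)).symm)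
  rw [fsmul_sub f (_ - _), fsmul_sub f (_ - _) (E.1 _), ← key α.1 β.2, ← key β.1 α.2]
  rfl

theorem LineFrame.exists_jetSec (G : LineFrame m L Set.univ) (Φ : Gauge m L →ₗ[ℝ] Sec m L)
    (hΦ : ∀ f E, Φ (gsmul f E) = fsmul f (Φ E)) : ∃ ψ : JetSec m L, jetPair m L ψ = Φ := by
  refine ⟨∑ a, jsmul (G.q (Φ (G.gframe a))) (G.jframe a), LinearMap.ext fun E => ?_⟩
  have hE : E = ∑ a, gsmul (G.q (jetPair m L (G.jframe a) E)) (G.gframe a) := by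
    refine gauge_ext fun x => ?_
    conv_lhs => rw [G.gauge_expand (Set.mem_univ x) (gaugeEval m L x E)]
    rw [gaugeEval_sum]
    refine Finset.sum_congr rfl fun a _ => ?_
    rw [gaugeEval_gsmul, G.q_eq _ (Set.mem_univ x)]
    rfl
  conv_rhs => rw [hE]
  ext x
  rw [jetPair_apply, jetSec_sum_apply, map_sum, sec_sum_apply, LinearMap.sum_apply]
  refine Finset.sum_congr rfl fun a _ => ?_
  rw [hΦ, fsmul_apply, jsmul_apply, LinearMap.smul_apply,
    ← G.q_smul (Φ (G.gframe a)) x (Set.mem_univ x), smul_comm, G.q_smul _ x (Set.mem_univ x)]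
  rfl

/-- A functional linear over functions is a combination of the dual frame. The frame has to be
global, so this serves on the transversal; on `M` the required sections come from `integrable`. -/
theorem LineFrame.dorfman_mem_range (G : LineFrame m L Set.univ) (α β : OmniSec m L) :
    dorfman m L α β ∈ LinearMap.range (toFunctional m L) := by
  obtain ⟨ψ, hψ⟩ := G.exists_jetSec (dorfman m L α β).2 (dorfman_gsmul α β)
  exact ⟨((dorfman m L α β).1, ψ), Prod.ext rfl hψ⟩

end

/-! ### Agreement to first order -/

/-- Two sections have the same first jet at `y`. -/
def JetEq (y : N) (l l' : Sec n L') : Prop := ∀ Δ : GaugeFiber n L' y, Δ.1 l = Δ.1 l'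

namespace JetEq

variable {y : N} {l l' k k' : Sec n L'}

theorem sub (h : JetEq y l l') (h' : JetEq y k k') : JetEq y (l - k) (l' - k') := fun Δ => by
  rw [map_sub, map_sub, h, h']

theorem sum {ι : Type*} (s : Finset ι) {l l' : ι → Sec n L'} (h : ∀ i ∈ s, JetEq y (l i) (l' i)) :
    JetEq y (∑ i ∈ s, l i) (∑ i ∈ s, l' i) := fun Δ => by
  rw [map_sum, map_sum]
  exact Finset.sum_congr rfl fun i hi => h i hi Δ

theorem apply_gauge [IsManifold (𝓡 n) ∞ N] (h : JetEq y l l') (Δ : Gauge n L') :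
    Δ.1 l y = Δ.1 l' y := h (gaugeEval n L' y Δ)

/-- The identity is a derivation, so equality of first jets includes equality of values. -/
theorem apply [IsManifold (𝓡 n) ∞ N] (h : JetEq y l l') : l y = l' y := h.apply_gauge gaugeOne

theorem fsmul [IsManifold (𝓡 n) ∞ N] (h : JetEq y l l') {f f' : C^∞⟮𝓡 n, N; ℝ⟯} (h0 : f y = f' y)
    (h1 : mvfderiv (𝓡 n) f y = mvfderiv (𝓡 n) f' y) :
    JetEq y (fsmul f l) (GenContact.fsmul f' l') := fun Δ => by
  obtain ⟨v, hv⟩ := Δ.2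
  rw [hv, hv, h0, h1, h Δ, h.apply]

end JetEq

theorem mvfderiv_finset_sum {ι : Type} (s : Finset ι) (c : ι → ℝ) (f : ι → C^∞⟮𝓡 m, M; ℝ⟯) (x : M)
    (v : TangentSpace (𝓡 m) x) :
    mvfderiv (𝓡 m) (∑ i ∈ s, c i • f i : C^∞⟮𝓡 m, M; ℝ⟯) x v =
      ∑ i ∈ s, c i * mvfderiv (𝓡 m) (f i) x v := by
  have hd : ∀ f : C^∞⟮𝓡 m, M; ℝ⟯, MDifferentiableAt (𝓡 m) 𝓘(ℝ, ℝ) f x := fun f =>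
    (f.contMDiff x).mdifferentiableAt (by simp)
  let d : C^∞⟮𝓡 m, M; ℝ⟯ →+ ℝ := AddMonoidHom.mk' (fun f => mvfderiv (𝓡 m) f x v) fun a b => by
    rw [ContMDiffMap.coe_add, mvfderiv_add (hd a) (hd b)]
    rfl
  change d _ = _
  rw [map_sum]
  refine Finset.sum_congr rfl fun i _ => ?_
  change mvfderiv (𝓡 m) ((fun _ : M => c i) • ⇑(f i)) x v = _
  rw [mvfderiv_smul mdifferentiableAt_const (hd _), mvfderiv_const]
  simp

variable [IsManifold (𝓡 m) ∞ M] {V : Set M}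

/-- Functions extend to first order along an immersion. -/
theorem LineFrame.exists_firstOrder_extension (F : LineFrame m L V) {y : N} (hy : φ y ∈ V)
    (hinj : Function.Injective (mfderiv (𝓡 n) (𝓡 m) φ y)) (f : C^∞⟮𝓡 n, N; ℝ⟯) :
    ∃ g : C^∞⟮𝓡 m, M; ℝ⟯, g (φ y) = f y ∧
      mvfderiv (𝓡 n) (g.comp φ) y = mvfderiv (𝓡 n) f y := by
  -- Only the first jet at `y` is prescribed, so nothing has to be extended from the immersed
  -- submanifold. As `du ∘ dφ` is injective, every covector at `y` is a combination of the `d(u j ∘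
  -- φ)`; a constant then corrects the value.
  let D : TangentSpace (𝓡 n) y →ₗ[ℝ] (Fin m → ℝ) := LinearMap.pi fun j =>
    (mvfderiv (𝓡 m) (F.u j) (φ y)).toLinearMap ∘ₗ (mfderiv (𝓡 n) (𝓡 m) φ y).toLinearMap
  have hD : Function.Injective D := by
    refine (injective_iff_map_eq_zero D).2 fun v hv => hinj ?_
    rw [map_zero]
    exact F.symbol_inj _ hy _ fun j => congrFun hv j
  obtain ⟨r, hr⟩ := LinearMap.exists_leftInverse_of_injective D (LinearMap.ker_eq_bot.2 hD)
  let c : Fin m → ℝ := fun j => mvfderiv (𝓡 n) f y (r (Pi.single j 1))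
  have hc : ∀ w : Fin m → ℝ, mvfderiv (𝓡 n) f y (r w) = ∑ j, c j * w j := fun w => by
    conv_lhs => rw [LinearMap.pi_apply_eq_sum_univ r w]
    rw [map_sum]
    refine Finset.sum_congr rfl fun j _ => ?_
    rw [map_smul, smul_eq_mul, mul_comm]
    congr 3
    ext i
    simp [Pi.single_apply, eq_comm]
  let g₀ : C^∞⟮𝓡 m, M; ℝ⟯ := ∑ j, c j • F.u j
  let g : C^∞⟮𝓡 m, M; ℝ⟯ := g₀ + ⟨fun _ => f y - g₀ (φ y), contMDiff_const⟩
  refine ⟨g, ?_, ?_⟩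
  · change g₀ (φ y) + (f y - g₀ (φ y)) = f y
    ring
  · ext v
    have hd : ∀ f : C^∞⟮𝓡 m, M; ℝ⟯, MDifferentiableAt (𝓡 m) 𝓘(ℝ, ℝ) f (φ y) := fun f =>
      (f.contMDiff _).mdifferentiableAt (by simp)
    have h1 : mvfderiv (𝓡 n) (g.comp φ) y v
        = mvfderiv (𝓡 m) g (φ y) (mfderiv (𝓡 n) (𝓡 m) φ y v) :=
      mvfderiv_comp_apply (g := g) (f := φ) y (hd g)
        ((φ.contMDiff _).mdifferentiableAt (by simp)) v
    have h2 : mvfderiv (𝓡 m) g (φ y) = mvfderiv (𝓡 m) g₀ (φ y) := by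
      refine (mvfderiv_add (hd g₀) (hd _)).trans ?_
      change _ + mvfderiv (𝓡 m) (fun _ : M => f y - g₀ (φ y)) (φ y) = _
      rw [mvfderiv_const, add_zero]
    rw [h1, h2, mvfderiv_finset_sum]
    have h3 := hc (D v)
    have h4 : r (D v) = v := LinearMap.congr_fun hr v
    rw [h4] at h3
    exact h3.symm

namespace RegularMap

variable {P : RegularMap L L' φ} {y : N}

/-- A lift of `0` has the form `(0, ψ)` with `Φ^*ψ = 0`. If its image under `K` is again a lift,
then `J♯ψ` is a push-forward, which is the situation that `IsCosymplecticAt` excludes. -/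
theorem rel_zero_unique {K : GenContactStructure m L} (hT : P.IsCosymplecticAt K y)
    (hi : Function.Injective (P.push y)) {b : OmniFiber n L' y} {c : OmniFiber m L (φ y)}
    (h : P.Rel y 0 c) (k : P.Rel y b (K.fib (φ y) c)) : b = 0 ∧ c = 0 := by
  have h1 : c.1 = 0 := h.1.symm.trans (map_zero _)
  have h2 : K.fib (φ y) c = K.fib (φ y) (0, c.2) := congrArg _ (Prod.ext h1 rfl)
  have h3 : c.2 = 0 := hT c.2 h.2.symm ⟨b.1, k.1.trans (congrArg Prod.fst h2)⟩
  have hc : c = 0 := Prod.ext h1 h3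
  rw [hc, map_zero] at k
  exact ⟨Prod.ext (hi (k.1.trans (map_zero _).symm)) (k.2.trans (map_zero _)), hc⟩

theorem rel_unique {K : GenContactStructure m L} (hT : P.IsCosymplecticAt K y)
    (hi : Function.Injective (P.push y)) {a b b' : OmniFiber n L' y} {c c' : OmniFiber m L (φ y)}
    (h : P.Rel y a c) (k : P.Rel y b (K.fib (φ y) c)) (h' : P.Rel y a c')
    (k' : P.Rel y b' (K.fib (φ y) c')) : b = b' ∧ c = c' := by
  have := rel_zero_unique hT hi (b := b - b') (c := c - c') (sub_self a ▸ h.sub h')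
    (by rw [map_sub]; exact k.sub k')
  exact ⟨sub_eq_zero.1 this.1, sub_eq_zero.1 this.2⟩

end RegularMap

variable [IsManifold (𝓡 n) ∞ N]

/-! ### Relations to first order at a point and transfer of the bracket -/

namespace RegularMap

variable (P : RegularMap L L' φ)

/-- Derivations related by the bundle map to first order at `y`. -/
def GaugeRel (y : N) (E : Gauge n L') (E' : Gauge m L) : Prop :=
  ∀ l, JetEq y (E.1 (P.sec l)) (P.sec (E'.1 l))

/-- Sections of the first jet bundles related to first order at `y`. -/
def JetRel (y : N) (ψ : JetSec n L') (ψ' : JetSec m L) : Prop :=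
  ψ.1 y = P.pullJetFiber y (ψ'.1 (φ y)) ∧
  ∀ E E', P.GaugeRel y E E' → JetEq y (jetPair n L' ψ E) (P.sec (jetPair m L ψ' E'))

/-- Sections of the omni-Lie algebroids related to first order at `y`. -/
def SecRel (y : N) (α : OmniSec n L') (α' : OmniSec m L) : Prop :=
  P.GaugeRel y α.1 α'.1 ∧ P.JetRel y α.2 α'.2

/-- Values of brackets related at `y`. -/
def FunRel (y : N) (p : Gauge n L' × (Gauge n L' →ₗ[ℝ] Sec n L'))
    (p' : Gauge m L × (Gauge m L →ₗ[ℝ] Sec m L)) : Prop :=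
  P.push y (gaugeEval n L' y p.1) = gaugeEval m L (φ y) p'.1 ∧
  ∀ E E', P.GaugeRel y E E' → p.2 E y = P.fib y (p'.2 E' (φ y))

variable {P} {y : N}

theorem GaugeRel.push_eq {E : Gauge n L'} {E' : Gauge m L} (h : P.GaugeRel y E E') :
    P.push y (gaugeEval n L' y E) = gaugeEval m L (φ y) E' := by
  ext1; ext1 l
  apply (P.fib y).injective
  rw [P.fib_push, gaugeEval_apply, gaugeEval_apply, (h l).apply, P.sec_apply]

/-- The value at `y` of `Δ` applied to a section depends on its first jet only, so `E(P.sec l)` may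
be replaced by `P.sec (E' l)` under `Δ`, and symmetrically. -/
theorem gaugeBracket_push {Δ E : Gauge n L'} {Δ' E' : Gauge m L} (h : P.GaugeRel y Δ Δ')
    (k : P.GaugeRel y E E') :
    P.push y (gaugeEval n L' y (gaugeBracket n L' Δ E)) =
      gaugeEval m L (φ y) (gaugeBracket m L Δ' E') := by
  ext1; ext1 l
  apply (P.fib y).injective
  rw [P.fib_push, gaugeEval_apply, gaugeEval_apply, gaugeBracket_apply, gaugeBracket_apply,
    ContMDiffSection.coe_sub, ContMDiffSection.coe_sub, Pi.sub_apply, Pi.sub_apply, map_sub,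
    (k l).apply_gauge Δ, (h l).apply_gauge E, (h _).apply, (k _).apply, P.sec_apply, P.sec_apply]

set_option maxHeartbeats 800000 in
-- Each term of the bracket is either a jet contracted with a commutator or a derivative of a
-- pairing. The first needs related values, the second pairings that agree to first order; `JetRel`
-- records both.
theorem SecRel.dorfman {α β : OmniSec n L'} {α' β' : OmniSec m L} (h : P.SecRel y α α')
    (k : P.SecRel y β β') :
    P.FunRel y (GenContact.dorfman n L' α β) (GenContact.dorfman m L α' β') := by
  refine ⟨gaugeBracket_push h.1 k.1, fun E E' hE => ?_⟩
  have hb : ∀ {ψ : JetSec n L'} {ψ' : JetSec m L}, P.JetRel y ψ ψ' →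
      ∀ {Δ Δ'}, P.GaugeRel y Δ Δ' → jetPair n L' ψ (gaugeBracket n L' Δ E) y =
        P.fib y (jetPair m L ψ' (gaugeBracket m L Δ' E') (φ y)) := by
    intro ψ ψ' hψ Δ Δ' hΔ
    rw [jetPair_apply, hψ.1, P.pullJetFiber_apply, gaugeBracket_push hΔ hE, jetPair_apply]
  have hc : ∀ {ψ : JetSec n L'} {ψ' : JetSec m L}, P.JetRel y ψ ψ' →
      ∀ {Δ Δ' D D'}, P.GaugeRel y Δ Δ' → P.GaugeRel y D D' → D.1 (jetPair n L' ψ Δ) y =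
        P.fib y (D'.1 (jetPair m L ψ' Δ') (φ y)) := by
    intro ψ ψ' hψ Δ Δ' D D' hΔ hD
    rw [(hψ.2 _ _ hΔ).apply_gauge, (hD _).apply, P.sec_apply]
  rw [dorfman_snd_apply, dorfman_snd_apply]
  simp only [ContMDiffSection.coe_sub, Pi.sub_apply, map_sub]
  rw [hb k.2 h.1, hb h.2 k.1, hc k.2 hE h.1, hc h.2 hE k.1, hc h.2 k.1 hE]

theorem FunRel.add {p q : Gauge n L' × (Gauge n L' →ₗ[ℝ] Sec n L')}
    {p' q' : Gauge m L × (Gauge m L →ₗ[ℝ] Sec m L)} (h : P.FunRel y p p') (k : P.FunRel y q q') :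
    P.FunRel y (p + q) (p' + q') :=
  ⟨by rw [Prod.fst_add, Prod.fst_add, map_add, map_add, map_add, h.1, k.1], fun E E' hE => by
    rw [Prod.snd_add, Prod.snd_add, LinearMap.add_apply, LinearMap.add_apply,
      ContMDiffSection.coe_add, ContMDiffSection.coe_add, Pi.add_apply, Pi.add_apply, map_add,
      h.2 E E' hE, k.2 E E' hE]⟩

theorem FunRel.sub {p q : Gauge n L' × (Gauge n L' →ₗ[ℝ] Sec n L')}
    {p' q' : Gauge m L × (Gauge m L →ₗ[ℝ] Sec m L)} (h : P.FunRel y p p') (k : P.FunRel y q q') :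
    P.FunRel y (p - q) (p' - q') :=
  ⟨by rw [Prod.fst_sub, Prod.fst_sub, map_sub, map_sub, map_sub, h.1, k.1], fun E E' hE => by
    rw [Prod.snd_sub, Prod.snd_sub, LinearMap.sub_apply, LinearMap.sub_apply,
      ContMDiffSection.coe_sub, ContMDiffSection.coe_sub, Pi.sub_apply, Pi.sub_apply, map_sub,
      h.2 E E' hE, k.2 E E' hE]⟩

set_option maxHeartbeats 800000 in
-- Expanding in the frame leaves the pairings with the jets of `e` and `u j · e`, that is, `E`
-- applied to pulled-back sections. There the claim is the hypothesis on `E` and `E'`.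
theorem jetRel_pullJet (F : LineFrame m L V) (hφ : ∀ y, φ y ∈ V) (ψ : JetSec m L) :
    P.JetRel y (P.pullJet F hφ ψ) ψ := by
  refine ⟨rfl, fun E E' hE => ?_⟩
  have h1 : jetPair n L' (P.pullJet F hφ ψ) E =
      ∑ a, fsmul ((F.q (jetPair m L ψ (F.gframe a))).comp φ)
        (jetPair n L' (P.pullJframe F a) E) := by
    ext z
    rw [sec_sum_apply, jetPair_apply,
      pullJet_apply]
    conv_lhs => rw [F.jet_expand (hφ z) (ψ.1 (φ z))]
    rw [map_sum, LinearMap.sum_apply]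
    refine Finset.sum_congr rfl fun a _ => ?_
    rw [map_smul, ← pullJframe_apply, fsmul_apply, jetPair_apply,
      LinearMap.smul_apply]
    change _ = F.q _ (φ z) • _
    rw [F.q_eq _ (hφ z)]
    rfl
  have h2 : P.sec (jetPair m L ψ E') =
      ∑ a, fsmul ((F.q (jetPair m L ψ (F.gframe a))).comp φ)
        (P.sec (jetPair m L (F.jframe a) E')) := by
    ext z
    rw [sec_sum_apply, P.sec_apply,
      jetPair_apply]
    conv_lhs => rw [F.jet_expand (hφ z) (ψ.1 (φ z))]
    rw [LinearMap.sum_apply, map_sum]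
    refine Finset.sum_congr rfl fun a _ => ?_
    rw [fsmul_apply, P.sec_apply, jetPair_apply,
      LinearMap.smul_apply, map_smul]
    change _ = F.q _ (φ z) • _
    rw [F.q_eq _ (hφ z)]
    rfl
  rw [h1, h2]
  refine JetEq.sum _ fun a _ => JetEq.fsmul ?_ rfl rfl
  rcases a with _ | j
  · exact hE F.e
  · have h3 : jetPair n L' (P.pullJframe F (some j)) E = E.1 (P.sec (fsmul (F.u j) F.e)) -
        fsmul ((F.u j).comp φ) (E.1 (P.sec F.e)) := rfl
    have h4 : P.sec (jetPair m L (F.jframe (some j)) E') = P.sec (E'.1 (fsmul (F.u j) F.e)) -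
        fsmul ((F.u j).comp φ) (P.sec (E'.1 F.e)) := by
      rw [← P.sec_fsmul, ← map_sub]
      rfl
    rw [h3, h4]
    exact (hE _).sub ((hE _).fsmul rfl rfl)

set_option maxHeartbeats 800000 in
-- The coefficients of a lift live on `N` only. Replacing them by functions on `M` with the same
-- first jet along `φ` at `y` does not change the first jets of the resulting combinations.
theorem secRel_of_rel (F : LineFrame m L V) (hφ : ∀ y, φ y ∈ V) {ι : Type*} [Fintype ι]
    {α : OmniSec n L'} {f : ι → C^∞⟮𝓡 n, N; ℝ⟯} {a : ι → OmniSec m L}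
    (h : ∀ z, P.Rel z (omniEval n L' z α) (∑ i, f i z • omniEval m L (φ z) (a i)))
    {g : ι → C^∞⟮𝓡 m, M; ℝ⟯} (h0 : ∀ i, g i (φ y) = f i y)
    (h1 : ∀ i, mvfderiv (𝓡 n) ((g i).comp φ) y = mvfderiv (𝓡 n) (f i) y) :
    P.SecRel y α (∑ i, osmul (g i) (a i)) := by
  have hfst : (∑ i, osmul (g i) (a i)).1 = ∑ i, gsmul (g i) (a i).1 := by
    rw [Prod.fst_sum]; rfl
  have hsnd : (∑ i, osmul (g i) (a i)).2 = ∑ i, jsmul (g i) (a i).2 := by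
    rw [Prod.snd_sum]; rfl
  refine ⟨fun l => ?_, ?_, fun E E' hE => ?_⟩
  · have h2 : α.1.1 (P.sec l) = ∑ i, fsmul (f i) (P.sec ((a i).1.1 l)) := by
      ext z
      rw [sec_sum_apply]
      have h3 := (h z).1
      rw [sum_smul_omniEval, omniEval_fst] at h3
      have h4 := P.fib_push (gaugeEval n L' z α.1) l
      rw [h3, gaugeFiber_sum_apply, map_sum] at h4
      refine h4.symm.trans (Finset.sum_congr rfl fun i _ => ?_)
      rw [fsmul_apply, P.sec_apply, LinearEquiv.map_smul]
      rfl
    have h3 : P.sec ((∑ i, osmul (g i) (a i)).1.1 l) =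
        ∑ i, fsmul ((g i).comp φ) (P.sec ((a i).1.1 l)) := by
      rw [hfst, Submodule.coe_sum, LinearMap.sum_apply, map_sum]
      refine Finset.sum_congr rfl fun i _ => ?_
      rw [← P.sec_fsmul]
      rfl
    rw [h2, h3]
    exact JetEq.sum _ fun i _ => JetEq.fsmul (fun _ => rfl) (h0 i).symm (h1 i).symm
  · have h2 := (h y).2
    rw [omniEval_snd] at h2
    rw [h2, hsnd, jetSec_sum_apply, sum_smul_omniEval]
    refine congrArg _ (Finset.sum_congr rfl fun i _ => ?_)
    rw [jsmul_apply, h0]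
  · have h2 : jetPair n L' α.2 E =
        ∑ i, fsmul (f i) (jetPair n L' (P.pullJet F hφ (a i).2) E) := by
      ext z
      rw [sec_sum_apply, jetPair_apply]
      have h2 := (h z).2
      rw [omniEval_snd] at h2
      rw [h2, sum_smul_omniEval, map_sum, LinearMap.sum_apply]
      refine Finset.sum_congr rfl fun i _ => ?_
      rw [LinearMap.map_smul]
      rfl
    have h3 : P.sec (jetPair m L (∑ i, osmul (g i) (a i)).2 E') =
        ∑ i, fsmul ((g i).comp φ) (P.sec (jetPair m L (a i).2 E')) := by
      rw [hsnd, map_sum, LinearMap.sum_apply, map_sum]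
      refine Finset.sum_congr rfl fun i _ => ?_
      rw [← P.sec_fsmul]
      rfl
    rw [h2, h3]
    exact JetEq.sum _ fun i _ =>
      JetEq.fsmul ((P.jetRel_pullJet F hφ _).2 E E' hE) (h0 i).symm (h1 i).symm

theorem _root_.GenContact.LineFrame.exists_omniSec (G : LineFrame n L' Set.univ)
    (a : OmniFiber n L' y) : ∃ α : OmniSec n L', omniEval n L' y α = a :=
  ⟨∑ A, G.ocoord y A a • G.oframe A, by
    rw [omniEval_sum]
    conv_rhs => rw [G.omni_expand (Set.mem_univ y) a]
    rfl⟩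

/-- A jet is determined by its values on a frame, so it suffices that the frame derivations have
first order counterparts on `M`. -/
theorem FunRel.rel (G : LineFrame n L' Set.univ) {γ : OmniSec n L'} {γ' : OmniSec m L}
    (hext : ∀ E : Gauge n L', ∃ E', P.GaugeRel y E E')
    (h : P.FunRel y (toFunctional n L' γ) (toFunctional m L γ')) :
    P.Rel y (omniEval n L' y γ) (omniEval m L (φ y) γ') := by
  refine ⟨h.1, G.jet_ext (Set.mem_univ y) fun a => ?_⟩
  obtain ⟨E', hE'⟩ := hext (G.gframe a)
  have h1 := h.2 _ _ hE'
  rw [omniEval_snd, omniEval_snd, P.pullJetFiber_apply, hE'.push_eq]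
  exact h1

/-- Only real linearity of `sec` is part of the structure; linearity over functions follows from
`eval_sec`. -/
theorem sec_sum_osmul (K : GenContactStructure m L) {ι : Type*} (s : Finset ι)
    (g : ι → C^∞⟮𝓡 m, M; ℝ⟯) (a : ι → OmniSec m L) :
    K.sec (∑ i ∈ s, osmul (g i) (a i)) = ∑ i ∈ s, osmul (g i) (K.sec (a i)) := by
  refine omniSec_ext fun x => ?_
  rw [K.eval_sec, omniEval_sum, omniEval_sum, map_sum]
  refine Finset.sum_congr rfl fun i _ => ?_
  rw [omniEval_osmul, omniEval_osmul, LinearMap.map_smul, K.eval_sec]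

set_option maxHeartbeats 1000000 in
/-- A generalized contact structure induces one along a cosymplectic transversal. -/
theorem exists_induced (P : RegularMap L L' φ) (K : GenContactStructure m L) (F : LineFrame m L V)
    (G : LineFrame n L' Set.univ) (hG : G.e = P.sec F.e) (hφ : ∀ y, φ y ∈ V)
    (himm : ∀ y, Function.Injective (mfderiv (𝓡 n) (𝓡 m) φ y))
    (hT : ∀ y, P.IsCosymplecticAt K y) :
    ∃ K' : GenContactStructure n L', ∀ y a, ∃ c, P.Rel y a c ∧
      P.Rel y (K'.fib y a) (K.fib (φ y) c) := by
  have hi : ∀ y, Function.Injective (P.push y) := fun y =>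
    P.push_injective F G hG (hφ y) (himm y)
  have hex := P.exists_lift K F hG hφ hi hT
  have hfib : ∀ y (a : OmniFiber n L' y), ∃ b c, P.Rel y a c ∧ P.Rel y b (K.fib (φ y) c) := by
    intro y a
    obtain ⟨α, rfl⟩ := G.exists_omniSec a
    obtain ⟨f, β, h⟩ := hex α
    exact ⟨_, _, h y⟩
  choose! fib c hc hb using hfib
  choose lf sec hsec using hex
  -- Uniqueness of lifts does most of the remaining work: any lift whose image under `K` is a lift
  -- computes `fib`. Linearity, the square and integrability each come from exhibiting one.
  have hfib_eq : ∀ y a b c', P.Rel y a c' → P.Rel y b (K.fib (φ y) c') → fib y a = b :=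
    fun y a b c' h k => (rel_unique (hT y) (hi y) (hc y a) (hb y a) h k).1
  let fibL : ∀ y, OmniFiber n L' y →ₗ[ℝ] OmniFiber n L' y := fun y =>
    { toFun := fib y
      map_add' := fun a b => hfib_eq y _ _ (c y a + c y b) ((hc y a).add (hc y b))
        (by rw [map_add]; exact (hb y a).add (hb y b))
      map_smul' := fun t a => hfib_eq y _ _ (t • c y a) ((hc y a).smul t)
        (by rw [LinearMap.map_smul]; exact (hb y a).smul t) }
  have heval : ∀ α y, omniEval n L' y (sec α) = fibL y (omniEval n L' y α) := fun α y =>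
    (hfib_eq y _ _ _ (hsec α y).1 (hsec α y).2).symm
  let secL : OmniSec n L' →ₗ[ℝ] OmniSec n L' :=
    { toFun := sec
      map_add' := fun α β => omniSec_ext fun y => by
        rw [heval, map_add, map_add, map_add, heval, heval]
      map_smul' := fun t α => omniSec_ext fun y => by
        rw [heval, LinearMap.map_smul, LinearMap.map_smul, LinearMap.map_smul, heval]
        rfl }
  refine ⟨⟨fibL, secL, heval, fun y a => ?_, fun y a b => ?_, fun α β => ?_⟩,
    fun y a => ⟨c y a, hc y a, hb y a⟩⟩
  -- The lift of `fib y a` is `Kc`, and `K(Kc) = -c` lifts `-a`.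
  · refine hfib_eq y _ _ _ (hb y a) ?_
    rw [K.sq]
    exact (hc y a).neg
  · change pairing n L' y (fib y a) b + pairing n L' y a (fib y b) = 0
    rw [(hb y a).pairing_eq (hc y b), (hc y a).pairing_eq (hb y b), ← map_add, K.skew, map_zero]
  -- Both sides of the integrability identity are represented by sections `γ` and `γ'`; it remains
  -- to compare `secL γ` and `γ'` at each point.
  · obtain ⟨γ, hγ⟩ := add_mem (G.dorfman_mem_range (sec α) β) (G.dorfman_mem_range α (sec β))
    obtain ⟨γ', hγ'⟩ := sub_mem (G.dorfman_mem_range (sec α) (sec β)) (G.dorfman_mem_range α β)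
    refine ⟨γ, hγ, ?_⟩
    suffices h : secL γ = γ' by rw [h, hγ']; rfl
    refine omniSec_ext fun y => (heval γ y).trans ?_
    -- The same extended coefficients serve for `α` and for its image, because `K` is linear over
    -- functions.
    have hlift : ∀ α, ∃ α', P.SecRel y α α' ∧ P.SecRel y (sec α) (K.sec α') := by
      intro α
      choose g hg0 hg1 using fun A => F.exists_firstOrder_extension (hφ y) (himm y) (lf α A)
      refine ⟨∑ A, osmul (g A) (F.oframe A),
        secRel_of_rel F hφ (fun z => (hsec α z).1) hg0 hg1, ?_⟩
      rw [sec_sum_osmul]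
      refine secRel_of_rel F hφ (fun z => ?_) hg0 hg1
      rw [sum_smul_omniEval, ← fib_sum]
      exact (hsec α z).2
    -- A derivation on `N` is extended to first order as the derivation part of a lift of `(E, 0)`.
    have hext : ∀ E : Gauge n L', ∃ E', P.GaugeRel y E E' := fun E =>
      let ⟨α', h, _⟩ := hlift (E, 0)
      ⟨α'.1, h.1⟩
    obtain ⟨α', hα, hKα⟩ := hlift α
    obtain ⟨β', hβ, hKβ⟩ := hlift β
    obtain ⟨δ, hδ, hδ'⟩ := K.integrable α' β'
    have h1 : P.FunRel y (toFunctional n L' γ) (toFunctional m L δ) := by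
      rw [hγ, hδ]
      exact (hKα.dorfman hβ).add (hα.dorfman hKβ)
    have h2 : P.FunRel y (toFunctional n L' γ') (toFunctional m L (K.sec δ)) := by
      rw [hγ', ← hδ']
      exact (hKα.dorfman hKβ).sub (hα.dorfman hβ)
    have h3 := h2.rel G hext
    rw [K.eval_sec] at h3
    exact hfib_eq y _ _ _ (h1.rel G hext) h3

end RegularMap

end Induced

section Complexification

/-! ### Complexification -/

section Monoid

variable {V W : Type*} [AddCommMonoid V] [Module ℝ V] [AddCommMonoid W] [Module ℝ W]

/-- The element `u + i v` of the complexification. -/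
def cplx (u v : V) : ℂ ⊗[ℝ] V := (1 : ℂ) ⊗ₜ u + Complex.I ⊗ₜ v

/-- The expected real part is `B a b - B a' b'`; the hypothesis is stated without subtraction, so
additive monoids suffice. -/
theorem baseChange_cplx_eq_bilin (f : V →ₗ[ℝ] W) (B : LinearMap.BilinMap ℝ V W)
    {a b a' b' c c' : V} (h : f c + B a' b' = B a b) (h' : f c' = B a b' + B a' b) :
    f.baseChange ℂ (cplx c c') = B.baseChange ℂ (cplx a a') (cplx b b') := by
  simp only [cplx, map_add, LinearMap.add_apply, LinearMap.BilinMap.baseChange_tmul, one_mul,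
    mul_one, Complex.I_mul_I, LinearMap.baseChange_tmul, ← h, h', TensorProduct.tmul_add]
  have : (1 : ℂ) ⊗ₜ[ℝ] B a' b' + (-1 : ℂ) ⊗ₜ[ℝ] B a' b' = 0 := by
    rw [← TensorProduct.add_tmul, add_neg_cancel, TensorProduct.zero_tmul]
  calc _ = (1 : ℂ) ⊗ₜ[ℝ] f c + (Complex.I ⊗ₜ B a b' + Complex.I ⊗ₜ B a' b) +
        ((1 : ℂ) ⊗ₜ[ℝ] B a' b' + (-1 : ℂ) ⊗ₜ[ℝ] B a' b') := by rw [this, add_zero]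
    _ = _ := by abel

end Monoid

variable {V W X : Type*} [AddCommGroup V] [Module ℝ V] [AddCommGroup W] [Module ℝ W]
  [AddCommGroup X] [Module ℝ X]

theorem cplx_add (u v u' v' : V) : cplx u v + cplx u' v' = cplx (u + u') (v + v') := by
  simp only [cplx, TensorProduct.tmul_add]
  abel

theorem tmul_eq_cplx (z : ℂ) (u : V) : z ⊗ₜ[ℝ] u = cplx (z.re • u) (z.im • u) := by
  rw [cplx, ← TensorProduct.smul_tmul, ← TensorProduct.smul_tmul, ← TensorProduct.add_tmul]
  congr 1
  apply Complex.ext <;> simp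

theorem exists_cplx (a : ℂ ⊗[ℝ] V) : ∃ u v, a = cplx u v := by
  induction a with
  | zero => exact ⟨0, 0, by simp [cplx]⟩
  | tmul z u => exact ⟨_, _, tmul_eq_cplx z u⟩
  | add a b ha hb =>
    obtain ⟨u, v, rfl⟩ := ha
    obtain ⟨u', v', rfl⟩ := hb
    exact ⟨_, _, cplx_add _ _ _ _⟩

variable (V) in
/-- The real part on a complexification. -/
def cplxRe : ℂ ⊗[ℝ] V →ₗ[ℝ] V :=
  (TensorProduct.lid ℝ V).toLinearMap ∘ₗ TensorProduct.map Complex.reLm LinearMap.id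

variable (V) in
/-- The imaginary part on a complexification. -/
def cplxIm : ℂ ⊗[ℝ] V →ₗ[ℝ] V :=
  (TensorProduct.lid ℝ V).toLinearMap ∘ₗ TensorProduct.map Complex.imLm LinearMap.id

@[simp] theorem cplxRe_cplx (u v : V) : cplxRe V (cplx u v) = u := by simp [cplxRe, cplx]

@[simp] theorem cplxIm_cplx (u v : V) : cplxIm V (cplx u v) = v := by simp [cplxIm, cplx]

theorem cplx_inj {u v u' v' : V} : cplx u v = cplx u' v' ↔ u = u' ∧ v = v' :=
  ⟨fun h => ⟨by simpa using congrArg (cplxRe V) h, by simpa using congrArg (cplxIm V) h⟩,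
    fun h => by rw [h.1, h.2]⟩

@[simp] theorem cplx_zero : cplx (0 : V) 0 = 0 := by simp [cplx]

theorem smul_cplx (z : ℂ) (u v : V) :
    z • cplx u v = cplx (z.re • u - z.im • v) (z.im • u + z.re • v) := by
  rw [cplx, smul_add, TensorProduct.smul_tmul', TensorProduct.smul_tmul', tmul_eq_cplx,
    tmul_eq_cplx, cplx_add]
  simp [sub_eq_add_neg]

@[simp] theorem baseChange_cplx (f : V →ₗ[ℝ] W) (u v : V) :
    f.baseChange ℂ (cplx u v) = cplx (f u) (f v) := by
  simp [cplx]

theorem conjC_cplx (u v : V) : conjC V (cplx u v) = cplx u (-v) := by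
  simp [cplx, conjC, TensorProduct.neg_tmul, TensorProduct.tmul_neg]

theorem bilin_cplx (B : LinearMap.BilinMap ℝ V W) (u v u' v' : V) :
    B.baseChange ℂ (cplx u v) (cplx u' v') =
      cplx (B u u' - B v v') (B u v' + B v u') := by
  simp only [cplx, map_add, LinearMap.add_apply, LinearMap.BilinMap.baseChange_tmul, one_mul,
    mul_one, Complex.I_mul_I, TensorProduct.neg_tmul, TensorProduct.tmul_sub,
    TensorProduct.tmul_add]
  abel

theorem sum_cplx {ι : Type*} (s : Finset ι) (u v : ι → V) :
    ∑ i ∈ s, cplx (u i) (v i) = cplx (∑ i ∈ s, u i) (∑ i ∈ s, v i) := by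
  simp only [cplx, Finset.sum_add_distrib, TensorProduct.tmul_sum]

/-- The eigenvalue equation says `Tu = -v` and `Tv = u`; the second follows from the first because
`T² = -1`. -/
theorem cplx_mem_eigenspace {T : V →ₗ[ℝ] V} (hT : ∀ v, T (T v) = -v) {u v : V} :
    cplx u v ∈ Module.End.eigenspace (T.baseChange ℂ) Complex.I ↔ v = -T u := by
  rw [Module.End.mem_eigenspace_iff, baseChange_cplx, smul_cplx, cplx_inj]
  simp only [Complex.I_re, Complex.I_im, zero_smul, one_smul, zero_sub, add_zero]
  constructor
  · rintro ⟨h, -⟩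
    rw [h, neg_neg]
  · rintro rfl
    rw [neg_neg, map_neg, hT, neg_neg]
    exact ⟨rfl, rfl⟩

/-- Elements of either eigenspace have the form `w - iTw`, so the complex identity reduces to real
pairs `s, t` in `X` with `f t = T (f s)`. In the application `X` holds a derivation on `N` together
with a jet on `M`. -/
theorem eigenspace_eq_map_comap {T : V →ₗ[ℝ] V} {T' : W →ₗ[ℝ] W} (hT : ∀ v, T (T v) = -v)
    (hT' : ∀ v, T' (T' v) = -v) (f : X →ₗ[ℝ] V) (g : X →ₗ[ℝ] W)
    (h1 : ∀ a, ∃ s t, g s = a ∧ g t = T' a ∧ f t = T (f s))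
    (h2 : ∀ s t, f t = T (f s) → g t = T' (g s)) :
    Module.End.eigenspace (T'.baseChange ℂ) Complex.I =
      ((Module.End.eigenspace (T.baseChange ℂ) Complex.I).comap (f.baseChange ℂ)).map
        (g.baseChange ℂ) := by
  ext a
  rw [Submodule.mem_map]
  constructor
  · intro ha
    obtain ⟨u, v, rfl⟩ := exists_cplx a
    rw [cplx_mem_eigenspace hT'] at ha
    obtain ⟨s, t, hs, ht, hst⟩ := h1 u
    refine ⟨cplx s (-t), ?_, ?_⟩
    · rw [Submodule.mem_comap, baseChange_cplx, cplx_mem_eigenspace hT, map_neg, hst]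
    · rw [baseChange_cplx, map_neg, hs, ht, ha]
  · rintro ⟨b, hb, rfl⟩
    obtain ⟨u, v, rfl⟩ := exists_cplx b
    rw [Submodule.mem_comap, baseChange_cplx, cplx_mem_eigenspace hT] at hb
    rw [baseChange_cplx, cplx_mem_eigenspace hT']
    have := h2 u (-v) (by rw [map_neg, hb, neg_neg])
    rw [← this, map_neg, neg_neg]

/-- A complex structure on a real vector space has a basis adapted to it. -/
theorem exists_complex_basis [FiniteDimensional ℝ V] (J : V →ₗ[ℝ] V) (hJ : ∀ v, J (J v) = -v) :
    ∃ (k : ℕ) (a : Fin k → V), LinearIndependent ℝ (Sum.elim a (J ∘ a)) ∧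
      Submodule.span ℝ (Set.range (Sum.elim a (J ∘ a))) = ⊤ := by
  -- Multiplication by `i` is taken to be `J`; a complex basis together with its `J`-image is a real
  -- basis.
  let ρ : ℂ →ₐ[ℝ] Module.End ℝ V := Complex.lift ⟨J, by ext v; simp [hJ]⟩
  let : Module ℂ V := Module.compHom V ρ.toRingHom
  have hsmul : ∀ (z : ℂ) (v : V), z • v = z.re • v + z.im • J v := fun z v => by
    change ρ z v = _
    simp [ρ, Complex.liftAux_apply]
  have : IsScalarTower ℝ ℂ V := ⟨fun c z v => by
    rw [hsmul, hsmul, Complex.smul_re, Complex.smul_im, smul_add, smul_smul, smul_smul]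
    rfl⟩
  have : Module.Finite ℂ V := Module.Finite.of_restrictScalars_finite ℝ ℂ V
  let b := Module.finBasis ℂ V
  let B := (Complex.basisOneI.smulTower b)
  refine ⟨_, b, ?_⟩
  let e : Fin (Module.finrank ℂ V) ⊕ Fin (Module.finrank ℂ V) ≃ Fin 2 × Fin (Module.finrank ℂ V) :=
    { toFun := Sum.elim (fun i => (0, i)) fun i => (1, i)
      invFun := fun p => if p.1 = 0 then .inl p.2 else .inr p.2
      left_inv := by rintro (i | i) <;> simp
      right_inv := by rintro ⟨p, i⟩; fin_cases p <;> simp }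
  have hB : Sum.elim b (J ∘ b) = B ∘ e := by
    funext i
    rcases i with i | i
    · simp [B, e, Module.Basis.smulTower_apply]
    · simp [B, e, Module.Basis.smulTower_apply, hsmul]
  rw [hB]
  refine ⟨B.linearIndependent.comp _ e.injective, ?_⟩
  rw [e.surjective.range_comp, B.span_eq]

end Complexification

section Eigenbundle

variable {m : ℕ} {M : Type*} [TopologicalSpace M] [ChartedSpace (EuclideanSpace ℝ (Fin m)) M]
  {L : M → Type*} [TopologicalSpace (TotalSpace ℝ L)] [∀ x, AddCommGroup (L x)]
  [∀ x, Module ℝ (L x)] [∀ x, TopologicalSpace (L x)] [FiberBundle ℝ L] [VectorBundle ℝ ℝ L]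

/-! ### The eigenbundle of a generalized contact structure -/

/-- Test against `(0, f · e)` for all linear forms `f`, which separate points, and against `(Δ, 0)`.
-/
theorem pairing_nondegenerate {x : M} {e : L x} (he : e ≠ 0) {a : OmniFiber m L x}
    (h : ∀ b, pairing m L x a b = 0) : a = 0 := by
  refine Prod.ext ((Module.forall_dual_apply_eq_zero_iff ℝ a.1).1 fun f => ?_)
    (LinearMap.ext fun Δ => ?_)
  · have := h (0, LinearMap.toSpanSingleton ℝ (L x) e ∘ₗ f)
    have h2 : f a.1 • e + a.2 0 = 0 := this
    rw [map_zero, add_zero] at h2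
    exact (smul_eq_zero.1 h2).resolve_right he
  · have h2 : (0 : JetFiber m L x) a.1 + a.2 Δ = 0 := h (Δ, 0)
    rw [LinearMap.zero_apply, zero_add] at h2
    exact h2

variable [IsManifold (𝓡 m) ∞ M]

namespace LineFrame

/-- The coordinates on the fibres of the omni-Lie algebroid, as a linear equivalence. -/
def ocoordEquiv (G : LineFrame m L Set.univ) (x : M) :
    OmniFiber m L x ≃ₗ[ℝ] (Option (Fin m) ⊕ Option (Fin m) → ℝ) :=
  LinearEquiv.ofLinearMap (LinearMap.pi fun A => G.ocoord x A)
    (LinearMap.lsum ℝ (fun _ => ℝ) ℝ fun A =>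
      LinearMap.toSpanSingleton ℝ _ (omniEval m L x (G.oframe A)))
    (by
      refine LinearMap.ext fun c => funext fun A => ?_
      simp only [LinearMap.comp_apply, LinearMap.lsum_apply, LinearMap.sum_apply,
        LinearMap.proj_apply, LinearMap.toSpanSingleton_apply, LinearMap.pi_apply, map_sum,
        map_smul, G.ocoord_oframe _ _ (Set.mem_univ x), LinearMap.id_apply, smul_eq_mul, mul_ite,
        mul_one, mul_zero, Finset.sum_ite_eq, Finset.mem_univ, if_true])
    (by
      refine LinearMap.ext fun a => ?_
      conv_rhs => rw [G.omni_expand (Set.mem_univ x) a]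
      simp only [LinearMap.comp_apply, LinearMap.lsum_apply, LinearMap.sum_apply,
        LinearMap.proj_apply, LinearMap.toSpanSingleton_apply, LinearMap.pi_apply,
        LinearMap.id_apply])

theorem finiteDimensional (G : LineFrame m L Set.univ) (x : M) :
    FiniteDimensional ℝ (OmniFiber m L x) :=
  Module.Finite.equiv (G.ocoordEquiv x).symm

/-- Linear independence of sections is an open condition. -/
theorem eventually_linearIndependent (G : LineFrame m L Set.univ) {ι : Type*} [Finite ι]
    (α : ι → OmniSec m L) {x : M}
    (h : LinearIndependent ℝ fun i => omniEval m L x (α i)) :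
    ∀ᶠ y in 𝓝 x, LinearIndependent ℝ fun i => omniEval m L y (α i) := by
  let c : M → ι → (Option (Fin m) ⊕ Option (Fin m)) → ℝ := fun y i A => G.ocoordSec (α i) A y
  have hc : Continuous c := continuous_pi fun i => continuous_pi fun A =>
    (G.ocoordSec (α i) A).contMDiff.continuous
  have hiff : ∀ y, LinearIndependent ℝ (c y) ↔
      LinearIndependent ℝ fun i => omniEval m L y (α i) := fun y => by
    rw [← LinearMap.linearIndependent_iff (G.ocoordEquiv y).toLinearMap (G.ocoordEquiv y).ker]
    have : c y = ⇑(G.ocoordEquiv y).toLinearMap ∘ fun i => omniEval m L y (α i) := by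
      funext i A
      exact G.ocoordSec_apply (α i) A (Set.mem_univ y)
    rw [this]
  have := (isOpen_setOfPred_linearIndependent (𝕜 := ℝ) (ι := ι)
    (E := (Option (Fin m) ⊕ Option (Fin m)) → ℝ)).preimage hc
  filter_upwards [this.mem_nhds ((hiff x).2 h)] with y hy using (hiff y).1 hy

end LineFrame

namespace GenContactStructure

variable (K : GenContactStructure m L)

theorem cplx_mem_eigenbundle {x : M} {u v : OmniFiber m L x} :
    cplx u v ∈ K.eigenbundle x ↔ v = -K.fib x u :=
  cplx_mem_eigenspace (K.sq x)

theorem mem_eigenbundle_iff {x : M} {a : OmniFiberC m L x} :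
    a ∈ K.eigenbundle x ↔ ∃ u, a = cplx u (-K.fib x u) := by
  constructor
  · obtain ⟨u, v, rfl⟩ := exists_cplx a
    intro h
    exact ⟨u, by rw [K.cplx_mem_eigenbundle.1 h]⟩
  · rintro ⟨u, rfl⟩
    exact K.cplx_mem_eigenbundle.2 rfl

set_option maxHeartbeats 1000000 in
-- Extend a complex basis of the fibre at `x`, with complex structure `K`, to sections `α i`. Then
-- `α i` and `Kα i` stay independent near `x` and span since the rank is constant. The sections `α i
-- - iKα i` form the local frame.
theorem smooth_eigenbundle (G : LineFrame m L Set.univ) (x : M) :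
    ∃ (k : ℕ) (s : Fin k → OmniSecC m L), ∀ᶠ y in 𝓝 x,
      LinearIndependent ℂ (fun i => omniEvalC m L y (s i)) ∧
      Submodule.span ℂ (Set.range fun i => omniEvalC m L y (s i)) = K.eigenbundle y := by
  have := G.finiteDimensional
  obtain ⟨k, a, hli, hsp⟩ := exists_complex_basis (K.fib x) (K.sq x)
  have hex : ∀ a : OmniFiber m L x, ∃ α : OmniSec m L, omniEval m L x α = a := fun a =>
    ⟨∑ A, G.ocoord x A a • G.oframe A, by
      rw [omniEval_sum]
      conv_rhs => rw [G.omni_expand (Set.mem_univ x) a]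
      rfl⟩
  choose α hα using fun i => hex (a i)
  refine ⟨k, fun i => cplx (α i) (-K.sec (α i)), ?_⟩
  have hcard : ∀ y, Fintype.card (Fin k ⊕ Fin k) = Module.finrank ℝ (OmniFiber m L y) := fun y => by
    rw [(G.ocoordEquiv y).finrank_eq, ← (G.ocoordEquiv x).finrank_eq]
    exact (Module.finrank_eq_card_basis (Module.Basis.mk hli hsp.ge)).symm
  have hsum : ∀ y, (fun i => omniEval m L y (Sum.elim α (K.sec ∘ α) i)) =
      Sum.elim (fun i => omniEval m L y (α i)) fun i => K.fib y (omniEval m L y (α i)) := by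
    intro y
    funext i
    rcases i with i | i
    · rfl
    · exact K.eval_sec _ _
  have hx : LinearIndependent ℝ fun i => omniEval m L x (Sum.elim α (K.sec ∘ α) i) := by
    rw [hsum]
    simp only [hα]
    exact hli
  filter_upwards [G.eventually_linearIndependent _ hx] with y hy
  have hspan := hy.span_eq_top_of_card_eq_finrank' (hcard y)
  rw [hsum] at hy hspan
  set b : Fin k → OmniFiber m L y := fun i => omniEval m L y (α i) with hb
  have hs : (fun i => omniEvalC m L y (cplx (α i) (-K.sec (α i)))) =
      fun i => cplx (b i) (-K.fib y (b i)) := by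
    funext i
    rw [omniEvalC, baseChange_cplx, map_neg, K.eval_sec]
  rw [hs]
  -- `z(b - iKb) = w - iKw` with `w = Re z · b + Im z · Kb`, so complex combinations become real
  -- combinations of the `b i` and `K b i`.
  have hcomb : ∀ z : Fin k → ℂ, ∑ i, z i • cplx (b i) (-K.fib y (b i)) =
      cplx (∑ i, ((z i).re • b i + (z i).im • K.fib y (b i)))
        (-K.fib y (∑ i, ((z i).re • b i + (z i).im • K.fib y (b i)))) := fun z => by
    simp only [smul_cplx, sum_cplx, map_sum, map_add, map_smul, K.sq, ← Finset.sum_neg_distrib]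
    rw [cplx_inj]
    constructor <;> refine Finset.sum_congr rfl fun i _ => ?_
    · rw [smul_neg, sub_neg_eq_add]
    · simp only [smul_neg]
      abel
  constructor
  · rw [Fintype.linearIndependent_iff]
    intro z hz i
    rw [hcomb, ← cplx_zero, cplx_inj] at hz
    have h1 := Fintype.linearIndependent_iff.1 hy
      (Sum.elim (fun i => (z i).re) fun i => (z i).im) (by
        rw [Fintype.sum_sum_type, ← Finset.sum_add_distrib]
        exact hz.1)
    exact Complex.ext (h1 (.inl i)) (h1 (.inr i))
  · refine le_antisymm (Submodule.span_le.2 ?_) fun c hc => ?_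
    · rintro _ ⟨i, rfl⟩
      exact K.cplx_mem_eigenbundle.2 rfl
    · obtain ⟨u, rfl⟩ := K.mem_eigenbundle_iff.1 hc
      have hu : u ∈ Submodule.span ℝ (Set.range (Sum.elim b fun i => K.fib y (b i))) :=
        hspan ▸ Submodule.mem_top
      obtain ⟨t, ht⟩ := (Submodule.mem_span_range_iff_exists_fun ℝ).1 hu
      rw [Fintype.sum_sum_type, ← Finset.sum_add_distrib] at ht
      have := hcomb fun i => ⟨t (.inl i), t (.inr i)⟩
      have h2 : u = ∑ i, (t (.inl i) • b i + t (.inr i) • K.fib y (b i)) := ht.symm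
      simp only [← h2] at this
      rw [← this]
      exact Submodule.sum_mem _ fun i _ =>
        Submodule.smul_mem _ _ (Submodule.subset_span ⟨i, rfl⟩)

theorem fib_pairing (x : M) (a b : OmniFiber m L x) :
    pairing m L x (K.fib x a) (K.fib x b) = pairing m L x a b := by
  have := K.skew x a (K.fib x b)
  rwa [K.sq, map_neg, add_neg_eq_zero] at this

theorem isotropic_eigenbundle {x : M} {a b : OmniFiberC m L x} (ha : a ∈ K.eigenbundle x)
    (hb : b ∈ K.eigenbundle x) : (pairing m L x).baseChange ℂ a b = 0 := by
  obtain ⟨u, rfl⟩ := K.mem_eigenbundle_iff.1 ha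
  obtain ⟨v, rfl⟩ := K.mem_eigenbundle_iff.1 hb
  rw [bilin_cplx, ← cplx_zero, cplx_inj]
  simp only [map_neg, LinearMap.neg_apply, neg_neg, K.fib_pairing, sub_self, true_and]
  rw [← neg_add, add_comm, K.skew, neg_zero]

/-- If `u + iv` is orthogonal to every `b - iKb`, the imaginary part and skewness show that `v + Ku`
pairs to zero with every `b`, so `v = -Ku`. -/
theorem maximal_isotropic_eigenbundle {x : M} {e : L x} (he : e ≠ 0) :
    Maximal (fun W : Submodule ℂ (OmniFiberC m L x) =>
      ∀ a ∈ W, ∀ b ∈ W, (pairing m L x).baseChange ℂ a b = 0) (K.eigenbundle x) := by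
  refine ⟨fun a ha b hb => K.isotropic_eigenbundle ha hb, fun W hW hle w hw => ?_⟩
  obtain ⟨u, v, rfl⟩ := exists_cplx w
  rw [K.cplx_mem_eigenbundle]
  refine eq_neg_of_add_eq_zero_left (pairing_nondegenerate he fun b => ?_)
  have h := hW _ hw _ (hle (K.cplx_mem_eigenbundle (u := b).2 rfl))
  rw [bilin_cplx, ← cplx_zero, cplx_inj] at h
  have h2 := h.2
  have h3 := K.skew x u b
  rw [map_neg] at h2
  rw [map_add, LinearMap.add_apply]
  rw [eq_neg_of_add_eq_zero_left h3, ← h2]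
  abel

set_option maxHeartbeats 1000000 in
-- With `γ = ⟦Ka, b⟧ + ⟦a, Kb⟧`, integrability gives `⟦a - iKa, b - iKb⟧ = -Kγ - iγ`, which is `w -
-- iKw` for `w = -Kγ`.
theorem involutive_eigenbundle (α β : OmniSecC m L) (hα : ∀ x, omniEvalC m L x α ∈ K.eigenbundle x)
    (hβ : ∀ x, omniEvalC m L x β ∈ K.eigenbundle x) :
    ∃ γ : OmniSecC m L, (∀ x, omniEvalC m L x γ ∈ K.eigenbundle x) ∧
      (toFunctional m L).baseChange ℂ γ = (dorfman m L).baseChange ℂ α β := by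
  have hform : ∀ α : OmniSecC m L, (∀ x, omniEvalC m L x α ∈ K.eigenbundle x) →
      ∃ a, α = cplx a (-K.sec a) := fun α hα => by
    obtain ⟨a, a', rfl⟩ := exists_cplx α
    refine ⟨a, ?_⟩
    have : a' = -K.sec a := omniSec_ext fun x => by
      have := hα x
      rw [omniEvalC, baseChange_cplx, K.cplx_mem_eigenbundle] at this
      rw [this, map_neg, K.eval_sec]
    rw [this]
  obtain ⟨a, rfl⟩ := hform α hα
  obtain ⟨b, rfl⟩ := hform β hβ
  obtain ⟨γ, h1, h2⟩ := K.integrable a b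
  refine ⟨cplx (-K.sec γ) (-γ), fun x => ?_, ?_⟩
  · rw [omniEvalC, baseChange_cplx, K.cplx_mem_eigenbundle, map_neg, map_neg, map_neg, K.eval_sec,
      K.sq, neg_neg]
  · refine baseChange_cplx_eq_bilin (toFunctional m L) (dorfman m L) ?_ ?_
    · have e1 := LinearMap.map_neg₂ (dorfman m L) (K.sec a) (-K.sec b)
      have e2 := (dorfman m L (K.sec a)).map_neg (K.sec b)
      have e3 := (toFunctional m L).map_neg (K.sec γ)
      rw [e1, e2, e3, ← h2, neg_neg, neg_sub, sub_add_cancel]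
    · have e1 := LinearMap.map_neg₂ (dorfman m L) (K.sec a) b
      have e2 := (dorfman m L a).map_neg (K.sec b)
      have e3 := (toFunctional m L).map_neg γ
      exact e3.trans (((congrArg Neg.neg h1).trans (neg_add_rev _ _)).trans
        (congrArg₂ (· + ·) e2.symm e1.symm))

/-- If `u - iKu` and its conjugate both lie in the eigenbundle then `Ku = -Ku`, hence `Ku = 0` and
`u = 0`. -/
theorem isGenContactType_eigenbundle (G : LineFrame m L Set.univ) :
    IsGenContactType K.eigenbundle := by
  refine ⟨⟨K.smooth_eigenbundle G, fun x => K.maximal_isotropic_eigenbundle (G.e_ne x trivial),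
    K.involutive_eigenbundle⟩, fun x a ha hca => ?_⟩
  obtain ⟨u, rfl⟩ := K.mem_eigenbundle_iff.1 ha
  rw [conjC_cplx, K.cplx_mem_eigenbundle, neg_neg, eq_neg_iff_add_eq_zero, ← two_smul ℝ,
    smul_eq_zero] at hca
  have h := hca.resolve_left two_ne_zero
  have hu : u = 0 := by
    have h2 := K.sq x u
    rw [h, map_zero] at h2
    exact neg_eq_zero.1 h2.symm
  rw [hu, map_zero, neg_zero, cplx_zero]

end GenContactStructure

end Eigenbundle

/-! ### The eigenbundle of the induced structure as a backward image -/

section BackwardImage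

variable {m n : ℕ} {M N : Type*} [TopologicalSpace M]
  [ChartedSpace (EuclideanSpace ℝ (Fin m)) M] [TopologicalSpace N]
  [ChartedSpace (EuclideanSpace ℝ (Fin n)) N]
  {L : M → Type*} [TopologicalSpace (TotalSpace ℝ L)] [∀ x, AddCommGroup (L x)]
  [∀ x, Module ℝ (L x)] [∀ x, TopologicalSpace (L x)] [FiberBundle ℝ L] [VectorBundle ℝ ℝ L]
  {L' : N → Type*} [TopologicalSpace (TotalSpace ℝ L')] [∀ x, AddCommGroup (L' x)]
  [∀ x, Module ℝ (L' x)] [∀ x, TopologicalSpace (L' x)] [FiberBundle ℝ L'] [VectorBundle ℝ ℝ L']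
  {φ : C^∞⟮𝓡 n, N; 𝓡 m, M⟯} [IsManifold (𝓡 m) ∞ M] [IsManifold (𝓡 n) ∞ N]

/-- A pair of a derivation on `N` and a jet on `M` is the same as a point on `N` with a chosen lift.
One inclusion uses that lifts exist, the other that they are unique (`rel_unique`). -/
theorem RegularMap.eigenbundle_eq (P : RegularMap L L' φ) (K : GenContactStructure m L)
    (K' : GenContactStructure n L')
    (h : ∀ y a, ∃ c, P.Rel y a c ∧ P.Rel y (K'.fib y a) (K.fib (φ y) c)) (y : N)
    (hT : P.IsCosymplecticAt K y) (hi : Function.Injective (P.push y)) :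
    K'.eigenbundle y = ((K.eigenbundle (φ y)).comap
      ((LinearMap.prodMap (P.push y) LinearMap.id :
        GaugeFiber n L' y × JetFiber m L (φ y) →ₗ[ℝ] OmniFiber m L (φ y)).baseChange ℂ)).map
      ((LinearMap.prodMap LinearMap.id (P.pullJetFiber y) :
        GaugeFiber n L' y × JetFiber m L (φ y) →ₗ[ℝ] OmniFiber n L' y).baseChange ℂ) := by
  refine eigenspace_eq_map_comap (K.sq _) (K'.sq _) _ _ (fun a => ?_) fun s t hst => ?_
  · obtain ⟨c, h1, h2⟩ := h y a
    have e1 : LinearMap.prodMap (P.push y) LinearMap.id (a.1, c.2) = c := Prod.ext h1.1 rfl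
    refine ⟨(a.1, c.2), ((K'.fib y a).1, (K.fib (φ y) c).2), Prod.ext rfl h1.2.symm,
      Prod.ext rfl h2.2.symm, ?_⟩
    rw [e1]
    exact Prod.ext h2.1 rfl
  · obtain ⟨c, h1, h2⟩ := h y (LinearMap.prodMap LinearMap.id (P.pullJetFiber y) s)
    have r : ∀ w : GaugeFiber n L' y × JetFiber m L (φ y),
        P.Rel y (LinearMap.prodMap LinearMap.id (P.pullJetFiber y) w)
          (LinearMap.prodMap (P.push y) LinearMap.id w) := fun w => ⟨rfl, rfl⟩
    have hv := r t
    rw [hst] at hv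
    exact (RegularMap.rel_unique hT hi h1 h2 (r s) hv).1.symm

end BackwardImage

section FrameExistence

variable {m : ℕ} {M : Type*} [TopologicalSpace M] [ChartedSpace (EuclideanSpace ℝ (Fin m)) M]
  {L : M → Type*} [TopologicalSpace (TotalSpace ℝ L)] [∀ x, AddCommGroup (L x)]
  [∀ x, Module ℝ (L x)] [∀ x, TopologicalSpace (L x)] [FiberBundle ℝ L] [VectorBundle ℝ ℝ L]

/-! ### Existence of frames -/

theorem mvfderiv_congr {f g : M → ℝ} {x : M} (h : f =ᶠ[𝓝 x] g) :
    mvfderiv (𝓡 m) f x = mvfderiv (𝓡 m) g x := by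
  rw [mvfderiv, mvfderiv, h.mfderiv_eq, h.eq_of_nhds]

theorem mvfderiv_coord {t : M → EuclideanSpace ℝ (Fin m)} {x : M}
    (ht : MDifferentiableAt (𝓡 m) 𝓘(ℝ, EuclideanSpace ℝ (Fin m)) t x) (j : Fin m)
    (v : TangentSpace (𝓡 m) x) :
    mvfderiv (𝓡 m) (fun y => t y j) x v =
      (EuclideanSpace.proj j : EuclideanSpace ℝ (Fin m) →L[ℝ] ℝ)
        (mfderiv (𝓡 m) 𝓘(ℝ, EuclideanSpace ℝ (Fin m)) t x v) := by
  have h := mvfderiv_comp_apply (g := (EuclideanSpace.proj j : EuclideanSpace ℝ (Fin m) →L[ℝ] ℝ))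
    (f := t) x (I' := 𝓘(ℝ, EuclideanSpace ℝ (Fin m)))
    (EuclideanSpace.proj j : EuclideanSpace ℝ (Fin m) →L[ℝ] ℝ).mdifferentiableAt ht v
  refine h.trans ?_
  rw [mvfderiv, mfderiv_eq_fderiv, ContinuousLinearMap.fderiv]
  rfl

section Derivative

variable [IsManifold (𝓡 m) ∞ M]

theorem vfDeriv_add (X : VField m M) (f g : C^∞⟮𝓡 m, M; ℝ⟯) :
    vfDeriv X (f + g) = vfDeriv X f + vfDeriv X g := by
  ext x
  have := mvfderiv_add (I := 𝓡 m) ((f.contMDiff x).mdifferentiableAt (by simp))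
    ((g.contMDiff x).mdifferentiableAt (by simp))
  exact congrArg (· (X x)) this

theorem vfDeriv_mul (X : VField m M) (f g : C^∞⟮𝓡 m, M; ℝ⟯) :
    vfDeriv X (f * g) = f * vfDeriv X g + g * vfDeriv X f := by
  ext x
  have := mvfderiv_mul (I := 𝓡 m) ((f.contMDiff x).mdifferentiableAt (by simp))
    ((g.contMDiff x).mdifferentiableAt (by simp))
  exact congrArg (· (X x)) this

theorem vfDeriv_smul (X : VField m M) (c : ℝ) (f : C^∞⟮𝓡 m, M; ℝ⟯) :
    vfDeriv X (c • f) = c • vfDeriv X f := by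
  let k : C^∞⟮𝓡 m, M; ℝ⟯ := ⟨fun _ => c, contMDiff_const⟩
  have h : c • f = k * f := rfl
  rw [h, vfDeriv_mul]
  ext x
  have : vfDeriv X k x = 0 := by
    change mvfderiv (𝓡 m) (fun _ => c) x (X x) = 0
    rw [mvfderiv_const]
    rfl
  change c * vfDeriv X f x + f x * vfDeriv X k x = c * vfDeriv X f x
  rw [this, mul_zero, add_zero]

end Derivative

/-- The coordinate of sections with respect to a section `e`, cut off by `g`. -/
def cutRatio (e : Sec m L) (g : C^∞⟮𝓡 m, M; ℝ⟯) (hg : ∀ x ∈ tsupport g, e x ≠ 0) :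
    Sec m L →ₗ[ℝ] C^∞⟮𝓡 m, M; ℝ⟯ where
  toFun l := ⟨fun x => g x * ratio (e x) (l x), contMDiff_of_tsupport fun x hx =>
    (g.contMDiff x).mul (contMDiffAt_ratio e l (hg x (tsupport_mul_subset_left hx))).1⟩
  map_add' a b := by
    ext x
    change g x * ratio (e x) (a x + b x) = g x * ratio (e x) (a x) + g x * ratio (e x) (b x)
    rw [map_add, mul_add]
  map_smul' c a := by
    ext x
    change g x * ratio (e x) (c • a x) = c * (g x * ratio (e x) (a x))
    rw [map_smul, smul_eq_mul, mul_left_comm]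

theorem cutRatio_apply (e : Sec m L) (g : C^∞⟮𝓡 m, M; ℝ⟯) (hg : ∀ x ∈ tsupport g, e x ≠ 0)
    (l : Sec m L) (x : M) : cutRatio e g hg l x = g x * ratio (e x) (l x) := rfl

theorem cutRatio_fsmul (e : Sec m L) (g : C^∞⟮𝓡 m, M; ℝ⟯) (hg : ∀ x ∈ tsupport g, e x ≠ 0)
    (f : C^∞⟮𝓡 m, M; ℝ⟯) (l : Sec m L) :
    cutRatio e g hg (fsmul f l) = f * cutRatio e g hg l := by
  ext x
  change g x * ratio (e x) (f x • l x) = f x * (g x * ratio (e x) (l x))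
  rw [map_smul, smul_eq_mul, mul_left_comm]

theorem fsmul_cutRatio (e : Sec m L) (g : C^∞⟮𝓡 m, M; ℝ⟯) (hg : ∀ x ∈ tsupport g, e x ≠ 0)
    (l : Sec m L) : fsmul (cutRatio e g hg l) e = fsmul g l := by
  ext x
  rw [fsmul_apply, fsmul_apply, cutRatio_apply, mul_smul]
  by_cases h : g x = 0
  · rw [h, zero_smul, zero_smul]
  · rw [ratio_smul_self (hg x (subset_tsupport _ h))]

variable [IsManifold (𝓡 m) ∞ M]

/-- The derivation differentiating the coordinate with respect to `e` along `X`. -/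
def cutGauge (e : Sec m L) (g : C^∞⟮𝓡 m, M; ℝ⟯) (hg : ∀ x ∈ tsupport g, e x ≠ 0)
    (X : VField m M) : Gauge m L :=
  ⟨{ toFun := fun l => fsmul (vfDeriv X (cutRatio e g hg l)) e
     map_add' := fun a b => by
      ext x
      rw [map_add, vfDeriv_add]
      exact add_smul _ _ _
     map_smul' := fun c a => by
      ext x
      rw [map_smul, vfDeriv_smul]
      exact smul_assoc c _ _ },
    ⟨fun x => g x • X x, g.contMDiff.smul_section X.contMDiff⟩, fun x f l => by
      have h := congrArg (fun s : Sec m L => s x) (fsmul_cutRatio e g hg l)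
      change vfDeriv X (cutRatio e g hg (fsmul f l)) x • e x =
        mvfderiv (𝓡 m) f x (g x • X x) • l x + f x • vfDeriv X (cutRatio e g hg l) x • e x
      rw [cutRatio_fsmul, vfDeriv_mul]
      change (f x * vfDeriv X (cutRatio e g hg l) x +
        cutRatio e g hg l x * mvfderiv (𝓡 m) f x (X x)) • e x = _
      rw [map_smul, smul_eq_mul, add_smul, mul_smul, mul_comm (cutRatio e g hg l x), mul_smul]
      rw [mul_comm (g x), mul_smul, add_comm]
      exact congrArg (mvfderiv (𝓡 m) f x (X x) • · + _) h⟩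

theorem cutGauge_apply (e : Sec m L) (g : C^∞⟮𝓡 m, M; ℝ⟯) (hg : ∀ x ∈ tsupport g, e x ≠ 0)
    (X : VField m M) (l : Sec m L) (x : M) :
    (cutGauge e g hg X).1 l x = mvfderiv (𝓡 m) (cutRatio e g hg l) x (X x) • e x := rfl

/-- A section and local coordinates, with a cut-off function, yield a frame. -/
theorem exists_lineFrame (e : Sec m L) (g : C^∞⟮𝓡 m, M; ℝ⟯) (hg : ∀ x ∈ tsupport g, e x ≠ 0)
    {W : Set M} (hW : IsOpen W) (hgW : tsupport g ⊆ W) {t : M → EuclideanSpace ℝ (Fin m)}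
    (ht : ContMDiffOn (𝓡 m) 𝓘(ℝ, EuclideanSpace ℝ (Fin m)) ∞ t W)
    (hinv : ∀ x ∈ W, (mfderiv (𝓡 m) 𝓘(ℝ, EuclideanSpace ℝ (Fin m)) t x).IsInvertible)
    {V : Set M} (hV : ∀ x ∈ V, g =ᶠ[𝓝 x] fun _ => 1) :
    ∃ F : LineFrame m L V, F.e = e := by
  have htW : ∀ x ∈ W, ContMDiffAt (𝓡 m) 𝓘(ℝ, EuclideanSpace ℝ (Fin m)) ∞ t x := fun x hx =>
    ht.contMDiffAt (hW.mem_nhds hx)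
  have hVg : ∀ x ∈ V, x ∈ tsupport g := fun x hx => subset_tsupport _ (by
    rw [Function.mem_support, (hV x hx).eq_of_nhds]
    exact one_ne_zero)
  let u : Fin m → C^∞⟮𝓡 m, M; ℝ⟯ := fun j => ⟨fun x => g x * t x j, contMDiff_of_tsupport
    fun x hx => (g.contMDiff x).mul
      (((EuclideanSpace.proj j : EuclideanSpace ℝ (Fin m) →L[ℝ] ℝ).contMDiff.contMDiffAt).comp x
        (htW x (hgW (tsupport_mul_subset_left hx))))⟩
  let Y : Fin m → Π x : M, TangentSpace (𝓡 m) x := fun j =>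
    mpullback (𝓡 m) 𝓘(ℝ, EuclideanSpace ℝ (Fin m)) t fun _ => EuclideanSpace.single j (1 : ℝ)
  have hY : ∀ j, ContMDiffOn (𝓡 m) (𝓡 m).tangent ∞
      (fun x => (Y j x : TangentBundle (𝓡 m) M)) W := fun j x hx => by
    refine (ContMDiffAt.mpullback_vectorField_preimage (n := ∞) ?_ (htW x hx) (hinv x hx)
      (by simp)).contMDiffWithinAt
    exact contMDiffAt_vectorSpace_iff_contDiffAt.2 contDiffAt_const
  let X : Fin m → VField m M := fun j => ⟨fun x => g x • Y j x,
    ContMDiffOn.smul_section_of_tsupport g.contMDiff.contMDiffOn hW hgW (hY j)⟩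
  have hu : ∀ j, ∀ x ∈ V, ∀ v : TangentSpace (𝓡 m) x, mvfderiv (𝓡 m) (u j) x v =
      (EuclideanSpace.proj j : EuclideanSpace ℝ (Fin m) →L[ℝ] ℝ)
        (mfderiv (𝓡 m) 𝓘(ℝ, EuclideanSpace ℝ (Fin m)) t x v) := by
    intro j x hx v
    rw [← mvfderiv_coord ((htW x (hgW (hVg x hx))).mdifferentiableAt (by simp)),
      mvfderiv_congr (g := fun y => t y j)]
    filter_upwards [hV x hx] with y hy
    change g y * t y j = t y j
    rw [hy, one_mul]
  have hinj : ∀ x ∈ V, ∀ v : TangentSpace (𝓡 m) x, (∀ j, mvfderiv (𝓡 m) (u j) x v = 0) →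
      v = 0 := fun x hx v h => by
    have hz : (mfderiv (𝓡 m) 𝓘(ℝ, EuclideanSpace ℝ (Fin m)) t x v) =
        (0 : EuclideanSpace ℝ (Fin m)) :=
      PiLp.ext fun j => (hu j x hx v).symm.trans (h j)
    exact (hinv x (hgW (hVg x hx))).injective (hz.trans (map_zero _).symm)
  refine ⟨{
    e := e
    u := u
    D := fun j => cutGauge e g hg (X j)
    q := fun l => cutRatio e g hg l
    e_ne := fun x hx => hg x (hVg x hx)
    q_smul := fun l x hx => by
      rw [← fsmul_apply, fsmul_cutRatio, fsmul_apply, (hV x hx).eq_of_nhds, one_smul]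
    D_e := fun j x hx => by
      rw [cutGauge_apply, mvfderiv_congr (g := fun _ => 1), mvfderiv_const]
      · exact zero_smul _ _
      · filter_upwards [hV x hx, (contMDiffAt_ratio e e (hg x (hVg x hx))).2] with y hy hye
        rw [cutRatio_apply, hy, ratio_self hye, mul_one]
    D_u := fun j k x hx => by
      have h1 : mvfderiv (𝓡 m) (cutRatio e g hg (fsmul (u k) e)) x = mvfderiv (𝓡 m) (u k) x :=
        mvfderiv_congr (by
          filter_upwards [hV x hx, (contMDiffAt_ratio e e (hg x (hVg x hx))).2] with y hy hye
          rw [cutRatio_apply, hy, fsmul_apply, ratio_smul hye, one_mul])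
      have h2 : (X j) x = Y j x := by
        change g x • Y j x = Y j x
        rw [(hV x hx).eq_of_nhds, one_smul]
      rw [cutGauge_apply, h1, hu k x hx, h2]
      have h3 : mfderiv (𝓡 m) 𝓘(ℝ, EuclideanSpace ℝ (Fin m)) t x (Y j x) =
          EuclideanSpace.single j (1 : ℝ) :=
        (hinv x (hgW (hVg x hx))).self_apply_inverse _
      rw [h3]
      by_cases hkj : k = j <;> simp [hkj]
    ext := fun x hx Δ h0 hu0 => by
      obtain ⟨v, hv⟩ := Δ.2
      have hv0 : v = 0 := hinj x hx v fun j => by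
        have h := hv (u j) e
        rw [hu0 j, h0, smul_zero, add_zero, eq_comm, smul_eq_zero] at h
        exact h.resolve_right (hg x (hVg x hx))
      subst hv0
      ext1
      refine LinearMap.ext fun l => ?_
      -- The Leibniz rule for the two sides of `(g l / e) · e = g l` gives `Δ l = 0` for an
      -- arbitrary global `l`, with no appeal to the locality of `Δ`.
      have h1 := hv (cutRatio e g hg l) e
      rw [fsmul_cutRatio, hv g l, h0, (hV x hx).eq_of_nhds] at h1
      simpa using h1
    symbol_inj := hinj }, rfl⟩

/-- Every point has a neighbourhood with a frame. -/
theorem exists_lineFrame_nhds [T2Space M] [ContMDiffVectorBundle ∞ ℝ L (𝓡 m)] (x : M) :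
    ∃ V : Set M, IsOpen V ∧ x ∈ V ∧ Nonempty (LineFrame m L V) := by
  let e₀ : L x := ((trivializationAt ℝ L x).continuousLinearEquivAt ℝ x
    (FiberBundle.mem_baseSet_trivializationAt' x)).symm 1
  have he₀ : e₀ ≠ 0 := fun h => one_ne_zero ((LinearEquiv.map_eq_zero_iff
    ((trivializationAt ℝ L x).continuousLinearEquivAt ℝ x
      (FiberBundle.mem_baseSet_trivializationAt' x)).symm.toLinearEquiv).1 h)
  obtain ⟨s, hs, hse⟩ := FiberBundle.exists_contMDiffOn_extend (I := 𝓡 m) (k := ∞) (F := ℝ) e₀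
  obtain ⟨b, -, hb⟩ := (SmoothBumpFunction.nhds_basis_tsupport (I := 𝓡 m) x).mem_iff.1
    (interior_mem_nhds.2 hs)
  let e : Sec m L := ⟨fun y => b y • FiberBundle.extend ℝ e₀ y,
    ContMDiffOn.smul_section_of_tsupport b.contMDiff.contMDiffOn isOpen_interior hb
      (hse.mono interior_subset)⟩
  have hex : e x ≠ 0 := by
    change b x • FiberBundle.extend ℝ e₀ x ≠ 0
    rw [b.eq_one, one_smul, FiberBundle.extend_apply_self]
    exact he₀
  -- Two cut-offs are needed: `b` makes the local section global, and `g` is supported where that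
  -- section does not vanish, so that quotients by it are smooth.
  obtain ⟨g, -, hg⟩ := (SmoothBumpFunction.nhds_basis_tsupport (I := 𝓡 m) x).mem_iff.1
    (contMDiffAt_ratio e e hex).2
  refine ⟨interior {y | g y = 1}, isOpen_interior,
    mem_interior_iff_mem_nhds.2 g.eventuallyEq_one, ?_⟩
  obtain ⟨F, -⟩ := exists_lineFrame e ⟨g, g.contMDiff⟩ (fun y hy => hg hy)
    (chartAt (EuclideanSpace ℝ (Fin m)) x).open_source g.tsupport_subset_chartAt_source
    (t := extChartAt (𝓡 m) x) (contMDiffOn_extChartAt)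
    (fun y hy => isInvertible_mfderiv_extChartAt (by rwa [extChartAt_source]))
    (V := interior {y | g y = 1}) fun y hy => mem_interior_iff_mem_nhds.1 hy
  exact ⟨F⟩

/-- A nonvanishing section over a manifold with a global chart yields a global frame. -/
theorem exists_lineFrame_univ (e : Sec m L) (he : ∀ x, e x ≠ 0) (x : M)
    (hx : (chartAt (EuclideanSpace ℝ (Fin m)) x).source = Set.univ) :
    ∃ F : LineFrame m L Set.univ, F.e = e :=
  exists_lineFrame e ⟨fun _ => 1, contMDiff_const⟩ (fun x _ => he x)
    (chartAt (EuclideanSpace ℝ (Fin m)) x).open_source (hx ▸ Set.subset_univ _)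
    (t := extChartAt (𝓡 m) x) contMDiffOn_extChartAt
    (fun y hy => isInvertible_mfderiv_extChartAt (by rwa [extChartAt_source]))
    fun _ _ => Filter.EventuallyEq.rfl

/-- The inclusion of an open subset has bijective differentials. -/
theorem mfderiv_subtypeVal_bijective (U : TopologicalSpace.Opens M) (y : U) :
    Function.Bijective (mfderiv (𝓡 m) (𝓡 m) (Subtype.val : U → M) y) := by
  have h1 := isInvertible_mfderiv_extChartAt (I := 𝓡 m) (mem_extChartAt_source (I := 𝓡 m) y)
  have h2 := isInvertible_mfderiv_extChartAt (I := 𝓡 m) (mem_extChartAt_source (I := 𝓡 m) y.1)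
  have hc : (extChartAt (𝓡 m) y : U → EuclideanSpace ℝ (Fin m)) =
      extChartAt (𝓡 m) y.1 ∘ Subtype.val := rfl
  have hcomp := mfderiv_comp (I := 𝓡 m) (I' := 𝓡 m)
    (I'' := 𝓘(ℝ, EuclideanSpace ℝ (Fin m))) (g := extChartAt (𝓡 m) y.1) y
    ((contMDiffAt_extChartAt (n := ∞)).mdifferentiableAt (by simp))
    ((contMDiff_subtype_val (n := ∞) y).mdifferentiableAt (by simp))
  rw [← hc] at hcomp
  have hb1 : Function.Bijective (mfderiv (𝓡 m) 𝓘(ℝ, EuclideanSpace ℝ (Fin m))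
      (extChartAt (𝓡 m) y) y) := h1.bijective
  have hb2 : Function.Bijective (mfderiv (𝓡 m) 𝓘(ℝ, EuclideanSpace ℝ (Fin m))
      (extChartAt (𝓡 m) y.1) y.1) := h2.bijective
  rw [hcomp] at hb1
  exact (Function.Bijective.of_comp_iff' hb2 _).1 hb1

end FrameExistence

section SkewMaps

variable {D ℓ : Type*} [AddCommGroup D] [Module ℝ D] [AddCommGroup ℓ] [Module ℝ ℓ]

/-! ### Parity of the rank of a skew map -/

/-- The image of a skew map `Hom(D, ℓ) → D` has no basis of odd cardinality. -/
theorem not_odd_card_of_skew {e : ℓ} (he : e ≠ 0) (r : ℓ →ₗ[ℝ] ℝ) (hr : ∀ l, r l • e = l)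
    (J : (D →ₗ[ℝ] ℓ) →ₗ[ℝ] D) (hskew : ∀ a b : D →ₗ[ℝ] ℓ, a (J b) = -b (J a))
    {I : Type*} [Fintype I] [DecidableEq I] (ψ : I → D →ₗ[ℝ] ℓ)
    (hli : LinearIndependent ℝ fun i => J (ψ i))
    (hspan : ∀ a, J a ∈ Submodule.span ℝ (Set.range fun i => J (ψ i))) :
    ¬ Odd (Fintype.card I) := by
  intro hodd
  let A : Matrix I I ℝ := Matrix.of fun i j => r (ψ i (J (ψ j)))
  have hA : A.transpose = -A := by
    ext i j
    change r (ψ j (J (ψ i))) = -r (ψ i (J (ψ j)))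
    rw [hskew (ψ j), map_neg]
  have hdet : A.det = 0 := by
    have h := congrArg Matrix.det hA
    rw [Matrix.det_transpose, Matrix.det_neg, hodd.neg_one_pow] at h
    linarith
  -- A skew matrix of odd size is singular. Its kernel vector gives `v = ∑ c j • ψ j` with `ψ i (J
  -- v) = 0` for all `i`.
  obtain ⟨c, hc, hAc⟩ := Matrix.exists_mulVec_eq_zero_iff.2 hdet
  have h0 : ∀ i, ψ i (J (∑ j, c j • ψ j)) = 0 := fun i => by
    have h : ∑ j, r (ψ i (J (ψ j))) * c j = 0 := congrFun hAc i
    rw [← hr (ψ i _), map_sum, map_sum, map_sum]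
    simp only [map_smul, smul_eq_mul, mul_comm (c _)]
    rw [h, zero_smul]
  have hJ : J (∑ j, c j • ψ j) = 0 := by
    refine (Module.forall_dual_apply_eq_zero_iff ℝ _).1 fun f => ?_
    -- By skewness `(f · e)(J v) = -v(J(f · e))`. Here `J(f · e)` is a combination of the `J(ψ i)`,
    -- each of which `v` kills by skewness again.
    have h : (LinearMap.toSpanSingleton ℝ ℓ e ∘ₗ f) (J (∑ j, c j • ψ j)) = 0 := by
      obtain ⟨d, hd⟩ := (Submodule.mem_span_range_iff_exists_fun ℝ).1
        (hspan (LinearMap.toSpanSingleton ℝ ℓ e ∘ₗ f))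
      rw [hskew, ← hd, map_sum, neg_eq_zero]
      refine Finset.sum_eq_zero fun i _ => ?_
      rw [map_smul, hskew, h0, neg_zero, smul_zero]
    exact (smul_eq_zero.1 h).resolve_right he
  rw [map_sum] at hJ
  simp only [map_smul] at hJ
  exact hc (funext (Fintype.linearIndependent_iff.1 hli c hJ))

end SkewMaps

section Transversality

variable {m : ℕ} {M : Type*} [TopologicalSpace M] [ChartedSpace (EuclideanSpace ℝ (Fin m)) M]
  {L : M → Type*} [TopologicalSpace (TotalSpace ℝ L)] [∀ x, AddCommGroup (L x)]
  [∀ x, Module ℝ (L x)] [∀ x, TopologicalSpace (L x)] [FiberBundle ℝ L] [VectorBundle ℝ ℝ L]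
  [IsManifold (𝓡 m) ∞ M]

/-! ### Transversals to even dimensional leaves -/

namespace LineFrame

variable {V : Set M} (F : LineFrame m L V)

/-- The symbol of the points of the gauge algebroid. -/
def symbol {x : M} (hx : x ∈ V) : GaugeFiber m L x →ₗ[ℝ] TangentSpace (𝓡 m) x where
  toFun Δ := Δ.2.choose
  map_add' Δ E := F.isSymbol_unique hx (Δ + E).2.choose_spec
    (Δ.2.choose_spec.add E.2.choose_spec)
  map_smul' c Δ := F.isSymbol_unique hx (c • Δ).2.choose_spec (Δ.2.choose_spec.smul c)

theorem symbol_eq_iff {x : M} (hx : x ∈ V) {Δ : GaugeFiber m L x} {v : TangentSpace (𝓡 m) x} :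
    F.symbol hx Δ = v ↔ IsSymbol Δ.1 v :=
  ⟨fun h => h ▸ Δ.2.choose_spec, fun h => F.isSymbol_unique hx Δ.2.choose_spec h⟩

theorem symbol_one {x : M} (hx : x ∈ V) : F.symbol hx (gaugeEval m L x gaugeOne) = 0 :=
  (F.symbol_eq_iff hx).2 fun f l => by simp

/-- With zero symbol a derivation is linear over functions, and on a line such a map is a scalar. -/
theorem exists_eq_smul_one (F : LineFrame m L V) {x : M} (hx : x ∈ V)
    {Δ : GaugeFiber m L x} (h : F.symbol hx Δ = 0) :
    ∃ c : ℝ, Δ = c • gaugeEval m L x gaugeOne := by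
  refine ⟨ratio (F.e x) (Δ.1 F.e), sub_eq_zero.1 (F.ext x hx _ ?_ fun j => ?_)⟩
  · change Δ.1 F.e - ratio (F.e x) (Δ.1 F.e) • F.e x = 0
    rw [ratio_smul_self (F.e_ne x hx), sub_self]
  · have h1 := (F.symbol_eq_iff hx).1 h (F.u j) F.e
    change Δ.1 (fsmul (F.u j) F.e) - ratio (F.e x) (Δ.1 F.e) • F.u j x • F.e x = 0
    rw [h1, smul_comm, ratio_smul_self (F.e_ne x hx)]
    simp

theorem smul_one_eq_zero (F : LineFrame m L V) {x : M} (hx : x ∈ V) {c : ℝ}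
    (h : c • gaugeEval m L x gaugeOne = 0) : c = 0 := by
  have h1 : c • F.e x = 0 := congrArg (fun Δ : GaugeFiber m L x => Δ.1 F.e) h
  exact (smul_eq_zero.1 h1).resolve_right (F.e_ne x hx)

end LineFrame

namespace GenContactStructure

variable (K : GenContactStructure m L)

theorem sharp_skew (x : M) (ψ χ : JetFiber m L x) : ψ (K.sharp x χ) = -χ (K.sharp x ψ) := by
  have h := K.skew x (0, ψ) (0, χ)
  change (χ (K.sharp x ψ) + (K.fib x (0, ψ)).2 0) + ((K.fib x (0, χ)).2 0 + ψ (K.sharp x χ)) = 0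
    at h
  rw [map_zero, map_zero, add_zero, zero_add] at h
  exact eq_neg_of_add_eq_zero_right h

/-- At points of even dimensional leaves the identity is not in the image of `J♯`. -/
theorem sharp_ne_one {V : Set M} (F : LineFrame m L V) {x : M} (hx : x ∈ V) {k : ℕ}
    (heven : Even k) {b : Fin k → TangentSpace (𝓡 m) x} (hb : LinearIndependent ℝ b)
    (hspan : ∀ v, v ∈ K.charDistribution x ↔ v ∈ Submodule.span ℝ (Set.range b))
    (ψ : JetFiber m L x) : K.sharp x ψ ≠ gaugeEval m L x gaugeOne := by
  intro hψ
  have hex : ∀ j, ∃ χ, F.symbol hx (K.sharp x χ) = b j := fun j => by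
    obtain ⟨χ, hχ⟩ := (hspan (b j)).2 (Submodule.subset_span ⟨j, rfl⟩)
    exact ⟨χ, (F.symbol_eq_iff hx).2 hχ⟩
  choose χ hχ using hex
  -- If the identity is `J♯ψ`, then it and lifts of a basis of the characteristic space form a basis
  -- of `im J♯` with `k + 1` elements.
  let ρ : Option (Fin k) → JetFiber m L x := fun a => a.elim ψ χ
  refine not_odd_card_of_skew (F.e_ne x hx) (ratio (F.e x)) (ratio_smul_self (F.e_ne x hx))
    (K.sharp x) (K.sharp_skew x) ρ ?_ ?_ (by simpa using heven.add_one)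
  · refine Fintype.linearIndependent_iff.2 fun c hc => ?_
    rw [Fintype.sum_option] at hc
    have h1 := congrArg (F.symbol hx) hc
    change F.symbol hx (c none • K.sharp x ψ + ∑ j, c (some j) • K.sharp x (χ j)) = _ at h1
    rw [hψ, map_add, map_smul, F.symbol_one, smul_zero, zero_add, map_sum, map_zero] at h1
    simp only [map_smul, hχ] at h1
    have h2 := Fintype.linearIndependent_iff.1 hb (fun j => c (some j)) h1
    simp only [h2, zero_smul, Finset.sum_const_zero, add_zero] at hc
    rintro (_ | j)
    · exact F.smul_one_eq_zero hx (hψ ▸ hc)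
    · exact h2 j
  · intro a
    have h1 : F.symbol hx (K.sharp x a) ∈ Submodule.span ℝ (Set.range b) :=
      (hspan _).1 ⟨a, (F.symbol_eq_iff hx).1 rfl⟩
    obtain ⟨w, hw⟩ := (Submodule.mem_span_range_iff_exists_fun ℝ).1 h1
    have h2 : F.symbol hx (K.sharp x a - ∑ j, w j • K.sharp x (χ j)) = 0 := by
      rw [map_sub, map_sum, ← hw]
      simp only [map_smul, hχ, sub_self]
    obtain ⟨c, hc⟩ := F.exists_eq_smul_one hx h2
    rw [sub_eq_iff_eq_add.1 hc, ← hψ]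
    exact add_mem (Submodule.smul_mem _ _ (Submodule.subset_span ⟨none, rfl⟩))
      (sum_mem fun j _ => Submodule.smul_mem _ _ (Submodule.subset_span ⟨some j, rfl⟩))

/-- The nondegeneracy along a subspace of a tangent space which is needed for restricting a
generalized contact structure to a submanifold. -/
def IsCosymplecticOn {x : M} (W : Set (TangentSpace (𝓡 m) x)) : Prop :=
  ∀ ψ : JetFiber m L x,
    (∀ Δ : GaugeFiber m L x, (∃ v ∈ W, IsSymbol Δ.1 v) → ψ Δ = 0) →
    (∃ v ∈ W, IsSymbol (K.sharp x ψ).1 v) → ψ = 0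

/-- The symbol of `J♯ψ` is both in `W` and characteristic, hence zero, and `sharp_ne_one` upgrades
this to `J♯ψ = 0`. Any `Δ` differs by some `J♯χ` from a derivation with symbol in `W`; `ψ` kills the
latter by assumption and `J♯χ` by skewness. -/
theorem isCosymplecticOn_of_isCompl {V : Set M} (F : LineFrame m L V) {x : M} (hx : x ∈ V) {k : ℕ}
    (heven : Even k) {b : Fin k → TangentSpace (𝓡 m) x} (hb : LinearIndependent ℝ b)
    (hspan : ∀ v, v ∈ K.charDistribution x ↔ v ∈ Submodule.span ℝ (Set.range b))
    {W : Submodule ℝ (TangentSpace (𝓡 m) x)} (hW : IsCompl W (Submodule.span ℝ (Set.range b))) :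
    K.IsCosymplecticOn (x := x) W := by
  rintro ψ hψ ⟨v, hvW, hv⟩
  have hv0 : v = 0 := (Submodule.disjoint_def.1 hW.disjoint) v hvW ((hspan v).1 ⟨ψ, hv⟩)
  subst hv0
  obtain ⟨c, hc⟩ := F.exists_eq_smul_one hx ((F.symbol_eq_iff hx).2 hv)
  have hc0 : c = 0 := by
    by_contra hne
    refine K.sharp_ne_one F hx heven hb hspan (c⁻¹ • ψ) ?_
    rw [map_smul, hc, smul_smul, inv_mul_cancel₀ hne, one_smul]
  rw [hc0, zero_smul] at hc
  refine LinearMap.ext fun Δ => ?_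
  obtain ⟨w, hw, w', hw', hww⟩ := Submodule.mem_sup.1
    (hW.codisjoint.eq_top ▸ Submodule.mem_top : F.symbol hx Δ ∈ W ⊔ _)
  obtain ⟨χ, hχ⟩ := (hspan w').2 hw'
  have h1 : ψ (Δ - K.sharp x χ) = 0 := by
    refine hψ _ ⟨w, hw, (F.symbol_eq_iff hx).1 ?_⟩
    rw [map_sub, (F.symbol_eq_iff hx).2 hχ, ← hww, add_sub_cancel_right]
  rw [map_sub, K.sharp_skew, hc, map_zero, neg_zero, sub_zero] at h1
  exact h1

end GenContactStructure

end Transversality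

/-! ### The cosymplectic condition for pull-back bundles, in terms of tangent spaces -/

section PullbackBundle

variable {m n : ℕ} {M N : Type*} [TopologicalSpace M]
  [ChartedSpace (EuclideanSpace ℝ (Fin m)) M] [TopologicalSpace N]
  [ChartedSpace (EuclideanSpace ℝ (Fin n)) N]
  {L : M → Type*} [TopologicalSpace (TotalSpace ℝ L)] [∀ x, AddCommGroup (L x)]
  [∀ x, Module ℝ (L x)] [∀ x, TopologicalSpace (L x)] [FiberBundle ℝ L] [VectorBundle ℝ ℝ L]
  {L' : N → Type*} [TopologicalSpace (TotalSpace ℝ L')] [∀ x, AddCommGroup (L' x)]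
  [∀ x, Module ℝ (L' x)] [∀ x, TopologicalSpace (L' x)] [FiberBundle ℝ L'] [VectorBundle ℝ ℝ L']
  {φ : C^∞⟮𝓡 n, N; 𝓡 m, M⟯}

namespace RegularMap

variable (L φ) in
/-- The canonical map from a pull-back bundle. -/
def ofPullback : RegularMap L (φ *ᵖ L) φ where
  fib y := LinearEquiv.refl ℝ (L (φ y))
  sec := pullSec L φ
  sec_apply _ _ := rfl

theorem backwardImage_eq (D : ∀ x : M, Submodule ℂ (OmniFiberC m L x)) (y : N) :
    backwardImage L φ D y = ((D (φ y)).comap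
      ((LinearMap.prodMap ((ofPullback L φ).push y) LinearMap.id :
        GaugeFiber n (φ *ᵖ L) y × JetFiber m L (φ y) →ₗ[ℝ] OmniFiber m L (φ y)).baseChange ℂ)).map
      ((LinearMap.prodMap LinearMap.id ((ofPullback L φ).pullJetFiber y) :
        GaugeFiber n (φ *ᵖ L) y × JetFiber m L (φ y) →ₗ[ℝ]
          OmniFiber n (φ *ᵖ L) y).baseChange ℂ) :=
  rfl

variable [IsManifold (𝓡 m) ∞ M] [IsManifold (𝓡 n) ∞ N]

/-- A derivation on `N` with the right symbol pushes forward to `Δ` up to a multiple of the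
identity, and the identity is itself a push-forward. -/
theorem mem_range_push_iff (P : RegularMap L L' φ) {V : Set M} (F : LineFrame m L V)
    (G : LineFrame n L' Set.univ) {y : N} (hy : φ y ∈ V) {Δ : GaugeFiber m L (φ y)} :
    Δ ∈ LinearMap.range (P.push y) ↔
      ∃ v ∈ Set.range (mfderiv (𝓡 n) (𝓡 m) φ y), IsSymbol Δ.1 v := by
  constructor
  · rintro ⟨E, rfl⟩
    obtain ⟨w, hw⟩ := E.2
    exact ⟨_, ⟨w, rfl⟩, P.isSymbol_push hw⟩
  · rintro ⟨_, ⟨w, rfl⟩, hΔ⟩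
    obtain ⟨E, hE, -⟩ := G.exists_isSymbol (Set.mem_univ y) w
    have h1 : F.symbol hy (Δ - P.push y E) = 0 := by
      rw [map_sub, (F.symbol_eq_iff hy).2 hΔ, (F.symbol_eq_iff hy).2 (P.isSymbol_push hE), sub_self]
    obtain ⟨c, hc⟩ := F.exists_eq_smul_one hy h1
    have h2 : P.push y (gaugeEval n L' y gaugeOne) = gaugeEval m L (φ y) gaugeOne := by
      ext1
      refine LinearMap.ext fun l => ?_
      rw [P.push_apply]
      change (P.fib y).symm (P.sec l y) = l (φ y)
      rw [P.sec_apply, LinearEquiv.symm_apply_apply]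
    refine ⟨c • gaugeEval n L' y gaugeOne + E, ?_⟩
    rw [map_add, map_smul, h2, ← hc, sub_add_cancel]

theorem isCosymplecticAt_iff (P : RegularMap L L' φ) (K : GenContactStructure m L) {V : Set M}
    (F : LineFrame m L V) (G : LineFrame n L' Set.univ) {y : N} (hy : φ y ∈ V) :
    P.IsCosymplecticAt K y ↔
      K.IsCosymplecticOn (x := φ y) (Set.range (mfderiv (𝓡 n) (𝓡 m) φ y)) := by
  refine forall_congr' fun ψ => ?_
  have h1 : P.pullJetFiber y ψ = 0 ↔ ∀ Δ : GaugeFiber m L (φ y),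
      (∃ v ∈ Set.range (mfderiv (𝓡 n) (𝓡 m) φ y), IsSymbol Δ.1 v) → ψ Δ = 0 := by
    simp only [← P.mem_range_push_iff F G hy]
    constructor
    · rintro h _ ⟨E, rfl⟩
      have h2 : P.fib y (ψ (P.push y E)) = 0 := congrArg (fun f : JetFiber n L' y => f E) h
      exact (LinearEquiv.map_eq_zero_iff _).1 h2
    · intro h
      refine LinearMap.ext fun E => ?_
      change P.fib y (ψ (P.push y E)) = 0
      rw [h _ ⟨E, rfl⟩, map_zero]
  rw [h1, P.mem_range_push_iff F G hy]

theorem eigenbundle_eq_backwardImage (K : GenContactStructure m L)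
    (K' : GenContactStructure n (φ *ᵖ L))
    (h : ∀ y a, ∃ c, (ofPullback L φ).Rel y a c ∧
      (ofPullback L φ).Rel y (K'.fib y a) (K.fib (φ y) c))
    (hT : ∀ y, (ofPullback L φ).IsCosymplecticAt K y)
    (hi : ∀ y, Function.Injective ((ofPullback L φ).push y)) :
    K'.eigenbundle = backwardImage L φ K.eigenbundle :=
  funext fun y => ((ofPullback L φ).eigenbundle_eq K K' h y (hT y) (hi y)).trans
    (backwardImage_eq K.eigenbundle y).symm

end RegularMap

end PullbackBundle

section RestrictOpen

variable {m n : ℕ} {M : Type*} [TopologicalSpace M] [ChartedSpace (EuclideanSpace ℝ (Fin m)) M]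
  {N : Type*} [TopologicalSpace N] [ChartedSpace (EuclideanSpace ℝ (Fin n)) N]

/-! ### Restriction to small transversals -/

theorem mfderiv_restrictOpen (i : C^∞⟮𝓡 n, N; 𝓡 m, M⟯) (U : TopologicalSpace.Opens N) (y : U) :
    mfderiv (𝓡 n) (𝓡 m) (restrictOpen i U) y =
      (mfderiv (𝓡 n) (𝓡 m) i y.1).comp (mfderiv (𝓡 n) (𝓡 n) (Subtype.val : U → N) y) :=
  mfderiv_comp (I := 𝓡 n) (I' := 𝓡 n) (I'' := 𝓡 m) (g := i) y
    ((i.contMDiff _).mdifferentiableAt (by simp))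
    ((contMDiff_subtype_val (n := ∞) y).mdifferentiableAt (by simp))

variable [IsManifold (𝓡 n) ∞ N]

theorem mfderiv_restrictOpen_injective (i : C^∞⟮𝓡 n, N; 𝓡 m, M⟯)
    (hi : IsImmersedSubmanifold (m := m) (n := n) i) (U : TopologicalSpace.Opens N) (y : U) :
    Function.Injective (mfderiv (𝓡 n) (𝓡 m) (restrictOpen i U) y) := by
  rw [mfderiv_restrictOpen]
  exact (hi.injective_mfderiv y.1).comp (mfderiv_subtypeVal_bijective U y).1

theorem range_mfderiv_restrictOpen (i : C^∞⟮𝓡 n, N; 𝓡 m, M⟯) (U : TopologicalSpace.Opens N)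
    (y : U) : Set.range (mfderiv (𝓡 n) (𝓡 m) (restrictOpen i U) y) =
      Set.range (mfderiv (𝓡 n) (𝓡 m) i y.1) := by
  rw [mfderiv_restrictOpen]
  exact (mfderiv_subtypeVal_bijective U y).2.range_comp (mfderiv (𝓡 n) (𝓡 m) i y.1)

end RestrictOpen

/-! ### Cosymplecticity at the base point and on a neighbourhood -/

section Restriction

universe u

variable {m n k : ℕ} {M : Type u} [TopologicalSpace M]
  [ChartedSpace (EuclideanSpace ℝ (Fin m)) M] [IsManifold (𝓡 m) ∞ M]
  {L : M → Type*} [TopologicalSpace (TotalSpace ℝ L)] [∀ x, AddCommGroup (L x)]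
  [∀ x, Module ℝ (L x)] [∀ x, TopologicalSpace (L x)] [FiberBundle ℝ L] [VectorBundle ℝ ℝ L]
  {N : Type*} [TopologicalSpace N] [ChartedSpace (EuclideanSpace ℝ (Fin n)) N]

theorem isCosymplecticOn_of_isTransversalAt (K : GenContactStructure m L)
    {O : Type*} [TopologicalSpace O] [ChartedSpace (EuclideanSpace ℝ (Fin k)) O] {ι : O → M}
    (hι : K.IsIntegralManifold (k := k) ι) (heven : Even k) {i : N → M} {y : N} {o : O} {x : M}
    (htrans : IsTransversalAt (m := m) (n := n) (k := k) i ι y o x)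
    {V : Set M} (F : LineFrame m L V) (hy : i y ∈ V) :
    K.IsCosymplecticOn (x := i y) (Set.range (mfderiv (𝓡 n) (𝓡 m) i y)) := by
  obtain ⟨rfl, ho, hcompl⟩ := htrans
  let T : EuclideanSpace ℝ (Fin k) →ₗ[ℝ] EuclideanSpace ℝ (Fin m) :=
    (mfderiv (𝓡 k) (𝓡 m) ι o :
      EuclideanSpace ℝ (Fin k) →L[ℝ] EuclideanSpace ℝ (Fin m)).toLinearMap
  -- The points `ι o` and `i y` are equal only propositionally, so the statement is generalized over
  -- the base point before the equality is eliminated.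
  have hchar : ∀ x, ι o = x → ∀ v : EuclideanSpace ℝ (Fin m),
      v ∈ (K.charDistribution x : Set (EuclideanSpace ℝ (Fin m))) ↔ v ∈ LinearMap.range T := by
    rintro _ rfl v
    exact (Set.ext_iff.1 (hι.range_mfderiv o) v).symm
  let B := (EuclideanSpace.basisFun (Fin k) ℝ).toBasis
  let b : Fin k → EuclideanSpace ℝ (Fin m) := T ∘ B
  have hb : LinearIndependent ℝ b :=
    B.linearIndependent.map' T (LinearMap.ker_eq_bot.2 (hι.immersed.injective_mfderiv o))
  have hspan : Submodule.span ℝ (Set.range b) = LinearMap.range T := by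
    rw [Set.range_comp, ← Submodule.map_span, B.span_eq, Submodule.map_top]
  rw [← hspan] at hchar
  refine K.isCosymplecticOn_of_isCompl F hy heven (b := b) hb (hchar _ ho) (W := LinearMap.range
    (mfderiv (𝓡 n) (𝓡 m) i y :
      EuclideanSpace ℝ (Fin n) →L[ℝ] EuclideanSpace ℝ (Fin m)).toLinearMap) ?_
  exact hspan ▸ hcompl

variable [IsManifold (𝓡 n) ∞ N]

/-- Frames restrict to small submanifolds. -/
theorem exists_lineFrame_restrictOpen (i : C^∞⟮𝓡 n, N; 𝓡 m, M⟯) {U : TopologicalSpace.Opens N}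
    {V : Set M} (F : LineFrame m L V) (hUV : ∀ y ∈ U, i y ∈ V) {y : N} (hy : y ∈ U)
    (hU : ∀ z ∈ U, z ∈ (chartAt (EuclideanSpace ℝ (Fin n)) y).source) :
    ∃ G : LineFrame n (restrictOpen i U *ᵖ L) Set.univ,
      G.e = (RegularMap.ofPullback L (restrictOpen i U)).sec F.e := by
  refine exists_lineFrame_univ _ (fun z => F.e_ne _ (hUV z.1 z.2)) (⟨y, hy⟩ : U) ?_
  refine Set.eq_univ_of_forall fun z => ?_
  have h : (chartAt (EuclideanSpace ℝ (Fin n)) (⟨y, hy⟩ : U)).source =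
      Subtype.val ⁻¹' (chartAt (EuclideanSpace ℝ (Fin n)) y).source :=
    OpenPartialHomeomorph.subtypeRestr_source _ ⟨⟨y, hy⟩⟩
  rw [h]
  exact hU z.1 z.2

/-- The points at which a submanifold is cosymplectic form an open set. -/
theorem exists_open_isCosymplecticOn (K : GenContactStructure m L) (i : C^∞⟮𝓡 n, N; 𝓡 m, M⟯)
    (hi : IsImmersedSubmanifold (m := m) (n := n) i) {V : Set M} (hV : IsOpen V)
    (F : LineFrame m L V) {y : N} (hy : i y ∈ V)
    (h : K.IsCosymplecticOn (x := i y) (Set.range (mfderiv (𝓡 n) (𝓡 m) i y))) :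
    ∃ U : TopologicalSpace.Opens N, y ∈ U ∧ (∀ z ∈ U, i z ∈ V) ∧
      (∀ z ∈ U, z ∈ (chartAt (EuclideanSpace ℝ (Fin n)) y).source) ∧
      ∀ z ∈ U, K.IsCosymplecticOn (x := i z) (Set.range (mfderiv (𝓡 n) (𝓡 m) i z)) := by
  -- Inside one chart and over `V` the pull-back bundle has a global frame, so the determinant is a
  -- smooth function on all of `U₀` and its nonvanishing locus is open.
  let U₀ : TopologicalSpace.Opens N :=
    ⟨(chartAt (EuclideanSpace ℝ (Fin n)) y).source ∩ i ⁻¹' V,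
      (chartAt (EuclideanSpace ℝ (Fin n)) y).open_source.inter
        (hV.preimage i.contMDiff.continuous)⟩
  have hy₀ : y ∈ U₀ := ⟨mem_chart_source _ y, hy⟩
  obtain ⟨G, hG⟩ := exists_lineFrame_restrictOpen i F (U := U₀) (fun z hz => hz.2) hy₀
    fun z hz => hz.1
  let P := RegularMap.ofPullback L (restrictOpen i U₀)
  have hiff : ∀ z : U₀, (P.liftMatrix K F G).det z ≠ 0 ↔
      K.IsCosymplecticOn (x := i z) (Set.range (mfderiv (𝓡 n) (𝓡 m) i z)) := fun z => by
    rw [P.det_liftMatrix_ne_zero_iff K F (y := z) hG z.2.2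
        (P.push_injective F G hG z.2.2 (mfderiv_restrictOpen_injective i hi U₀ z)),
      P.isCosymplecticAt_iff K F G z.2.2, range_mfderiv_restrictOpen]
    rfl
  have hopen : IsOpen {z : U₀ | (P.liftMatrix K F G).det z ≠ 0} :=
    isOpen_ne_fun (P.liftMatrix K F G).det.contMDiff.continuous continuous_const
  refine ⟨⟨Subtype.val '' {z : U₀ | (P.liftMatrix K F G).det z ≠ 0},
    U₀.isOpen.isOpenMap_subtype_val _ hopen⟩, ⟨⟨y, hy₀⟩, (hiff ⟨y, hy₀⟩).2 h, rfl⟩, ?_, ?_, ?_⟩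
  · rintro _ ⟨z, -, rfl⟩
    exact z.2.2
  · rintro _ ⟨z, -, rfl⟩
    exact z.2.1
  · rintro _ ⟨z, hz, rfl⟩
    exact (hiff z).1 hz

end Restriction

end

end GenContact

theorem mainTheorem9 {m n k : ℕ}
    {M : Type*} [TopologicalSpace M] [T2Space M] [SecondCountableTopology M]
    [ChartedSpace (EuclideanSpace ℝ (Fin m)) M] [IsManifold (𝓡 m) ∞ M]
    (L : M → Type*) [TopologicalSpace (Bundle.TotalSpace ℝ L)] [∀ x, AddCommGroup (L x)]
    [∀ x, Module ℝ (L x)] [∀ x, TopologicalSpace (L x)] [FiberBundle ℝ L] [VectorBundle ℝ ℝ L]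
    [ContMDiffVectorBundle ∞ ℝ L (𝓡 m)]
    (K : GenContact.GenContactStructure m L)
    {O : Type*} [TopologicalSpace O] [ChartedSpace (EuclideanSpace ℝ (Fin k)) O]
    [IsManifold (𝓡 k) ∞ O] (ι : O → M)
    (hleaf : K.IsCharacteristicLeaf (k := k) ι) (heven : Even k)
    {N : Type*} [TopologicalSpace N] [ChartedSpace (EuclideanSpace ℝ (Fin n)) N]
    [IsManifold (𝓡 n) ∞ N] (i : C^∞⟮𝓡 n, N; 𝓡 m, M⟯)
    (hN : GenContact.IsImmersedSubmanifold (m := m) (n := n) i)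
    (x₀ : M) (y₀ : N) (o₀ : O)
    (htrans : GenContact.IsTransversalAt (m := m) (n := n) (k := k) i ι y₀ o₀ x₀) :
    ∃ U : TopologicalSpace.Opens N, y₀ ∈ U ∧
      GenContact.IsGenContactType
        (GenContact.backwardImage L (GenContact.restrictOpen i U) K.eigenbundle) ∧
      ∃ KN : GenContact.GenContactStructure n (GenContact.restrictOpen i U *ᵖ L),
        KN.eigenbundle =
          GenContact.backwardImage L (GenContact.restrictOpen i U) K.eigenbundle := by
  obtain ⟨V, hV, hx, ⟨F⟩⟩ := GenContact.exists_lineFrame_nhds (m := m) (L := L) x₀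
  have hy : i y₀ ∈ V := htrans.1 ▸ hx
  obtain ⟨U, hyU, hUV, hUc, hT⟩ := GenContact.exists_open_isCosymplecticOn K i hN hV F hy
    (GenContact.isCosymplecticOn_of_isTransversalAt K hleaf.integral heven htrans F hy)
  obtain ⟨G, hG⟩ := GenContact.exists_lineFrame_restrictOpen i F hUV hyU hUc
  let P := GenContact.RegularMap.ofPullback L (GenContact.restrictOpen i U)
  have himm := GenContact.mfderiv_restrictOpen_injective i hN U
  have hcos : ∀ y : U, P.IsCosymplecticAt K y := fun y =>
    (P.isCosymplecticAt_iff K F G (hUV y.1 y.2)).2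
      (by rw [GenContact.range_mfderiv_restrictOpen]; exact hT y.1 y.2)
  obtain ⟨KN, hKN⟩ := P.exists_induced K F G hG (fun y => hUV y.1 y.2) himm hcos
  have heq : KN.eigenbundle =
      GenContact.backwardImage L (GenContact.restrictOpen i U) K.eigenbundle :=
    GenContact.RegularMap.eigenbundle_eq_backwardImage K KN hKN hcos fun y =>
      P.push_injective F G hG (hUV y.1 y.2) (himm y)
  exact ⟨U, hyU, heq ▸ KN.isGenContactType_eigenbundle G, KN, heq⟩
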